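/- **Setting.** Identify the momentum plane $\mathbb R^2$ with $\mathbb C$, put $\omega=e^{2\pi i/3}$, and let $\Lambda$ be the triangular reciprocal lattice generated by $b\neq 0$ and $\omega b$; the moiré Brillouin zone is $\mathbb C/\Lambda$, and $\Gamma_M=0$. Let $P(k)$ ($k\in\mathbb C$) be a smooth family of rank-2 orthogonal projections on a complex Hilbert space (the two nearly flat bands of valley $+$, spinless). It is periodic under a unitary representation $S_G$ of $\Lambda$, $P(k+G)=S_GP(k)S_G^{-1}$, it commutes with an antiunitary $T=C_{2z}\mathcal T$, $T^2=1$, and $C_{3z}P(k)C_{3z}^{-1}=P(\omega k)$ for a unitary $C_{3z}$ with $C_{3z}^3=1$; $T$ commutes with $S_G$ and $C_{3z}$, and $C_{3z}S_G=S_{\omega G}C_{3z}$. Valley $-$ is the image of valley $+$ under a unitary $C_{2z}$, which maps $k$ to $-k$. Fix a Chern gauge $u_k=(u_{k,1},u_{k,2})$: an orthonormal basis of the range of $P(k)$ with $Tu_{k,1}=u_{k,2}$, smooth on the plane, periodic up to phases ($u_{k+G,a}\in \mathrm U(1)\,S_Gu_{k,a}$), with $C_{3z}u_{\Gamma_M,a}=u_{\Gamma_M,a}$;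 use $u_{-,-k}=C_{2z}u_k$ in valley $-$. In this gauge, a smooth self-adjoint band Hamiltonian $P_h$ of valley $+$ that is periodic and invariant under $T$ and $C_{3z}$ reads $h_+(k)=\epsilon(k)+\mathrm{Re} f(k)\,\tau_x+\mathrm{Im} f(k)\,\tau_y$; its lower and upper bands are $E_1\le E_2$. A smooth, periodic, $T$-invariant, parity-even ($\Delta^T=\Delta$) intervalley pairing $P_\Delta(k)=u_k\Delta(k)\,(Tu_{-,-k})^\dagger$ has $\Delta=\Delta_\parallel+\Delta_\perp$ with $\Delta_\parallel=\mathrm{diag}(\overline{d_\parallel},d_\parallel)$ and $\Delta_\perp$ off-diagonal; write $|\Delta_\perp|=\sqrt{\mathrm{Tr}[\Delta_\perp\Delta_\perp^\dagger]/2}$. Let $\mathcal X$ be the set of all $(\mu,P_h,P_\parallel)$, with $P_\parallel$ a parity-even pairing as above with $\Delta_\perp=0$, such that * $P_\parallel$ is spontaneously nematic ($E$ irrep): $P_\parallel=a_1P_1+a_2P_2$ with $a_1,a_2\in\mathbb R$ and pairings $P_1,P_2$ of the same kind for which $C_{3z}(P_1\ P_2)C_{3z}^{-1}=(P_1\ P_2)\,e^{-i\tau_y2\pi/3}$;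 * $\mu\in[E_1(\Gamma_M),E_2(\Gamma_M)]$; * $d_\parallel$ has, modulo $\Lambda$, either exactly two zeros, each of winding number $1$, or exactly one zero, of winding number $2$ (counted as two winding-1 zeros at the same momentum). Give $\mathcal X$ the topology of uniform convergence of $P_h$, $P_\parallel$ with all their derivatives, and convergence of $\mu$. Let $\Sigma$ be the set of all zeros of $d_\parallel+isf$ and of $d_\parallel-isf$, $s\in[0,1]$, and $$E(\Sigma)=\Big\{\epsilon(k)\pm\sqrt{|f(k)|^2-|d_\parallel(k)|^2}\ :\ k\in\Sigma\Big\}.$$ For a pairing $P_\Delta$ let $$\mathcal H(k)=\begin{pmatrix}h_+(k)-\mu&\Delta(k)\\ \Delta(k)^\dagger&-(h_+(k)-\mu)^T\end{pmatrix}.$$ Nodal superconductivity is *enforced by a sufficiently dominant $\Delta_\parallel$* at $(\mu,P_h,P_\parallel)$ if there is $\lambda>0$ such that, for every smooth, periodic, $T$-invariant, parity-even pairing $P_\perp$ in the $\perp$ channel with $|\Delta_\perp(k)|<\lambda$ for all $k$, the matrix $\mathcal H(k)$ with $\Delta=\Delta_\parallel+\Delta_\perp$ has a zero eigenvalue for some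 $k$. **Proposition.** 1. For every element of $\mathcal X$, $d_\parallel(\Gamma_M)=0$, and $$[\epsilon(\Gamma_M)-|f(\Gamma_M)|,\ \epsilon(\Gamma_M)+|f(\Gamma_M)|]\subset E(\Sigma).$$ 2. For all elements of a dense countable intersection of open subsets of $\mathcal X$ (that is, unless fine-tuned), $\Sigma$ contains a continuous path from $\Gamma_M$ to a zero of $d_\parallel+if$ or of $d_\parallel-if$. 3. For all elements of an open dense subset of $\mathcal X$ (that is, unless fine-tuned), nodal superconductivity is enforced by a sufficiently dominant $\Delta_\parallel$. -/

import Mathlib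

open scoped ContDiff ComplexConjugate Topology

noncomputable section

/-! Crystal momenta form the plane `ℝ² = ℂ`, with `k = k_x + i k_y`; the three-fold rotation acts
as multiplication by `ω = exp (2πi/3)` and `Γ_M` is the point `0`. -/

/-- The rotation by `2π/3` of the momentum plane. -/
def omega3 : ℂ := Complex.exp (2 * Real.pi * Complex.I / 3)

/-- The (triangular) moiré reciprocal lattice generated by `b` and its rotation by `2π/3`.
The moiré Brillouin zone is the torus `ℂ / recipLattice b`. -/
def recipLattice (b : ℂ) : AddSubgroup ℂ := AddSubgroup.closure {b, omega3 * b}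

/-- The two nearly flat bands of valley `+`: a smooth family of rank-2 orthogonal projections
`P k = |u_k⟩⟨u_k|` on the Hilbert space of periodic parts of Bloch states, together with the
(spinless) symmetries: reciprocal translations `S G = e^{-iG·r}`, the antiunitary `T = C_{2z}𝒯`
(which fixes `k`) and `C3 = C_{3z}` (which maps `k` to `ω k`). -/
structure MoireBands (H : Type*) [NormedAddCommGroup H] [InnerProductSpace ℂ H]
    [CompleteSpace H] where
  b : ℂ
  b_ne : b ≠ 0
  S : ℂ → (H ≃ₗᵢ[ℂ] H)
  T : H ≃ₗᵢ⋆[ℂ] H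
  C3 : H ≃ₗᵢ[ℂ] H
  P : ℂ → (H →L[ℂ] H)
  -- relations of the symmetry group
  S_add : ∀ G ∈ recipLattice b, ∀ G' ∈ recipLattice b, ∀ x, S (G + G') x = S G (S G' x)
  T_T : ∀ x, T (T x) = x
  C3_cubed : ∀ x, C3 (C3 (C3 x)) = x
  T_S : ∀ G ∈ recipLattice b, ∀ x, T (S G x) = S G (T x)
  T_C3 : ∀ x, T (C3 x) = C3 (T x)
  C3_S : ∀ G ∈ recipLattice b, ∀ x, C3 (S G x) = S (omega3 * G) (C3 x)
  -- the bands and their symmetries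
  P_smooth : ContDiff ℝ ∞ P
  P_proj : ∀ k, IsStarProjection (P k)
  P_rank : ∀ k, Module.finrank ℂ (LinearMap.range (P k : H →ₗ[ℂ] H)) = 2
  P_S : ∀ G ∈ recipLattice b, ∀ k x, P (k + G) (S G x) = S G (P k x)
  P_T : ∀ k x, P k (T x) = T (P k x)
  P_C3 : ∀ k x, P (omega3 * k) (C3 x) = C3 (P k x)

section

variable {Hp Hm : Type*} [NormedAddCommGroup Hp] [InnerProductSpace ℂ Hp] [CompleteSpace Hp]
  [NormedAddCommGroup Hm] [InnerProductSpace ℂ Hm] [CompleteSpace Hm]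

/-- A Chern gauge: an orthonormal basis `u k 0, u k 1` of the two bands with
`C_{2z}𝒯 u = u τ_x`, whose one-band projections `|u_a⟩⟨u_a|` are smooth and periodic, and on which
`C_{3z}` acts trivially at `Γ_M`. The phases are chosen smoothly on the whole plane, so that `u` is
periodic up to a phase. -/
structure ChernGauge (B : MoireBands Hp) where
  u : ℂ → Fin 2 → Hp
  smooth : ∀ a, ContDiff ℝ ∞ (fun k => u k a)
  orthonormal : ∀ k, Orthonormal ℂ (u k)
  span_eq : ∀ k, Submodule.span ℂ (Set.range (u k)) = LinearMap.range (B.P k : Hp →ₗ[ℂ] Hp)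
  T_u : ∀ k, B.T (u k 0) = u k 1
  periodic : ∀ G ∈ recipLattice B.b, ∀ k a, ∃ c : ℂ, ‖c‖ = 1 ∧ u (k + G) a = c • B.S G (u k a)
  C3_Gamma : ∀ a, B.C3 (u 0 a) = u 0 a

/-- `Ph k = |u_k⟩ h_+(k) ⟨u_k|` for a smooth symmetric Hamiltonian `h_+` of the two bands. -/
structure IsBandHamiltonian (B : MoireBands Hp) (Ph : ℂ → (Hp →L[ℂ] Hp)) : Prop where
  smooth : ContDiff ℝ ∞ Ph
  selfAdjoint : ∀ k, IsSelfAdjoint (Ph k)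
  supp : ∀ k x, B.P k (Ph k (B.P k x)) = Ph k x
  periodic : ∀ G ∈ recipLattice B.b, ∀ k x, Ph (k + G) (B.S G x) = B.S G (Ph k x)
  c2t : ∀ k x, Ph k (B.T x) = B.T (Ph k x)
  c3 : ∀ k x, Ph (omega3 * k) (B.C3 x) = B.C3 (Ph k x)

/-! Valley `-` is the image of valley `+` under the unitary `C2 = C_{2z} : Hp → Hm`, which maps
`k` to `-k`: its Bloch basis is `u_{-,-k} = C2 u_{+,k}`, and its symmetries are
`C2 T C2⁻¹`, `C2 C3 C2⁻¹`, and `C2 (S G) C2⁻¹` for the translation by `-G`. -/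

/-- `D k = P_Δ(k) = |u_{+,k}⟩ Δ(k) ⟨C_{2z}𝒯 u_{-,-k}|` for a smooth, translation-invariant,
`C_{2z}𝒯`-invariant, parity-even (that is, `Δᵀ = Δ`) intervalley pairing. -/
structure IsPairing (B : MoireBands Hp) (C2 : Hp ≃ₗᵢ[ℂ] Hm) (D : ℂ → (Hm →L[ℂ] Hp)) : Prop where
  smooth : ContDiff ℝ ∞ D
  supp : ∀ k x, B.P k (D k (C2 (B.P k x))) = D k (C2 x)
  periodic : ∀ G ∈ recipLattice B.b, ∀ k x, D (k + G) (C2 (B.S G x)) = B.S G (D k (C2 x))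
  c2t : ∀ k x, D k (C2 (B.T x)) = B.T (D k (C2 x))
  parityEven : ∀ k x y, inner ℂ y (D k (C2 (B.T x))) = inner ℂ x (D k (C2 (B.T y)))

variable {B : MoireBands Hp}

/-- The matrix `h_+(k)` in the Chern gauge. -/
def hMat (g : ChernGauge B) (Ph : ℂ → (Hp →L[ℂ] Hp)) (k : ℂ) : Matrix (Fin 2) (Fin 2) ℂ :=
  Matrix.of fun a c => inner ℂ (g.u k a) (Ph k (g.u k c))

/-- The matrix `Δ(k)` in the Chern gauge:
`Δ_{ac} = ⟨u_{+,k,a}| P_Δ(k) |C_{2z}𝒯 u_{-,-k,c}⟩` with `C_{2z}𝒯 u_{-,-k,c} = C2 (T u_{+,k,c})`. -/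
def pairMat (C2 : Hp ≃ₗᵢ[ℂ] Hm) (g : ChernGauge B) (D : ℂ → (Hm →L[ℂ] Hp)) (k : ℂ) :
    Matrix (Fin 2) (Fin 2) ℂ :=
  Matrix.of fun a c => inner ℂ (g.u k a) (D k (C2 (B.T (g.u k c))))

/-- `|Δ(k)| = √(Tr[Δ(k) Δ(k)†] / 2)`. -/
def pairAmp (C2 : Hp ≃ₗᵢ[ℂ] Hm) (g : ChernGauge B) (D : ℂ → (Hm →L[ℂ] Hp)) (k : ℂ) : ℝ :=
  Real.sqrt (((pairMat C2 g D k) * (pairMat C2 g D k).conjTranspose).trace.re / 2)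

/-- The Euler obstructed channel `Δ_∥`: pairing of Chern states with equal Chern numbers. -/
def IsParallel (C2 : Hp ≃ₗᵢ[ℂ] Hm) (g : ChernGauge B) (D : ℂ → (Hm →L[ℂ] Hp)) : Prop :=
  ∀ k, pairMat C2 g D k 0 1 = 0 ∧ pairMat C2 g D k 1 0 = 0

/-- The trivial channel `Δ_⊥`: pairing of Chern states with opposite Chern numbers. -/
def IsPerp (C2 : Hp ≃ₗᵢ[ℂ] Hm) (g : ChernGauge B) (D : ℂ → (Hm →L[ℂ] Hp)) : Prop :=
  ∀ k, pairMat C2 g D k 0 0 = 0 ∧ pairMat C2 g D k 1 1 = 0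

/-- `D` is a real combination `a₁ D₁ + a₂ D₂` of the two components of an `E` irrep:
`C_{3z} (D₁ D₂) C_{3z}⁻¹ = (D₁ D₂) exp (-i τ_y 2π/3)`. -/
def IsNematic (C2 : Hp ≃ₗᵢ[ℂ] Hm) (g : ChernGauge B) (D : ℂ → (Hm →L[ℂ] Hp)) : Prop :=
  ∃ (a₁ a₂ : ℝ) (D₁ D₂ : ℂ → (Hm →L[ℂ] Hp)),
    IsPairing B C2 D₁ ∧ IsPairing B C2 D₂ ∧ IsParallel C2 g D₁ ∧ IsParallel C2 g D₂ ∧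
    (∀ k, D k = (a₁ : ℂ) • D₁ k + (a₂ : ℂ) • D₂ k) ∧
    (∀ k x, B.C3 (D₁ k (C2 x)) =
      (Real.cos (2 * Real.pi / 3) : ℂ) • D₁ (omega3 * k) (C2 (B.C3 x)) +
      (Real.sin (2 * Real.pi / 3) : ℂ) • D₂ (omega3 * k) (C2 (B.C3 x))) ∧
    (∀ k x, B.C3 (D₂ k (C2 x)) =
      (-Real.sin (2 * Real.pi / 3) : ℂ) • D₁ (omega3 * k) (C2 (B.C3 x)) +
      (Real.cos (2 * Real.pi / 3) : ℂ) • D₂ (omega3 * k) (C2 (B.C3 x)))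

/-- `h_+(k) = ε(k) + Re f(k) τ_x + Im f(k) τ_y` in the Chern gauge. -/
def epsFun (g : ChernGauge B) (Ph : ℂ → (Hp →L[ℂ] Hp)) (k : ℂ) : ℝ := (hMat g Ph k 0 0).re

def fFun (g : ChernGauge B) (Ph : ℂ → (Hp →L[ℂ] Hp)) (k : ℂ) : ℂ := hMat g Ph k 1 0

/-- `Δ_∥(k) = diag (conj (d_∥ k), d_∥ k)` in the Chern gauge. -/
def dFun (C2 : Hp ≃ₗᵢ[ℂ] Hm) (g : ChernGauge B) (D : ℂ → (Hm →L[ℂ] Hp)) (k : ℂ) : ℂ :=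
  pairMat C2 g D k 1 1

/-- The lower and the upper normal-state band: smallest and largest eigenvalue of `h_+(k)`. -/
def lowerBand (g : ChernGauge B) (Ph : ℂ → (Hp →L[ℂ] Hp)) (k : ℂ) : ℝ :=
  sInf {E : ℝ | (hMat g Ph k - (E : ℂ) • 1).det = 0}

def upperBand (g : ChernGauge B) (Ph : ℂ → (Hp →L[ℂ] Hp)) (k : ℂ) : ℝ :=
  sSup {E : ℝ | (hMat g Ph k - (E : ℂ) • 1).det = 0}

/-- `p` is not an accumulation point of zeros of `q`, and `arg q` winds `n` times along all small
counterclockwise circles around `p`. -/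
def HasWinding (q : ℂ → ℂ) (p : ℂ) (n : ℤ) : Prop :=
  ∀ᶠ r : ℝ in 𝓝[>] 0, (∀ t : ℝ, q (circleMap p r t) ≠ 0) ∧
    ∃ θ : ℝ → ℝ, Continuous θ ∧
      (∀ t, q (circleMap p r t) = ‖q (circleMap p r t)‖ * Complex.exp (θ t * Complex.I)) ∧
      θ (2 * Real.pi) - θ 0 = 2 * Real.pi * n

/-- Modulo the lattice, `q` has exactly two zeros of winding `1`, a zero of winding `2` being
counted as two zeros of winding `1` at the same momentum. -/
def HasTwoZeros (b : ℂ) (q : ℂ → ℂ) : Prop :=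
  ∃ p p' : ℂ, (∀ k, q k = 0 ↔ k - p ∈ recipLattice b ∨ k - p' ∈ recipLattice b) ∧
    ((p - p' ∉ recipLattice b ∧ HasWinding q p 1 ∧ HasWinding q p' 1) ∨
      (p - p' ∈ recipLattice b ∧ HasWinding q p 2))

/-- The variable data `(μ, P_{h,+}, P_∥)`. -/
structure MeanField (Hp Hm : Type*) [NormedAddCommGroup Hp] [InnerProductSpace ℂ Hp]
    [NormedAddCommGroup Hm] [InnerProductSpace ℂ Hm] where
  μ : ℝ
  Ph : ℂ → (Hp →L[ℂ] Hp)
  Ppar : ℂ → (Hm →L[ℂ] Hp)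

/-- The choices of `(μ, P_{h,+}, P_∥)` under consideration: spontaneously nematic parity-even
pairing, `μ ∈ [E₁(Γ_M), E₂(Γ_M)]`, and exactly two zeros of `Δ_∥`, with winding `1`. -/
structure Admissible (C2 : Hp ≃ₗᵢ[ℂ] Hm) (g : ChernGauge B) (x : MeanField Hp Hm) : Prop where
  band : IsBandHamiltonian B x.Ph
  pairing : IsPairing B C2 x.Ppar
  parallel : IsParallel C2 g x.Ppar
  nematic : IsNematic C2 g x.Ppar
  mu_mem : x.μ ∈ Set.Icc (lowerBand g x.Ph 0) (upperBand g x.Ph 0)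
  zeros : HasTwoZeros B.b (dFun C2 g x.Ppar)

/-- The set `Σ` of the zeros of `d_∥ ± i s f`, `s ∈ [0,1]`, as a periodic subset of the plane. -/
def SigmaSet (C2 : Hp ≃ₗᵢ[ℂ] Hm) (g : ChernGauge B) (x : MeanField Hp Hm) : Set ℂ :=
  {k | ∃ s ∈ Set.Icc (0 : ℝ) 1,
    dFun C2 g x.Ppar k + Complex.I * s * fFun g x.Ph k = 0 ∨
    dFun C2 g x.Ppar k - Complex.I * s * fFun g x.Ph k = 0}

/-- `E(Σ)`: the values of `ε ± √(|f|² - |d_∥|²)` on `Σ` (where `|d_∥| ≤ |f|`). -/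
def ESigma (C2 : Hp ≃ₗᵢ[ℂ] Hm) (g : ChernGauge B) (x : MeanField Hp Hm) : Set ℝ :=
  {E | ∃ k ∈ SigmaSet C2 g x,
    E = epsFun g x.Ph k + Real.sqrt (‖fFun g x.Ph k‖ ^ 2 - ‖dFun C2 g x.Ppar k‖ ^ 2) ∨
    E = epsFun g x.Ph k - Real.sqrt (‖fFun g x.Ph k‖ ^ 2 - ‖dFun C2 g x.Ppar k‖ ^ 2)}

/-- The Bogoliubov-de Gennes matrix with pairing `P_∥ + P_⊥`. In the gauge `u_{-,-k} = C2 u_{+,k}`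
the Hamiltonian `h_-(-k)` of valley `-` is `h_+(k)`. -/
def bdg (C2 : Hp ≃ₗᵢ[ℂ] Hm) (g : ChernGauge B) (x : MeanField Hp Hm)
    (Pperp : ℂ → (Hm →L[ℂ] Hp)) (k : ℂ) : Matrix (Fin 2 ⊕ Fin 2) (Fin 2 ⊕ Fin 2) ℂ :=
  Matrix.fromBlocks
    (hMat g x.Ph k - (x.μ : ℂ) • 1)
    (pairMat C2 g Pperp k + pairMat C2 g x.Ppar k)
    (pairMat C2 g Pperp k + pairMat C2 g x.Ppar k).conjTranspose
    (-(hMat g x.Ph k - (x.μ : ℂ) • 1).transpose)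

/-- Nodal superconductivity is enforced by a sufficiently dominant `Δ_∥`: there is `lam > 0` such
that the Bogoliubov-de Gennes matrix has a zero-energy node for every symmetry-preserving `P_⊥`
with `|Δ_⊥| < lam` everywhere. -/
def NodalEnforced (C2 : Hp ≃ₗᵢ[ℂ] Hm) (g : ChernGauge B) (x : MeanField Hp Hm) : Prop :=
  ∃ lam : ℝ, 0 < lam ∧ ∀ Pperp : ℂ → (Hm →L[ℂ] Hp),
    IsPairing B C2 Pperp → IsPerp C2 g Pperp → (∀ k, pairAmp C2 g Pperp k < lam) →
    ∃ k, (bdg C2 g x Pperp k).det = 0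

/-- `Σ` contains a continuous path from `Γ_M` to a zero of `d_∥ + i f` or of `d_∥ - i f`. -/
def HasNodalPath (C2 : Hp ≃ₗᵢ[ℂ] Hm) (g : ChernGauge B) (x : MeanField Hp Hm) : Prop :=
  ∃ γ : ℝ → ℂ, ContinuousOn γ (Set.Icc 0 1) ∧ γ 0 = 0 ∧
    (∀ t ∈ Set.Icc (0 : ℝ) 1, γ t ∈ SigmaSet C2 g x) ∧
    (dFun C2 g x.Ppar (γ 1) + Complex.I * fFun g x.Ph (γ 1) = 0 ∨
      dFun C2 g x.Ppar (γ 1) - Complex.I * fFun g x.Ph (γ 1) = 0)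

/-- `x` and `y` are `δ`-close together with all derivatives of order at most `r`. -/
def CloseTo (r : ℕ) (δ : ℝ) (x y : MeanField Hp Hm) : Prop :=
  |x.μ - y.μ| < δ ∧ ∀ j ≤ r, ∀ k : ℂ,
    ‖iteratedFDeriv ℝ j (fun q => x.Ph q - y.Ph q) k‖ < δ ∧
    ‖iteratedFDeriv ℝ j (fun q => x.Ppar q - y.Ppar q) k‖ < δ

/-- `U ∩ X` is open in `X` for the `C^∞` topology. -/
def RelOpen (X U : Set (MeanField Hp Hm)) : Prop :=
  ∀ x ∈ X ∩ U, ∃ (r : ℕ) (δ : ℝ), 0 < δ ∧ ∀ y ∈ X, CloseTo r δ x y → y ∈ U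

/-- `U ∩ X` is dense in `X` for the `C^∞` topology. -/
def RelDense (X U : Set (MeanField Hp Hm)) : Prop :=
  ∀ x ∈ X, ∀ (r : ℕ) (δ : ℝ), 0 < δ → ∃ y ∈ X ∩ U, CloseTo r δ x y

end

end

noncomputable section

/-! ### Continuous logarithms -/

/-! In the Chern gauge the off-diagonal element `f` of the Hamiltonian and the amplitude `d` of the
parallel pairing pick up the same phase under every lattice translation (`section_cocycle`): both
are sections of one line bundle over the Brillouin torus. All zeros of `d` have positive winding,
and the nematic symmetry puts one of them at Γ_M, since a rotation by 2π/3 of the plane fixes no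
nonzero vector.

The topological core is `false_of_removed_zero`. Let `q` be another section that equals `d` near
each of its own zeros but does not vanish at Γ_M. Then `q / d`, extended by 1 at the zeros of `q`,
is a doubly periodic function, continuous and nonvanishing except at the zeros of `d` that were
removed, where it has negative winding. The windings of such a function sum to zero on the torus, a
contradiction. That sum rule is proved with logarithms on strips: the increment of the logarithm
over one period jumps by 2πi times the winding whenever the strip crosses a puncture, and returns to
itself after a full translation.

Each existence statement assumes the conclusion false and then builds such a `q`. Nodes: the
Bogoliubov-de Gennes determinant vanishes as soon as `e² - a² - |f|² + |d|² = 0` and `Re (f conj d)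
= a e`, where `e = ε - μ` and `a` is the amplitude of the perpendicular channel. If these have no
common solution, `q = d + f (i s - r)` with cutoffs `s`, `r` removes the zero at Γ_M
(`exists_node_of_small_perturbation`). This needs the first expression, at `a = 0`, to be negative
at Γ_M and nonzero at the zeros of `d`; the case `a = 0` with variable energy gives the energy
window. Path: `Σ` is the set where `Re (f conj d) = 0` and `|d| ≤ |f|`. If no path in the zero set
`Z` of `Re (f conj d)` leads from Γ_M to `|d| ≥ |f|`, a relatively open and closed part `Q` of `Z`
containing Γ_M stays in `|d| < |f|`, and `q = d + i s f` works with `s = 1` on `Q` and `s = 0` near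
the rest of `Z` (`exists_joinedIn_norm_le`).

Genericity. For nodes it suffices to open the window at Γ_M and move `μ` off finitely many energies.
For paths, `Z` must be a regular curve on `Σ` away from the zeros of `d`. Replacing `f` by `f (1 + i
τ)` with a four-parameter family of invariant functions `τ` achieves this: irregularity imposes
three equations at a point of a plane, so the bad parameters form a null set
(`volume_fiber_eq_zero`, `ae_regular`). Near the zeros of `d` nothing is known about the shape of
`Z`, and paths into them are made by concatenating infinitely many pieces (`joinedIn_of_accesses`).
-/

theorem exists_continuousOn_log {U : Set ℂ} (hU : IsOpen U) (hc : Convex ℝ U) {w : ℂ → ℂ}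
    (hw : ContinuousOn w U) (h0 : ∀ k ∈ U, w k ≠ 0) :
    ∃ L : ℂ → ℂ, ContinuousOn L U ∧ ∀ k ∈ U, Complex.exp (L k) = w k := by
  rcases U.eq_empty_or_nonempty with rfl | hne
  · exact ⟨0, by simp, by simp⟩
  have hs : IsSimplyConnected U := by
    have := hc.contractibleSpace hne
    exact (inferInstance : SimplyConnectedSpace U)
  obtain ⟨L, hL, hL'⟩ := Complex.exists_continuousOn_eqOn_exp_comp hs hU hw (by
    rintro ⟨k, hk, hk0⟩
    exact h0 k hk hk0)
  exact ⟨L, hL, fun k hk => hL' hk⟩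

/-- Two continuous logarithms of the same function on a preconnected set differ by a constant. -/
theorem IsPreconnected.log_sub_log_eq {X : Type*} [TopologicalSpace X] {S : Set X}
    (hS : IsPreconnected S) {A B : X → ℂ} (hA : ContinuousOn A S) (hB : ContinuousOn B S)
    (h : ∀ x ∈ S, Complex.exp (A x) = Complex.exp (B x)) {x y : X} (hx : x ∈ S) (hy : y ∈ S) :
    A x - B x = A y - B y := by
  have hpi : (2 * (Real.pi : ℂ) * Complex.I) ≠ 0 := by simp [Real.pi_ne_zero]
  have key : ∀ z ∈ S, ∃ n : ℤ, A z - B z = n * (2 * Real.pi * Complex.I) := by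
    intro z hz
    obtain ⟨n, hn⟩ := Complex.exp_eq_exp_iff_exists_int.1 (h z hz)
    exact ⟨n, by rw [hn]; ring⟩
  have hcont : ContinuousOn (fun z => ((A z - B z) / (2 * Real.pi * Complex.I)).re) S :=
    Complex.continuous_re.comp_continuousOn ((hA.sub hB).div_const _)
  have hd : IsDiscrete (Set.range ((↑) : ℤ → ℝ)) :=
    Int.isClosedEmbedding_coe_real.isEmbedding.isDiscrete_range
  have hm : Set.MapsTo (fun z => ((A z - B z) / (2 * Real.pi * Complex.I)).re) S
      (Set.range ((↑) : ℤ → ℝ)) := by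
    intro z hz
    obtain ⟨n, hn⟩ := key z hz
    exact ⟨n, by simp only [hn]; rw [mul_div_cancel_right₀ _ hpi]; simp⟩
  have := hS.constant_of_mapsTo hd hcont hm hx hy
  obtain ⟨n, hn⟩ := key x hx
  obtain ⟨m, hm'⟩ := key y hy
  simp only [hn, hm'] at this ⊢
  rw [mul_div_cancel_right₀ _ hpi, mul_div_cancel_right₀ _ hpi] at this
  simp only [Complex.intCast_re, Int.cast_inj] at this
  rw [this]

/-! ### Winding numbers from logarithms on sectors -/

/-- The oriented area spanned by two vectors of the plane. -/
def cross (a k : ℂ) : ℝ := a.re * k.im - a.im * k.re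

theorem cross_continuous (a : ℂ) : Continuous (cross a) := by
  unfold cross; fun_prop

theorem cross_swap (a k : ℂ) : cross a k = -cross k a := by unfold cross; ring

theorem cross_add_right (a k l : ℂ) : cross a (k + l) = cross a k + cross a l := by
  simp only [cross, Complex.add_re, Complex.add_im]; ring

theorem cross_add_left (a k l : ℂ) : cross (k + l) a = cross k a + cross l a := by
  simp only [cross, Complex.add_re, Complex.add_im]; ring

theorem cross_sub_right (a k l : ℂ) : cross a (k - l) = cross a k - cross a l := by
  simp only [cross, Complex.sub_re, Complex.sub_im]; ring

theorem cross_sub_left (a k l : ℂ) : cross (k - l) a = cross k a - cross l a := by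
  simp only [cross, Complex.sub_re, Complex.sub_im]; ring

theorem cross_smul_right (a : ℂ) (r : ℝ) (k : ℂ) : cross a (r * k) = r * cross a k := by
  simp [cross]; ring

theorem cross_smul_left (a : ℂ) (r : ℝ) (k : ℂ) : cross (r * k) a = r * cross k a := by
  simp [cross]; ring

@[simp] theorem cross_same (a : ℂ) : cross a a = 0 := by simp [cross]; ring

theorem cross_exp (ρ r s t : ℝ) :
    cross (ρ * Complex.exp (s * Complex.I)) (r * Complex.exp (t * Complex.I)) =
      ρ * r * Real.sin (t - s) := by
  simp only [cross, Complex.mul_re, Complex.mul_im, Complex.ofReal_re, Complex.ofReal_im,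
    Complex.exp_ofReal_mul_I_re, Complex.exp_ofReal_mul_I_im, Real.sin_sub]
  ring

theorem convex_cross_lt (a : ℂ) (c : ℝ) : Convex ℝ {k | cross a k < c} := by
  refine convex_halfSpace_lt ⟨fun x y => cross_add_right a x y, fun r x => ?_⟩ c
  simp only [Complex.real_smul, cross_smul_right, smul_eq_mul]

theorem convex_lt_cross (a : ℂ) (c : ℝ) : Convex ℝ {k | c < cross a k} := by
  refine convex_halfSpace_gt ⟨fun x y => cross_add_right a x y, fun r x => ?_⟩ c
  simp only [Complex.real_smul, cross_smul_right, smul_eq_mul]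

/-- Along an arc, the increments of an argument and of a logarithm agree. -/
theorem arg_increment_eq_log_increment {w : ℂ → ℂ} {c : ℝ → ℂ} {θ : ℝ → ℝ} (hc : Continuous c)
    (hθ : Continuous θ)
    (hw : ∀ t, w (c t) = ‖w (c t)‖ * Complex.exp (θ t * Complex.I)) {m m' : ℝ} (hm : m ≤ m')
    {S : Set ℂ} {L : ℂ → ℂ} (hL : ContinuousOn L S) (hLw : ∀ k ∈ S, Complex.exp (L k) = w k)
    (hS : ∀ t ∈ Set.Icc m m', c t ∈ S) :
    (L (c m')).im - (L (c m)).im = θ m' - θ m := by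
  have hLc : ContinuousOn (fun t => L (c t)) (Set.Icc m m') := hL.comp hc.continuousOn hS
  have h1 : ContinuousOn (fun t => (((L (c t)).im : ℂ) * Complex.I)) (Set.Icc m m') :=
    (Complex.continuous_ofReal.comp_continuousOn
      (Complex.continuous_im.comp_continuousOn hLc)).mul continuousOn_const
  have h2 : ContinuousOn (fun t => ((θ t : ℂ) * Complex.I)) (Set.Icc m m') := by fun_prop
  have := (isPreconnected_Icc (a := m) (b := m')).log_sub_log_eq h1 h2 (by
    intro t ht
    have e1 := hLw _ (hS t ht)
    have e2 := hw t
    rw [← e1, Complex.norm_exp] at e2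
    have e3 : Complex.exp (L (c t)) =
        Complex.exp ((L (c t)).re : ℂ) * Complex.exp ((L (c t)).im * Complex.I) := by
      rw [← Complex.exp_add, Complex.re_add_im]
    rw [e3, Complex.ofReal_exp] at e2
    exact mul_left_cancel₀ (Complex.exp_ne_zero _) e2)
    (Set.left_mem_Icc.2 hm) (Set.right_mem_Icc.2 hm)
  rw [← sub_mul, ← sub_mul] at this
  have := mul_right_cancel₀ Complex.I_ne_zero this
  have := congrArg Complex.re this
  simp at this
  linarith

/-- A small circle is cut into four arcs, each lying in one of the half discs bounded by the
directions `e₁`, `e₂`. On each arc the increment of the argument is that of the imaginary part of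
the local logarithm; the sum telescopes, leaving only the mismatches of consecutive logarithms at
the four corners. -/
theorem winding_eq_of_sectors {w : ℂ → ℂ} {z : ℂ} {n : ℤ} (hw : HasWinding w z n) {e₁ e₂ : ℂ}
    (he : 0 < cross e₁ e₂) {R : ℝ} (hR : 0 < R) {LR LT LL LB : ℂ → ℂ}
    (hLR : ContinuousOn LR {k | ‖k - z‖ < R ∧ cross e₂ (k - z) < 0})
    (hLR' : ∀ k, ‖k - z‖ < R → cross e₂ (k - z) < 0 → Complex.exp (LR k) = w k)
    (hLT : ContinuousOn LT {k | ‖k - z‖ < R ∧ 0 < cross e₁ (k - z)})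
    (hLT' : ∀ k, ‖k - z‖ < R → 0 < cross e₁ (k - z) → Complex.exp (LT k) = w k)
    (hLL : ContinuousOn LL {k | ‖k - z‖ < R ∧ 0 < cross e₂ (k - z)})
    (hLL' : ∀ k, ‖k - z‖ < R → 0 < cross e₂ (k - z) → Complex.exp (LL k) = w k)
    (hLB : ContinuousOn LB {k | ‖k - z‖ < R ∧ cross e₁ (k - z) < 0})
    (hLB' : ∀ k, ‖k - z‖ < R → cross e₁ (k - z) < 0 → Complex.exp (LB k) = w k)
    {c₁ c₂ c₃ c₄ : ℂ}
    (h₁ : ∀ k, ‖k - z‖ < R → cross e₂ (k - z) < 0 → 0 < cross e₁ (k - z) → LR k - LT k = c₁)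
    (h₂ : ∀ k, ‖k - z‖ < R → 0 < cross e₂ (k - z) → 0 < cross e₁ (k - z) → LT k - LL k = c₂)
    (h₃ : ∀ k, ‖k - z‖ < R → 0 < cross e₂ (k - z) → cross e₁ (k - z) < 0 → LL k - LB k = c₃)
    (h₄ : ∀ k, ‖k - z‖ < R → cross e₂ (k - z) < 0 → cross e₁ (k - z) < 0 → LB k - LR k = c₄) :
    (c₁ + c₂ + c₃ + c₄).im = 2 * Real.pi * n := by
  obtain ⟨r, ⟨hr0, θ, hθ, hwθ, hθn⟩, hr, hrR⟩ :=
    (Filter.Eventually.and hw (Ioo_mem_nhdsGT hR)).exists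
  have he1 : e₁ ≠ 0 := by rintro rfl; simp [cross] at he
  have he2 : e₂ ≠ 0 := by rintro rfl; simp [cross] at he
  have hpi := Real.pi_pos
  -- polar forms of the two basis vectors
  set t₀ := e₁.arg
  set β := (e₂ / e₁).arg
  have hE1 : e₁ = ((‖e₁‖ : ℝ) : ℂ) * Complex.exp (t₀ * Complex.I) :=
    (Complex.norm_mul_exp_arg_mul_I e₁).symm
  have hE2 : e₂ = ((‖e₂‖ : ℝ) : ℂ) * Complex.exp ((t₀ + β : ℝ) * Complex.I) := by
    have h3 : ((‖e₂ / e₁‖ : ℝ) : ℂ) * Complex.exp (β * Complex.I) = e₂ / e₁ :=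
      Complex.norm_mul_exp_arg_mul_I (e₂ / e₁)
    have h4 : ((‖e₂ / e₁‖ : ℝ) : ℂ) * ((‖e₁‖ : ℝ) : ℂ) = ((‖e₂‖ : ℝ) : ℂ) := by
      rw [← Complex.ofReal_mul, norm_div, div_mul_cancel₀ _ (norm_ne_zero_iff.2 he1)]
    calc e₂ = (e₂ / e₁) * e₁ := by field_simp
      _ = (((‖e₂ / e₁‖ : ℝ) : ℂ) * Complex.exp (β * Complex.I)) *
          (((‖e₁‖ : ℝ) : ℂ) * Complex.exp (t₀ * Complex.I)) := by rw [h3, ← hE1]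
      _ = _ := by
        rw [← h4]
        push_cast
        rw [add_mul, Complex.exp_add]
        ring
  have hn1 : 0 < ‖e₁‖ := norm_pos_iff.2 he1
  have hn2 : 0 < ‖e₂‖ := norm_pos_iff.2 he2
  have hsinβ : 0 < Real.sin β := by
    rw [hE1, hE2, cross_exp] at he
    rw [show t₀ + β - t₀ = β by ring] at he
    exact pos_of_mul_pos_right he (by positivity)
  have hβ0 : 0 < β := by
    by_contra h
    exact absurd (Real.sin_nonpos_of_nonpos_of_neg_pi_le (not_lt.1 h)
      (Complex.neg_pi_lt_arg _).le) (not_le.2 hsinβ)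
  have hβπ : β < Real.pi := by
    refine lt_of_le_of_ne (Complex.arg_le_pi _) fun h => ?_
    rw [h, Real.sin_pi] at hsinβ
    exact lt_irrefl _ hsinβ
  have hc : Continuous (circleMap z r) := continuous_circleMap z r
  have hcn : ∀ t, ‖circleMap z r t - z‖ < R := by
    intro t; simp [circleMap, abs_of_pos hr, hrR]
  have hX1 : ∀ t, cross e₁ (circleMap z r t - z) = ‖e₁‖ * r * Real.sin (t - t₀) := by
    intro t
    rw [circleMap, add_sub_cancel_left]
    conv_lhs => rw [hE1]
    rw [cross_exp]
  have hX2 : ∀ t, cross e₂ (circleMap z r t - z) = ‖e₂‖ * r * Real.sin (t - t₀ - β) := by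
    intro t
    rw [circleMap, add_sub_cancel_left]
    conv_lhs => rw [hE2]
    rw [cross_exp]; ring_nf
  have hp1 : 0 < ‖e₁‖ * r := by positivity
  have hp2 : 0 < ‖e₂‖ * r := by positivity
  have p1 : ∀ t, t₀ < t → t < t₀ + Real.pi → 0 < cross e₁ (circleMap z r t - z) := by
    intro t h h'
    rw [hX1]
    exact mul_pos hp1 (Real.sin_pos_of_pos_of_lt_pi (by linarith) (by linarith))
  have n1 : ∀ t, t₀ + Real.pi < t → t < t₀ + 2 * Real.pi →
      cross e₁ (circleMap z r t - z) < 0 := by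
    intro t h h'
    rw [hX1, show t - t₀ = (t - t₀ - 2 * Real.pi) + 2 * Real.pi by ring, Real.sin_add_two_pi]
    exact mul_neg_of_pos_of_neg hp1 (Real.sin_neg_of_neg_of_neg_pi_lt (by linarith) (by linarith))
  have p2 : ∀ t, t₀ + β < t → t < t₀ + β + Real.pi → 0 < cross e₂ (circleMap z r t - z) := by
    intro t h h'
    rw [hX2]
    exact mul_pos hp2 (Real.sin_pos_of_pos_of_lt_pi (by linarith) (by linarith))
  have n2 : ∀ t, t₀ + β - Real.pi < t → t < t₀ + β → cross e₂ (circleMap z r t - z) < 0 := by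
    intro t h h'
    rw [hX2]
    exact mul_neg_of_pos_of_neg hp2 (Real.sin_neg_of_neg_of_neg_pi_lt (by linarith) (by linarith))
  have n2' : ∀ t, t₀ + β + Real.pi < t → t < t₀ + β + 2 * Real.pi →
      cross e₂ (circleMap z r t - z) < 0 := by
    intro t h h'
    rw [hX2, show t - t₀ - β = (t - t₀ - β - 2 * Real.pi) + 2 * Real.pi by ring,
      Real.sin_add_two_pi]
    exact mul_neg_of_pos_of_neg hp2 (Real.sin_neg_of_neg_of_neg_pi_lt (by linarith) (by linarith))
  -- the four corner angles
  set m₁ := t₀ + β / 2 with hm₁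
  set m₂ := t₀ + β / 2 + Real.pi / 2 with hm₂
  set m₃ := t₀ + β / 2 + Real.pi with hm₃
  set m₄ := t₀ + β / 2 + Real.pi / 2 + Real.pi with hm₄
  set m₅ := t₀ + β / 2 + 2 * Real.pi with hm₅
  have a₁ := arg_increment_eq_log_increment hc hθ hwθ (m := m₁) (m' := m₂) (by linarith) hLT
    (fun k hk => hLT' k hk.1 hk.2)
    (fun t ht => ⟨hcn t, p1 t (by linarith [ht.1]) (by linarith [ht.2])⟩)
  have a₂ := arg_increment_eq_log_increment hc hθ hwθ (m := m₂) (m' := m₃) (by linarith) hLL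
    (fun k hk => hLL' k hk.1 hk.2)
    (fun t ht => ⟨hcn t, p2 t (by linarith [ht.1]) (by linarith [ht.2])⟩)
  have a₃ := arg_increment_eq_log_increment hc hθ hwθ (m := m₃) (m' := m₄) (by linarith) hLB
    (fun k hk => hLB' k hk.1 hk.2)
    (fun t ht => ⟨hcn t, n1 t (by linarith [ht.1]) (by linarith [ht.2])⟩)
  have a₄ := arg_increment_eq_log_increment hc hθ hwθ (m := m₄) (m' := m₅) (by linarith) hLR
    (fun k hk => hLR' k hk.1 hk.2)
    (fun t ht => ⟨hcn t, n2' t (by linarith [ht.1]) (by linarith [ht.2])⟩)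
  have hper : circleMap z r m₅ = circleMap z r m₁ := periodic_circleMap z r m₁
  have b₁ := h₁ _ (hcn m₁) (n2 m₁ (by linarith) (by linarith)) (p1 m₁ (by linarith) (by linarith))
  have b₂ := h₂ _ (hcn m₂) (p2 m₂ (by linarith) (by linarith)) (p1 m₂ (by linarith) (by linarith))
  have b₃ := h₃ _ (hcn m₃) (p2 m₃ (by linarith) (by linarith)) (n1 m₃ (by linarith) (by linarith))
  have b₄ := h₄ _ (hcn m₄) (n2' m₄ (by linarith) (by linarith)) (n1 m₄ (by linarith) (by linarith))
  -- the increment of the argument over a period does not depend on the starting point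
  have hshift : θ (m₁ + 2 * Real.pi) - θ m₁ = θ (0 + 2 * Real.pi) - θ 0 := by
    have h1 : ContinuousOn (fun t : ℝ => ((θ (t + 2 * Real.pi) : ℂ) * Complex.I)) Set.univ := by
      fun_prop
    have h2 : ContinuousOn (fun t : ℝ => ((θ t : ℂ) * Complex.I)) Set.univ := by fun_prop
    have := isPreconnected_univ.log_sub_log_eq h1 h2 (by
      intro t _
      have e1 := hwθ t
      have e2 := hwθ (t + 2 * Real.pi)
      rw [periodic_circleMap z r t, e1] at e2
      simp only [norm_mul, Complex.norm_real, norm_norm, Complex.norm_exp_ofReal_mul_I,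
        mul_one] at e2
      exact (mul_left_cancel₀ (by simpa using hr0 t) e2).symm) (Set.mem_univ m₁) (Set.mem_univ 0)
    rw [← sub_mul, ← sub_mul] at this
    exact_mod_cast mul_right_cancel₀ Complex.I_ne_zero this
  rw [zero_add, hθn] at hshift
  rw [hper] at a₄
  have hm5 : m₁ + 2 * Real.pi = m₅ := by rw [hm₁, hm₅]
  rw [hm5] at hshift
  rw [← b₁, ← b₂, ← b₃, ← b₄]
  simp only [Complex.add_im, Complex.sub_im]
  linarith

end

noncomputable section

/-! ### Doubly periodic functions with punctures -/

/-- The increment of a logarithm over a period jumps by the winding number when the strip crosses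
a line of punctures. -/
theorem strip_jump {w : ℂ → ℂ} {e₁ e₂ : ℂ} (he : 0 < cross e₁ e₂) (hper : ∀ k, w (k + e₂) = w k)
    {z : ℂ} {a c : ℝ} (ha : a < cross e₂ z) (hc : cross e₂ z < c)
    (hgood : ∀ k, a < cross e₂ k → cross e₂ k < c → (∀ j : ℤ, k ≠ z + j * e₂) →
      ContinuousAt w k ∧ w k ≠ 0)
    {LL LR : ℂ → ℂ} {nL nR : ℂ}
    (hLR : ContinuousOn LR {k | a < cross e₂ k ∧ cross e₂ k < cross e₂ z})
    (hLR' : ∀ k, a < cross e₂ k → cross e₂ k < cross e₂ z → Complex.exp (LR k) = w k)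
    (hnR : ∀ k, a < cross e₂ k → cross e₂ k < cross e₂ z → LR (k + e₂) - LR k = nR)
    (hLL : ContinuousOn LL {k | cross e₂ z < cross e₂ k ∧ cross e₂ k < c})
    (hLL' : ∀ k, cross e₂ z < cross e₂ k → cross e₂ k < c → Complex.exp (LL k) = w k)
    (hnL : ∀ k, cross e₂ z < cross e₂ k → cross e₂ k < c → LL (k + e₂) - LL k = nL)
    {n : ℤ} (hw : HasWinding w z n) : (nR - nL).im = 2 * Real.pi * n := by
  set D := cross e₁ e₂ with hD
  have h2 : ∀ k, cross e₂ (k + e₂) = cross e₂ k := by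
    intro k; rw [cross_add_right, cross_same, add_zero]
  have h1 : ∀ k, cross e₁ (k + e₂) = cross e₁ k + D := by
    intro k; rw [cross_add_right]
  -- the rectangle between two consecutive punctures
  set U : Set ℂ := ({k | a < cross e₂ k} ∩ {k | cross e₂ k < c}) ∩
    ({k | cross e₁ z < cross e₁ k} ∩ {k | cross e₁ k < cross e₁ z + D}) with hU
  have hUo : IsOpen U :=
    ((isOpen_lt continuous_const (cross_continuous _)).inter
      (isOpen_lt (cross_continuous _) continuous_const)).inter
    ((isOpen_lt continuous_const (cross_continuous _)).inter
      (isOpen_lt (cross_continuous _) continuous_const))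
  have hUc : Convex ℝ U :=
    ((convex_lt_cross _ _).inter (convex_cross_lt _ _)).inter
      ((convex_lt_cross _ _).inter (convex_cross_lt _ _))
  have hUg : ∀ k ∈ U, ContinuousAt w k ∧ w k ≠ 0 := by
    rintro k ⟨⟨k1, k2⟩, k3, k4⟩
    refine hgood k k1 k2 fun j hj => ?_
    simp only [Set.mem_ofPred_eq, hj, cross_add_right] at k3 k4
    rw [show ((j : ℂ) * e₂) = ((j : ℝ) : ℂ) * e₂ by push_cast; ring, cross_smul_right] at k3 k4
    have k5 : 0 < (j : ℝ) := pos_of_mul_pos_left (by linarith : 0 < (j : ℝ) * cross e₁ e₂) he.le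
    have k6 : (j : ℝ) < 1 := by
      by_contra h
      have : 1 * cross e₁ e₂ ≤ j * cross e₁ e₂ := mul_le_mul_of_nonneg_right (not_lt.1 h) he.le
      linarith
    have k7 : (0 : ℤ) < j := by exact_mod_cast k5
    have k8 : j < (1 : ℤ) := by exact_mod_cast k6
    omega
  obtain ⟨LT, hLT, hLT'⟩ := exists_continuousOn_log hUo hUc
    (fun k hk => (hUg k hk).1.continuousWithinAt) (fun k hk => (hUg k hk).2)
  -- the differences of logarithms on the two halves of the rectangle
  have hR : ∃ α : ℂ, ∀ k ∈ U, cross e₂ k < cross e₂ z → LR k - LT k = α := by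
    have hconv : IsPreconnected (U ∩ {k | cross e₂ k < cross e₂ z}) :=
      (hUc.inter (convex_cross_lt _ _)).isPreconnected
    rcases (U ∩ {k | cross e₂ k < cross e₂ z}).eq_empty_or_nonempty with hE | ⟨k₀, hk₀⟩
    · exact ⟨0, fun k hk hk' => absurd (hE ▸ (⟨hk, hk'⟩ : k ∈ U ∩ _)) (Set.notMem_empty k)⟩
    refine ⟨LR k₀ - LT k₀, fun k hk hk' => ?_⟩
    refine hconv.log_sub_log_eq (hLR.mono fun q hq => ⟨hq.1.1.1, hq.2⟩)
      (hLT.mono fun q hq => hq.1) (fun q hq => ?_) ⟨hk, hk'⟩ hk₀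
    rw [hLR' q hq.1.1.1 hq.2, hLT' q hq.1]
  have hL : ∃ β : ℂ, ∀ k ∈ U, cross e₂ z < cross e₂ k → LL k - LT k = β := by
    have hconv : IsPreconnected (U ∩ {k | cross e₂ z < cross e₂ k}) :=
      (hUc.inter (convex_lt_cross _ _)).isPreconnected
    rcases (U ∩ {k | cross e₂ z < cross e₂ k}).eq_empty_or_nonempty with hE | ⟨k₀, hk₀⟩
    · exact ⟨0, fun k hk hk' => absurd (hE ▸ (⟨hk, hk'⟩ : k ∈ U ∩ _)) (Set.notMem_empty k)⟩
    refine ⟨LL k₀ - LT k₀, fun k hk hk' => ?_⟩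
    refine hconv.log_sub_log_eq (hLL.mono fun q hq => ⟨hq.2, hq.1.1.2⟩)
      (hLT.mono fun q hq => hq.1) (fun q hq => ?_) ⟨hk, hk'⟩ hk₀
    rw [hLL' q hq.2 hq.1.1.2, hLT' q hq.1]
  obtain ⟨α, hα⟩ := hR
  obtain ⟨β, hβ⟩ := hL
  -- a small disc around the puncture
  have hnear : ∀ᶠ k in 𝓝 z, (a < cross e₂ k ∧ cross e₂ k < c) ∧
      (cross e₁ z - D < cross e₁ k ∧ cross e₁ k < cross e₁ z + D) :=
    (((cross_continuous e₂).continuousAt.eventually_const_lt ha).and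
      ((cross_continuous e₂).continuousAt.eventually_lt_const hc)).and
    (((cross_continuous e₁).continuousAt.eventually_const_lt (by linarith)).and
      ((cross_continuous e₁).continuousAt.eventually_lt_const (by linarith)))
  obtain ⟨R, hR0, hR⟩ := Metric.eventually_nhds_iff.1 hnear
  have hR' : ∀ k, ‖k - z‖ < R → (a < cross e₂ k ∧ cross e₂ k < c) ∧
      (cross e₁ z - D < cross e₁ k ∧ cross e₁ k < cross e₁ z + D) :=
    fun k hk => hR (by rwa [dist_eq_norm])
  have hTU : ∀ k, ‖k - z‖ < R → 0 < cross e₁ (k - z) → k ∈ U := by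
    intro k hk h
    rw [cross_sub_right] at h
    exact ⟨(hR' k hk).1, by simpa using h, (hR' k hk).2.2⟩
  have hBU : ∀ k, ‖k - z‖ < R → cross e₁ (k - z) < 0 → k + e₂ ∈ U := by
    intro k hk h
    rw [cross_sub_right] at h
    refine ⟨⟨?_, ?_⟩, ?_, ?_⟩
    · simpa [h2] using (hR' k hk).1.1
    · simpa [h2] using (hR' k hk).1.2
    · simp only [Set.mem_ofPred_eq, h1]; linarith [(hR' k hk).2.1]
    · simp only [Set.mem_ofPred_eq, h1]; linarith
  -- Around the puncture, the upper half disc lies in the rectangle and the lower one in its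
  -- translate by `-e₂`, so one logarithm `LT` serves both. The four mismatches `α`, `-β`, `β - nL`,
  -- `nR - α` add up to `nR - nL`.
  have key := winding_eq_of_sectors hw he hR0 (LR := LR) (LT := LT) (LL := LL)
    (LB := fun k => LT (k + e₂)) (c₁ := α) (c₂ := -β) (c₃ := β - nL) (c₄ := nR - α)
    (hLR.mono fun k hk => by
      have := hk.2
      rw [cross_sub_right] at this
      exact ⟨(hR' k hk.1).1.1, by linarith⟩)
    (fun k hk h => hLR' k (hR' k hk).1.1 (by rw [cross_sub_right] at h; linarith))
    (hLT.mono fun k hk => hTU k hk.1 hk.2)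
    (fun k hk h => hLT' k (hTU k hk h))
    (hLL.mono fun k hk => by
      have := hk.2
      rw [cross_sub_right] at this
      exact ⟨by linarith, (hR' k hk.1).1.2⟩)
    (fun k hk h => hLL' k (by rw [cross_sub_right] at h; linarith) (hR' k hk).1.2)
    (hLT.comp (by fun_prop) fun k hk => hBU k hk.1 hk.2)
    (fun k hk h => by rw [hLT' _ (hBU k hk h), hper])
    (fun k hk h h' => hα k (hTU k hk h') (by rw [cross_sub_right] at h; linarith))
    (fun k hk h h' => by
      rw [← hβ k (hTU k hk h') (by rw [cross_sub_right] at h; linarith)]; ring)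
    (fun k hk h h' => by
      have h4 : cross e₂ z < cross e₂ k := by rw [cross_sub_right] at h; linarith
      rw [← hβ _ (hBU k hk h') (by rw [h2]; exact h4), ← hnL k h4 (hR' k hk).1.2]; ring)
    (fun k hk h h' => by
      have h4 : cross e₂ k < cross e₂ z := by rw [cross_sub_right] at h; linarith
      rw [← hα _ (hBU k hk h') (by rw [h2]; exact h4), ← hnR k (hR' k hk).1.1 h4]; ring)
  rw [← key]
  congr 1
  ring

/-- A logarithm on a strip, together with its constant increment over a period. -/
theorem exists_log_on_strip {w : ℂ → ℂ} {e₂ : ℂ} (hper : ∀ k, w (k + e₂) = w k)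
    {a c : ℝ} (hgood : ∀ k, a < cross e₂ k → cross e₂ k < c → ContinuousAt w k ∧ w k ≠ 0) :
    ∃ (L : ℂ → ℂ) (n : ℂ), ContinuousOn L {k | a < cross e₂ k ∧ cross e₂ k < c} ∧
      (∀ k, a < cross e₂ k → cross e₂ k < c → Complex.exp (L k) = w k) ∧
      (∀ k, a < cross e₂ k → cross e₂ k < c → L (k + e₂) - L k = n) := by
  set U : Set ℂ := {k | a < cross e₂ k} ∩ {k | cross e₂ k < c} with hU
  have hUo : IsOpen U := (isOpen_lt continuous_const (cross_continuous _)).inter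
      (isOpen_lt (cross_continuous _) continuous_const)
  have hUc : Convex ℝ U := (convex_lt_cross _ _).inter (convex_cross_lt _ _)
  have h2 : ∀ k ∈ U, k + e₂ ∈ U := by
    rintro k ⟨h, h'⟩
    simp only [hU, Set.mem_inter_iff, Set.mem_ofPred_eq, cross_add_right, cross_same, add_zero]
    exact ⟨h, h'⟩
  obtain ⟨L, hL, hL'⟩ := exists_continuousOn_log hUo hUc
    (fun k hk => (hgood k hk.1 hk.2).1.continuousWithinAt) (fun k hk => (hgood k hk.1 hk.2).2)
  rcases U.eq_empty_or_nonempty with hE | ⟨k₀, hk₀⟩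
  · have : ∀ k, a < cross e₂ k → cross e₂ k < c → False :=
      fun k h h' => absurd (hE ▸ (⟨h, h'⟩ : k ∈ U)) (Set.notMem_empty k)
    exact ⟨L, 0, hL, fun k h h' => (this k h h').elim, fun k h h' => (this k h h').elim⟩
  refine ⟨L, L (k₀ + e₂) - L k₀, hL, fun k h h' => hL' k ⟨h, h'⟩, fun k h h' => ?_⟩
  refine hUc.isPreconnected.log_sub_log_eq (A := fun k => L (k + e₂))
    (hL.comp (by fun_prop) h2) hL (fun q hq => ?_) ⟨h, h'⟩ hk₀
  rw [hL' _ (h2 q hq), hL' q hq, hper]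

/-- Between two neighbouring lines of punctures there is a single strip, and its translate by `e₁`
lies on the other side of the line. Both sides thus have the same increment over `e₂`, and the jump
across the line is zero. -/
theorem winding_eq_zero_of_one_puncture {w : ℂ → ℂ} {e₁ e₂ : ℂ} (he : 0 < cross e₁ e₂)
    (hper₁ : ∀ k, w (k + e₁) = w k) (hper₂ : ∀ k, w (k + e₂) = w k) {p : ℂ}
    (hgood : ∀ k, (∀ i j : ℤ, k ≠ p + i * e₁ + j * e₂) → ContinuousAt w k ∧ w k ≠ 0)
    {m : ℤ} (hw : HasWinding w p m) : m = 0 := by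
  set D := cross e₁ e₂ with hD
  have h1 : ∀ k, cross e₂ (k - e₁) = cross e₂ k + D := by
    intro k; rw [cross_sub_right, cross_swap e₂ e₁]; ring
  have hline : ∀ i j : ℤ, cross e₂ (p + i * e₁ + j * e₂) = cross e₂ p - i * D := by
    intro i j
    rw [show ((i : ℂ) * e₁) = ((i : ℝ) : ℂ) * e₁ by push_cast; ring,
      show ((j : ℂ) * e₂) = ((j : ℝ) : ℂ) * e₂ by push_cast; ring]
    simp only [cross_add_right, cross_smul_right, cross_same]
    rw [cross_swap e₂ e₁]; ring
  have hi : ∀ i : ℤ, -D < i * D → i * D < D → i = 0 := by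
    intro i h h'
    have k1 : (-1 : ℝ) < i := by
      by_contra hh
      nlinarith [mul_le_mul_of_nonneg_right (not_lt.1 hh) he.le]
    have k2 : (i : ℝ) < 1 := by
      by_contra hh
      nlinarith [mul_le_mul_of_nonneg_right (not_lt.1 hh) he.le]
    have k3 : (-1 : ℤ) < i := by exact_mod_cast k1
    have k4 : i < (1 : ℤ) := by exact_mod_cast k2
    omega
  obtain ⟨L, n, hL, hL', hn⟩ := exists_log_on_strip hper₂ (a := cross e₂ p)
    (c := cross e₂ p + D) (fun k h h' => hgood k fun i j hk => by
      rw [hk, hline] at h h'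
      have := hi i (by linarith) (by linarith)
      subst this
      simp at h)
  have := strip_jump he hper₂ (z := p) (a := cross e₂ p - D) (c := cross e₂ p + D)
    (by linarith) (by linarith) (fun k h h' hj => hgood k fun i j hk => by
      rw [hk, hline] at h h'
      have := hi i (by linarith) (by linarith)
      subst this
      exact hj j (by rw [hk]; simp))
    (LR := fun k => L (k - e₁)) (LL := L) (nR := n) (nL := n)
    (hL.comp (by fun_prop) fun k hk => by
      simp only [Set.mem_ofPred_eq, h1]; exact ⟨by linarith [hk.1], by linarith [hk.2]⟩)
    (fun k h h' => by
      rw [hL' _ (by rw [h1]; linarith) (by rw [h1]; linarith), ← hper₁, sub_add_cancel])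
    (fun k h h' => by
      simp only [add_sub_right_comm]
      exact hn _ (by rw [h1]; linarith) (by rw [h1]; linarith))
    hL hL' hn hw
  simp only [sub_self, Complex.zero_im] at this
  have h0 : (m : ℝ) = 0 := by
    have := this.symm
    simpa [Real.pi_ne_zero] using this
  exact_mod_cast h0

/-- The lines through the translates of `p` and `p'` alternate and cut the plane into two kinds of
strips, with increments `nA` and `nB`. Crossing one line changes `nB` into `nA`, crossing the other
changes `nA` back into `nB`, so the two jumps cancel. -/
theorem winding_add_eq_zero_of_two_punctures_aux {w : ℂ → ℂ} {e₁ e₂ : ℂ} (he : 0 < cross e₁ e₂)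
    (hper₁ : ∀ k, w (k + e₁) = w k) (hper₂ : ∀ k, w (k + e₂) = w k) {p p' : ℂ}
    (hgood : ∀ k, (∀ i j : ℤ, k ≠ p + i * e₁ + j * e₂) → (∀ i j : ℤ, k ≠ p' + i * e₁ + j * e₂) →
      ContinuousAt w k ∧ w k ≠ 0)
    (hp₁ : cross e₂ p - cross e₁ e₂ < cross e₂ p') (hp₂ : cross e₂ p' < cross e₂ p)
    {m m' : ℤ} (hw : HasWinding w p m) (hw' : HasWinding w p' m') : m + m' = 0 := by
  set D := cross e₁ e₂ with hD
  have h1 : ∀ k, cross e₂ (k - e₁) = cross e₂ k + D := by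
    intro k; rw [cross_sub_right, cross_swap e₂ e₁]; ring
  have hline : ∀ q : ℂ, ∀ i j : ℤ, cross e₂ (q + i * e₁ + j * e₂) = cross e₂ q - i * D := by
    intro q i j
    rw [show ((i : ℂ) * e₁) = ((i : ℝ) : ℂ) * e₁ by push_cast; ring,
      show ((j : ℂ) * e₂) = ((j : ℝ) : ℂ) * e₂ by push_cast; ring]
    simp only [cross_add_right, cross_smul_right, cross_same]
    rw [cross_swap e₂ e₁]; ring
  have hi : ∀ i : ℤ, -D < i * D → i * D < D → i = 0 := by
    intro i h h'
    have k1 : (-1 : ℝ) < i := by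
      by_contra hh
      nlinarith [mul_le_mul_of_nonneg_right (not_lt.1 hh) he.le]
    have k2 : (i : ℝ) < 1 := by
      by_contra hh
      nlinarith [mul_le_mul_of_nonneg_right (not_lt.1 hh) he.le]
    have k3 : (-1 : ℤ) < i := by exact_mod_cast k1
    have k4 : i < (1 : ℤ) := by exact_mod_cast k2
    omega
  have hi0 : ∀ i : ℤ, 0 < i * D → i * D < D → False := by
    intro i h h'
    have := hi i (by linarith) h'
    subst this
    simp at h
  have hi1 : ∀ i : ℤ, -D < i * D → i * D < 0 → False := by
    intro i h h'
    have := hi i h (by linarith)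
    subst this
    simp at h'
  obtain ⟨LA, nA, hLA, hLA', hnA⟩ := exists_log_on_strip hper₂ (a := cross e₂ p)
    (c := cross e₂ p' + D) (fun k h h' => hgood k
      (fun i j hk => by
        rw [hk, hline] at h h'
        exact hi1 i (by linarith) (by linarith))
      (fun i j hk => by
        rw [hk, hline] at h h'
        exact hi1 i (by linarith) (by linarith)))
  obtain ⟨LB, nB, hLB, hLB', hnB⟩ := exists_log_on_strip hper₂ (a := cross e₂ p')
    (c := cross e₂ p) (fun k h h' => hgood k
      (fun i j hk => by
        rw [hk, hline] at h h'
        exact hi0 i (by linarith) (by linarith))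
      (fun i j hk => by
        rw [hk, hline] at h h'
        exact hi1 i (by linarith) (by linarith)))
  have j1 := strip_jump he hper₂ (z := p) (a := cross e₂ p') (c := cross e₂ p' + D)
    (by linarith) (by linarith) (fun k h h' hj => hgood k
      (fun i j hk => by
        rw [hk, hline] at h h'
        have := hi i (by linarith) (by linarith)
        subst this
        exact hj j (by rw [hk]; simp))
      (fun i j hk => by
        rw [hk, hline] at h h'
        exact hi1 i (by linarith) (by linarith)))
    hLB hLB' hnB hLA hLA' hnA hw
  have j2 := strip_jump he hper₂ (z := p') (a := cross e₂ p - D) (c := cross e₂ p)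
    (by linarith) (by linarith) (fun k h h' hj => hgood k
      (fun i j hk => by
        rw [hk, hline] at h h'
        exact hi0 i (by linarith) (by linarith))
      (fun i j hk => by
        rw [hk, hline] at h h'
        have := hi i (by linarith) (by linarith)
        subst this
        exact hj j (by rw [hk]; simp)))
    (LR := fun k => LA (k - e₁)) (nR := nA)
    (hLA.comp (by fun_prop) fun k hk => by
      simp only [Set.mem_ofPred_eq, h1]; exact ⟨by linarith [hk.1], by linarith [hk.2]⟩)
    (fun k h h' => by
      rw [hLA' _ (by rw [h1]; linarith) (by rw [h1]; linarith), ← hper₁, sub_add_cancel])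
    (fun k h h' => by
      simp only [add_sub_right_comm]
      exact hnA _ (by rw [h1]; linarith) (by rw [h1]; linarith))
    hLB hLB' hnB hw'
  simp only [Complex.sub_im] at j1 j2
  have h0 : 2 * Real.pi * ((m : ℝ) + m') = 0 := by linarith
  have h3 : (m : ℝ) + m' = 0 := by simpa [Real.pi_ne_zero] using h0
  exact_mod_cast h3

end

noncomputable section

theorem HasWinding.add_period {w : ℂ → ℂ} {p G : ℂ} {n : ℤ} (h : HasWinding w p n)
    (hper : ∀ k, w (k + G) = w k) : HasWinding w (p + G) n := by
  have hc : ∀ r t : ℝ, w (circleMap (p + G) r t) = w (circleMap p r t) := by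
    intro r t
    rw [← hper (circleMap p r t)]
    congr 1
    simp only [circleMap]; ring
  unfold HasWinding at h ⊢
  simpa only [hc] using h

/-- Translating `p'` by a multiple of `e₁`, found by a floor, puts its line between that of `p` and
the next one; `hX` says that the two families of lines are distinct, which makes the inequality
strict. -/
theorem winding_add_eq_zero_of_two_punctures {w : ℂ → ℂ} {e₁ e₂ : ℂ} (he : 0 < cross e₁ e₂)
    (hper₁ : ∀ k, w (k + e₁) = w k) (hper₂ : ∀ k, w (k + e₂) = w k) {p p' : ℂ}
    (hgood : ∀ k, (∀ i j : ℤ, k ≠ p + i * e₁ + j * e₂) → (∀ i j : ℤ, k ≠ p' + i * e₁ + j * e₂) →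
      ContinuousAt w k ∧ w k ≠ 0)
    (hX : ∀ i : ℤ, cross e₂ p' ≠ cross e₂ p - i * cross e₁ e₂)
    {m m' : ℤ} (hw : HasWinding w p m) (hw' : HasWinding w p' m') : m + m' = 0 := by
  set D := cross e₁ e₂ with hD
  set N : ℤ := ⌊(cross e₂ p - cross e₂ p') / D⌋ with hN
  have hl : ∀ i : ℤ, cross e₂ (p' + i * (-e₁)) = cross e₂ p' + i * D := by
    intro i
    rw [show ((i : ℂ) * (-e₁)) = ((-i : ℝ) : ℂ) * e₁ by push_cast; ring]
    rw [cross_add_right, cross_smul_right, cross_swap e₂ e₁]; ring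
  have hperm : ∀ (i : ℤ) (k : ℂ), w (k + i * (-e₁)) = w k := by
    have hneg : Function.Periodic w (-e₁) := Function.Periodic.neg hper₁
    intro i k
    simpa [zsmul_eq_mul] using hneg.zsmul i k
  have h1 := Int.floor_le ((cross e₂ p - cross e₂ p') / D)
  have h2 := Int.lt_floor_add_one ((cross e₂ p - cross e₂ p') / D)
  rw [← hN] at h1 h2
  rw [le_div_iff₀ he] at h1
  rw [div_lt_iff₀ he] at h2
  refine winding_add_eq_zero_of_two_punctures_aux he hper₁ hper₂ (p := p)
    (p' := p' + N * (-e₁)) (fun k hk hk' => hgood k hk fun i j hij => hk' (i + N) j ?_) ?_ ?_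
    hw (hw'.add_period (hperm N))
  · rw [hij]; push_cast; ring
  · rw [hl]; linarith
  · rw [hl]
    refine lt_of_le_of_ne (by linarith) fun h => hX N ?_
    linarith

/-! ### The reciprocal lattice -/

theorem mem_recipLattice {b k : ℂ} :
    k ∈ recipLattice b ↔ ∃ i j : ℤ, k = i * b + j * (omega3 * b) := by
  rw [recipLattice, AddSubgroup.mem_closure_pair]
  simp only [zsmul_eq_mul, eq_comm]

theorem b_mem_recipLattice (b : ℂ) : b ∈ recipLattice b :=
  AddSubgroup.subset_closure (by simp)

theorem omega3_b_mem_recipLattice (b : ℂ) : omega3 * b ∈ recipLattice b :=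
  AddSubgroup.subset_closure (by simp)

theorem omega3_eq : omega3 = ⟨-1 / 2, √3 / 2⟩ := by
  have h : (2 * Real.pi * Complex.I / 3 : ℂ) = ((2 * Real.pi / 3 : ℝ) : ℂ) * Complex.I := by
    push_cast; ring
  have hs : (2 * Real.pi / 3 : ℝ) = Real.pi - Real.pi / 3 := by ring
  apply Complex.ext
  · rw [omega3, h, Complex.exp_ofReal_mul_I_re, hs, Real.cos_pi_sub, Real.cos_pi_div_three]
    norm_num
  · rw [omega3, h, Complex.exp_ofReal_mul_I_im, hs, Real.sin_pi_sub, Real.sin_pi_div_three]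

theorem omega3_sq : omega3 * omega3 = -1 - omega3 := by
  have h3 : √3 * √3 = 3 := Real.mul_self_sqrt (by norm_num)
  rw [omega3_eq]
  apply Complex.ext
  · simp only [Complex.mul_re, Complex.sub_re, Complex.neg_re, Complex.one_re]; nlinarith
  · simp only [Complex.mul_im, Complex.sub_im, Complex.neg_im, Complex.one_im]; ring

theorem omega3_cubed : omega3 * omega3 * omega3 = 1 := by
  rw [omega3_sq, sub_mul, omega3_sq]; ring

theorem norm_omega3 : ‖omega3‖ = 1 := by
  rw [omega3, show (2 * Real.pi * Complex.I / 3 : ℂ) = ((2 * Real.pi / 3 : ℝ) : ℂ) * Complex.I by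
    push_cast; ring, Complex.norm_exp_ofReal_mul_I]

theorem cross_lattice_pos {b : ℂ} (hb : b ≠ 0) : 0 < cross b (omega3 * b) := by
  have h : cross b (omega3 * b) = √3 / 2 * Complex.normSq b := by
    rw [omega3_eq]
    simp only [cross, Complex.mul_re, Complex.mul_im, Complex.normSq_apply]; ring
  rw [h]
  have := Complex.normSq_pos.2 hb
  positivity

theorem omega3_mul_mem_recipLattice {b G : ℂ} (hG : G ∈ recipLattice b) :
    omega3 * G ∈ recipLattice b := by
  obtain ⟨i, j, rfl⟩ := mem_recipLattice.1 hG
  refine mem_recipLattice.2 ⟨-j, i - j, ?_⟩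
  have : omega3 * (i * b + j * (omega3 * b)) = i * (omega3 * b) + j * ((omega3 * omega3) * b) := by
    ring
  rw [this, omega3_sq]
  push_cast; ring

/-- The two coordinates of a point of the plane with respect to the lattice basis. -/
theorem eq_coord_add (e₁ e₂ : ℂ) (he : cross e₁ e₂ ≠ 0) (k : ℂ) :
    k = ((cross k e₂ / cross e₁ e₂ : ℝ) : ℂ) * e₁ + ((cross e₁ k / cross e₁ e₂ : ℝ) : ℂ) * e₂ := by
  have h : (cross e₁ e₂) • k = (cross k e₂ : ℂ) * e₁ + (cross e₁ k : ℂ) * e₂ := by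
    apply Complex.ext <;>
    simp [cross] <;> ring
  have hc : (cross e₁ e₂ : ℂ) ≠ 0 := by exact_mod_cast he
  rw [Complex.real_smul] at h
  push_cast
  field_simp
  linear_combination h

/-- Compactness of the Brillouin zone in the form used below: with fractional lattice coordinates
the norm is at most `‖b‖ + ‖ω b‖ = 2 ‖b‖`. -/
theorem exists_mem_closedBall_sub_mem {b : ℂ} (hb : b ≠ 0) (k : ℂ) :
    ∃ G ∈ recipLattice b, k + G ∈ Metric.closedBall (0 : ℂ) (2 * ‖b‖) := by
  have hk := eq_coord_add b (omega3 * b) (cross_lattice_pos hb).ne' k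
  set x := cross k (omega3 * b) / cross b (omega3 * b)
  set y := cross b k / cross b (omega3 * b)
  refine ⟨(-⌊x⌋ : ℤ) * b + (-⌊y⌋ : ℤ) * (omega3 * b), mem_recipLattice.2 ⟨_, _, rfl⟩, ?_⟩
  have : k + (((-⌊x⌋ : ℤ) : ℂ) * b + ((-⌊y⌋ : ℤ) : ℂ) * (omega3 * b)) =
      ((Int.fract x : ℝ) : ℂ) * b + ((Int.fract y : ℝ) : ℂ) * (omega3 * b) := by
    rw [hk]
    simp only [Int.fract]
    push_cast; ring
  rw [this, mem_closedBall_zero_iff]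
  refine (norm_add_le _ _).trans ?_
  rw [norm_mul, norm_mul, norm_mul, norm_omega3, Complex.norm_real, Complex.norm_real,
    Real.norm_of_nonneg (Int.fract_nonneg _), Real.norm_of_nonneg (Int.fract_nonneg _)]
  have h1 := (Int.fract_lt_one x).le
  have h2 := (Int.fract_lt_one y).le
  nlinarith [norm_nonneg b]

/-! ### Removing zeros of positive winding is impossible -/

theorem HasWinding.congr_of_eventually_eq_one {w : ℂ → ℂ} {p : ℂ} (h : ∀ᶠ k in 𝓝 p, w k = 1) :
    HasWinding w p 0 := by
  obtain ⟨R, hR, hw⟩ := Metric.eventually_nhds_iff.1 h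
  filter_upwards [Ioo_mem_nhdsGT hR] with r hr
  have hc : ∀ t, w (circleMap p r t) = 1 := by
    intro t
    refine hw ?_
    simp [circleMap, dist_eq_norm, abs_of_pos hr.1, hr.2]
  exact ⟨fun t => by rw [hc]; exact one_ne_zero, fun _ => 0, continuous_const,
    fun t => by simp [hc], by simp⟩

/-- Near `p` the numerator has a continuous logarithm, which returns to its value around the circle;
only the denominator contributes. -/
theorem HasWinding.div_of_ne_zero {d q w : ℂ → ℂ} {p : ℂ} {n : ℤ} (hd : HasWinding d p n)
    (hq : Continuous q) (hqp : q p ≠ 0) (hw : ∀ k, q k ≠ 0 → d k ≠ 0 → w k = q k / d k) :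
    HasWinding w p (-n) := by
  obtain ⟨R, hR, hqR⟩ := Metric.eventually_nhds_iff.1 (hq.continuousAt.eventually_ne hqp)
  obtain ⟨L, hL, hL'⟩ := exists_continuousOn_log Metric.isOpen_ball (convex_ball p R)
    hq.continuousOn (fun k hk => hqR hk)
  filter_upwards [Ioo_mem_nhdsGT hR, hd] with r hr hdr
  obtain ⟨hd0, θ, hθ, hdθ, hθn⟩ := hdr
  have hc : ∀ t, circleMap p r t ∈ Metric.ball p R := by
    intro t
    simp [circleMap, abs_of_pos hr.1, hr.2]
  have hwc : ∀ t, w (circleMap p r t) = q (circleMap p r t) / d (circleMap p r t) :=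
    fun t => hw _ (hqR (hc t)) (hd0 t)
  refine ⟨fun t => by rw [hwc]; exact div_ne_zero (hqR (hc t)) (hd0 t),
    fun t => (L (circleMap p r t)).im - θ t, ?_, fun t => ?_, ?_⟩
  · refine (Complex.continuous_im.comp ?_).sub hθ
    exact hL.comp_continuous (continuous_circleMap p r) hc
  · rw [hwc, norm_div]
    have e1 : q (circleMap p r t) = ‖q (circleMap p r t)‖ *
        Complex.exp ((L (circleMap p r t)).im * Complex.I) := by
      have e := hL' _ (hc t)
      conv_rhs => rw [← e, Complex.norm_exp]
      conv_lhs => rw [← e]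
      rw [Complex.ofReal_exp, ← Complex.exp_add, Complex.re_add_im]
    conv_lhs => rw [e1, hdθ t]
    push_cast
    rw [sub_mul, Complex.exp_sub]
    ring
  · have : circleMap p r (2 * Real.pi) = circleMap p r 0 := by
      simpa using periodic_circleMap p r 0
    simp only [this]
    push_cast
    linarith

/-- A section with the same quasi-periodicity as `d` cannot avoid the zero of `d` at the origin if
it agrees with `d` near all of its own zeros. -/
theorem false_of_removed_zero {b : ℂ} (hb : b ≠ 0) {d q : ℂ → ℂ} (hd : Continuous d)
    (hq : Continuous q)
    (hper : ∀ G ∈ recipLattice b, ∀ k, ∃ c : ℂ, ‖c‖ = 1 ∧ d (k + G) = c * d k ∧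
      q (k + G) = c * q k)
    (hz : HasTwoZeros b d) (hd0 : d 0 = 0) (hq0 : q 0 ≠ 0)
    (hloc : ∀ k, q k = 0 → ∀ᶠ k' in 𝓝 k, q k' = d k') : False := by
  classical
  -- Near a zero of `q` the quotient is identically 1 wherever it is defined, so the value 1 makes
  -- `w` continuous there. The common phase cancels in the quotient, hence `w` is truly periodic.
  set w : ℂ → ℂ := fun k => if q k = 0 then 1 else q k / d k with hw
  have hqG : ∀ G ∈ recipLattice b, ∀ k, q (k + G) = 0 ↔ q k = 0 := by
    intro G hG k
    obtain ⟨c, hc, -, h⟩ := hper G hG k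
    have hc0 : c ≠ 0 := by rintro rfl; simp at hc
    simp [h, hc0]
  have hwper : ∀ G ∈ recipLattice b, ∀ k, w (k + G) = w k := by
    intro G hG k
    have h0 := hqG G hG k
    obtain ⟨c, hc, h, h'⟩ := hper G hG k
    have hc0 : c ≠ 0 := by rintro rfl; simp at hc
    simp only [hw, h0]
    rw [h, h', mul_div_mul_left _ _ hc0]
  have hwdiv : ∀ k, q k ≠ 0 → d k ≠ 0 → w k = q k / d k := by
    intro k hk _
    simp [hw, hk]
  have hw1 : ∀ k, q k = 0 → ∀ᶠ k' in 𝓝 k, w k' = 1 := by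
    intro k hk
    filter_upwards [hloc k hk] with k' hk'
    by_cases h : q k' = 0
    · simp [hw, h]
    · simp only [hw, h, if_false]
      rw [← hk', div_self h]
  have hgood0 : ∀ k, (d k ≠ 0 ∨ q k = 0) → ContinuousAt w k ∧ w k ≠ 0 := by
    intro k hk
    by_cases h : q k = 0
    · have := hw1 k h
      refine ⟨(continuousAt_const (y := (1 : ℂ))).congr ?_, ?_⟩
      · filter_upwards [this] with k' hk' using hk'.symm
      · rw [this.self_of_nhds]; exact one_ne_zero
    · have hdk : d k ≠ 0 := hk.resolve_right h
      refine ⟨(hq.continuousAt.div hd.continuousAt hdk).congr ?_, ?_⟩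
      · filter_upwards [hq.continuousAt.eventually_ne h] with k' hk'
        simp [hw, hk']
      · rw [hwdiv k h hdk]; exact div_ne_zero h hdk
  -- Every puncture contributes a nonpositive winding, and a strictly negative one where `q` does
  -- not vanish. Since the origin is such a puncture, a total winding of zero is impossible.
  have hwind : ∀ (p : ℂ) (n : ℤ), 0 ≤ n → HasWinding d p n →
      ∃ m : ℤ, m ≤ 0 ∧ HasWinding w p m ∧ (q p ≠ 0 → m = -n) := by
    intro p n hn hp
    by_cases h : q p = 0
    · exact ⟨0, le_rfl, HasWinding.congr_of_eventually_eq_one (hw1 p h), fun h' => absurd h h'⟩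
    · exact ⟨-n, by omega, hp.div_of_ne_zero hq h hwdiv, fun _ => rfl⟩
  have he := cross_lattice_pos hb
  have hb1 := hwper b (b_mem_recipLattice b)
  have hb2 := hwper _ (omega3_b_mem_recipLattice b)
  obtain ⟨p, p', hzero, hcases⟩ := hz
  have hq0' : ∀ r, 0 - r ∈ recipLattice b → q r ≠ 0 := by
    intro r hr h
    have := (hqG _ hr r).2 h
    rw [add_sub_cancel] at this
    exact hq0 this
  rcases hcases with ⟨hne, hp, hp'⟩ | ⟨hin, hp⟩
  · obtain ⟨m, hm0, hm, hmn⟩ := hwind p 1 (by norm_num) hp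
    obtain ⟨m', hm0', hm', hmn'⟩ := hwind p' 1 (by norm_num) hp'
    have hsum : m + m' = 0 := by
      have hgood : ∀ k, (∀ i j : ℤ, k ≠ p + (i * b + j * (omega3 * b))) →
          (∀ i j : ℤ, k ≠ p' + (i * b + j * (omega3 * b))) → ContinuousAt w k ∧ w k ≠ 0 := by
        intro k h h'
        refine hgood0 k (Or.inl fun hk => ?_)
        rcases (hzero k).1 hk with h1 | h1
        · obtain ⟨i, j, hij⟩ := mem_recipLattice.1 h1
          exact h i j (by rw [← hij]; ring)
        · obtain ⟨i, j, hij⟩ := mem_recipLattice.1 h1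
          exact h' i j (by rw [← hij]; ring)
      -- The strip argument needs the translates of the two zeros to lie on different lines. If this
      -- fails for both lattice directions, both coordinates of `p - p'` are integers, contrary to
      -- `hne`.
      by_cases hX : ∀ i : ℤ, cross (omega3 * b) p' ≠
          cross (omega3 * b) p - i * cross b (omega3 * b)
      · refine winding_add_eq_zero_of_two_punctures he hb1 hb2
          (fun k h h' => hgood k (fun i j => ?_) fun i j => ?_) hX hm hm'
        · rw [← add_assoc]; exact h i j
        · rw [← add_assoc]; exact h' i j
      · push Not at hX
        obtain ⟨i, hi⟩ := hX
        -- use the rotated basis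
        have he' : 0 < cross (omega3 * b) (-b) := by
          have : cross (omega3 * b) (-b) = cross b (omega3 * b) := by
            simp only [cross, Complex.neg_re, Complex.neg_im]; ring
          rwa [this]
        have hb3 : ∀ k, w (k + -b) = w k := hwper _ (neg_mem (b_mem_recipLattice b))
        refine winding_add_eq_zero_of_two_punctures he' hb2 hb3
          (fun k h h' => hgood k (fun i j => ?_) fun i j => ?_) (fun j hj => hne ?_) hm hm'
        · have := h j (-i)
          push_cast at this
          convert this using 1; ring
        · have := h' j (-i)
          push_cast at this
          convert this using 1; ring
        · have h1 : cross (p - p') (omega3 * b) = -i * cross b (omega3 * b) := by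
            rw [cross_sub_left, cross_swap p, cross_swap p', hi]; ring
          have h2 : cross b (p - p') = -j * cross b (omega3 * b) := by
            simp only [cross, Complex.neg_re, Complex.neg_im, Complex.sub_re,
              Complex.sub_im] at hj ⊢
            linarith
          have h3 := eq_coord_add b (omega3 * b) he.ne' (p - p')
          rw [h1, h2, mul_div_cancel_right₀ _ he.ne', mul_div_cancel_right₀ _ he.ne'] at h3
          refine mem_recipLattice.2 ⟨-i, -j, ?_⟩
          rw [h3]; push_cast; ring
    rcases (hzero 0).1 hd0 with h | h
    · have := hmn (hq0' p h); omega
    · have := hmn' (hq0' p' h); omega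
  · obtain ⟨m, hm0, hm, hmn⟩ := hwind p 2 (by norm_num) hp
    have hqp : q p ≠ 0 := by
      rcases (hzero 0).1 hd0 with h | h
      · exact hq0' p h
      · refine hq0' p ?_
        have := sub_mem h hin
        rwa [show (0 : ℂ) - p' - (p - p') = 0 - p by ring] at this
    have h2 := hmn hqp
    have := winding_eq_zero_of_one_puncture he hb1 hb2 (p := p) (fun k h => by
      refine hgood0 k (Or.inl fun hk => ?_)
      have hkp : k - p ∈ recipLattice b := by
        rcases (hzero k).1 hk with h1 | h1
        · exact h1
        · have := sub_mem h1 hin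
          rwa [show k - p' - (p - p') = k - p by ring] at this
      obtain ⟨i, j, hij⟩ := mem_recipLattice.1 hkp
      exact h i j (by rw [add_assoc, ← hij]; ring)) hm
    omega

end

noncomputable section

/-! ### Nodes enforced by the zeros of a section -/

theorem exists_pos_forall_le_of_periodic {b : ℂ} (hb : b ≠ 0) {φ : ℂ → ℝ} (hφ : Continuous φ)
    (hper : ∀ G ∈ recipLattice b, ∀ k, φ (k + G) = φ k) (hpos : ∀ k, 0 < φ k) :
    ∃ c : ℝ, 0 < c ∧ ∀ k, c ≤ φ k := by
  obtain ⟨k₀, -, hk₀⟩ := (isCompact_closedBall (0 : ℂ) (2 * ‖b‖)).exists_isMinOn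
    ⟨0, by simp⟩ hφ.continuousOn
  refine ⟨φ k₀, hpos _, fun k => ?_⟩
  obtain ⟨G, hG, hkG⟩ := exists_mem_closedBall_sub_mem hb k
  rw [← hper G hG k]
  exact hk₀ hkG

theorem exists_forall_le_of_periodic {b : ℂ} (hb : b ≠ 0) {φ : ℂ → ℝ} (hφ : Continuous φ)
    (hper : ∀ G ∈ recipLattice b, ∀ k, φ (k + G) = φ k) :
    ∃ M : ℝ, ∀ k, φ k ≤ M := by
  obtain ⟨k₀, -, hk₀⟩ := (isCompact_closedBall (0 : ℂ) (2 * ‖b‖)).exists_isMaxOn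
    ⟨0, by simp⟩ hφ.continuousOn
  refine ⟨φ k₀, fun k => ?_⟩
  obtain ⟨G, hG, hkG⟩ := exists_mem_closedBall_sub_mem hb k
  rw [← hper G hG k]
  exact hk₀ hkG

/-- Here `d = f (r - i s)`: the real part of `f conj d` sees only `r`, while `s` can only enlarge
`|d|`. This lets a zero of the test section be read as the second node equation, together with a
size condition. -/
theorem re_mul_conj_of_add_eq_zero {d f : ℂ} {s r : ℝ} (h : d + f * (Complex.I * s - r) = 0) :
    (f * conj d).re = ‖f‖ ^ 2 * r ∧ ‖d‖ ^ 2 = ‖f‖ ^ 2 * (s ^ 2 + r ^ 2) := by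
  have hd : d = f * (r - Complex.I * s) := by linear_combination h
  subst hd
  rw [← Complex.normSq_eq_norm_sq, ← Complex.normSq_eq_norm_sq]
  constructor
  · simp [Complex.normSq_apply]; ring
  · simp [Complex.normSq_apply]; ring

/-- Without a node, the section `q = d + f (i s - r)` contradicts `false_of_removed_zero`. The
function `r` is chosen so that, where `φ ≤ 0`, a zero of `q` satisfies `Re (f conj d) = a e`; then
`φ` cannot be small, `s` equals 2, and `|d| ≥ 2 |f|` is incompatible with `φ < 0`. For small
positive `φ` the zero set is empty because `d` is large there and `a e` is small. All zeros of `q`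
therefore lie where both cutoffs vanish and `q = d`, whereas `φ 0 < 0`. -/
theorem exists_node_of_small_perturbation {b : ℂ} (hb : b ≠ 0) {d f : ℂ → ℂ} {e : ℂ → ℝ}
    (hd : Continuous d) (hf : Continuous f) (he : Continuous e)
    (hper : ∀ G ∈ recipLattice b, ∀ k, ∃ c : ℂ, ‖c‖ = 1 ∧ d (k + G) = c * d k ∧
      f (k + G) = c * f k)
    (heper : ∀ G ∈ recipLattice b, ∀ k, e (k + G) = e k)
    (hz : HasTwoZeros b d) (hd0 : d 0 = 0)
    (h0 : e 0 ^ 2 - ‖f 0‖ ^ 2 + ‖d 0‖ ^ 2 < 0)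
    (hne : ∀ k, d k = 0 → e k ^ 2 - ‖f k‖ ^ 2 + ‖d k‖ ^ 2 ≠ 0) :
    ∃ lam : ℝ, 0 < lam ∧ ∀ a : ℂ → ℝ, Continuous a →
      (∀ G ∈ recipLattice b, ∀ k, a (k + G) = a k) → (∀ k, |a k| < lam) →
      ∃ k, e k ^ 2 - a k ^ 2 - ‖f k‖ ^ 2 + ‖d k‖ ^ 2 = 0 ∧ (f k * conj (d k)).re = a k * e k := by
  have hdn : ∀ G ∈ recipLattice b, ∀ k, ‖d (k + G)‖ = ‖d k‖ := by
    intro G hG k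
    obtain ⟨c, hc, h, -⟩ := hper G hG k
    rw [h, norm_mul, hc, one_mul]
  have hfn : ∀ G ∈ recipLattice b, ∀ k, ‖f (k + G)‖ = ‖f k‖ := by
    intro G hG k
    obtain ⟨c, hc, -, h⟩ := hper G hG k
    rw [h, norm_mul, hc, one_mul]
  have hfd : ∀ G ∈ recipLattice b, ∀ k, f (k + G) * conj (d (k + G)) = f k * conj (d k) := by
    intro G hG k
    obtain ⟨c, hc, h, h'⟩ := hper G hG k
    have hcc : c * conj c = 1 := by
      rw [Complex.mul_conj, Complex.normSq_eq_norm_sq, hc]; simp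
    rw [h, h', map_mul]
    linear_combination (f k * conj (d k)) * hcc
  -- constants from compactness
  obtain ⟨c, hc, hcmin⟩ := exists_pos_forall_le_of_periodic hb
    (φ := fun k => max (‖d k‖ ^ 2) (|e k ^ 2 - ‖f k‖ ^ 2 + ‖d k‖ ^ 2| / 2)) (by fun_prop)
    (fun G hG k => by simp only [hdn G hG, hfn G hG, heper G hG]) (fun k => by
      by_cases h : d k = 0
      · exact lt_max_of_lt_right (half_pos (abs_pos.2 (hne k h)))
      · exact lt_max_of_lt_left (by have := norm_pos_iff.2 h; positivity))
  obtain ⟨M, hM⟩ := exists_forall_le_of_periodic hb (φ := fun k => e k ^ 2) (by fun_prop)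
    (fun G hG k => by simp only [heper G hG])
  have hM0 : 0 ≤ M := (sq_nonneg (e 0)).trans (hM 0)
  -- `ν` will bound `a²`. The first bound keeps `φ` within `c / 4` of its value at `a = 0`; the
  -- second keeps `(a e)²` below `c² / 2`, which bounds `|d|² |f|²` from below in the region `0 ≤ φ
  -- ≤ c / 4`.
  set ν : ℝ := min (c / 4) (c ^ 2 / (4 * (M + 1))) with hν
  have hν0 : 0 < ν := lt_min (by positivity) (by positivity)
  have hν1 : ν ≤ c / 4 := min_le_left _ _
  have hνM : ν * M < c ^ 2 / 2 := by
    have h1 : ν ≤ c ^ 2 / (4 * (M + 1)) := min_le_right _ _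
    rw [le_div_iff₀ (by positivity)] at h1
    nlinarith
  refine ⟨√ν, Real.sqrt_pos.2 hν0, fun a ha haper hal => ?_⟩
  have ha2 : ∀ k, a k ^ 2 ≤ ν := by
    intro k
    rw [← sq_abs, ← Real.sq_sqrt hν0.le]
    exact pow_le_pow_left₀ (abs_nonneg _) (hal k).le 2
  by_contra hno
  push Not at hno
  set φ : ℂ → ℝ := fun k => e k ^ 2 - a k ^ 2 - ‖f k‖ ^ 2 + ‖d k‖ ^ 2 with hφ
  have hφc : Continuous φ := by fun_prop
  -- The absence of a node is made quantitative by compactness: if the second node equation holds,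
  -- then `|φ| ≥ δ`.
  obtain ⟨δ, hδ, hδmin⟩ := exists_pos_forall_le_of_periodic hb
    (φ := fun k => max (|φ k|) (|(f k * conj (d k)).re - a k * e k|))
    (by
      have : Continuous fun k => (f k * conj (d k)).re :=
        Complex.continuous_re.comp (hf.mul (Complex.continuous_conj.comp hd))
      fun_prop)
    (fun G hG k => by simp only [hφ, hfd G hG, hdn G hG, hfn G hG, heper G hG, haper G hG])
    (fun k => by
      by_cases h : φ k = 0
      · exact lt_max_of_lt_right (abs_pos.2 (sub_ne_zero.2 (hno k h)))
      · exact lt_max_of_lt_left (abs_pos.2 h))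
  -- `s` is 0 for `φ ≥ 0` and 2 for `φ ≤ -δ/2`; `τ` is 1 for `φ ≤ 0` and 0 for `φ ≥ c/4`. In `r` the
  -- maximum keeps the denominator away from zero, and by `hcase` it equals `‖f‖²` wherever `φ ≤
  -- c/4`.
  set s : ℂ → ℝ := fun k => 2 * max 0 (min 1 (-φ k * (2 / δ))) with hs
  set τ : ℂ → ℝ := fun k => max 0 (min 1 (1 - 4 / c * φ k)) with hτ
  set r : ℂ → ℝ := fun k => τ k * (a k * e k) / max (‖f k‖ ^ 2) (c / 2) with hr
  have hmaxpos : ∀ k, 0 < max (‖f k‖ ^ 2) (c / 2) := fun k => lt_max_of_lt_right (by positivity)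
  have hsc : Continuous s := by fun_prop
  have hrc : Continuous r := by
    refine Continuous.div (by fun_prop) (by fun_prop) fun k => (hmaxpos k).ne'
  set q : ℂ → ℂ := fun k => d k + f k * (Complex.I * s k - r k) with hq
  have hqc : Continuous q := by fun_prop
  have hφper : ∀ G ∈ recipLattice b, ∀ k, φ (k + G) = φ k := by
    intro G hG k
    simp only [hφ, hdn G hG, hfn G hG, heper G hG, haper G hG]
  -- where `φ ≤ c / 4`, the section `f` is bounded below
  have hcase : ∀ k, φ k ≤ c / 4 → c / 2 ≤ ‖f k‖ ^ 2 := by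
    intro k hk
    have h1 := ha2 k
    have h2 := hcmin k
    have h3 : e k ^ 2 - ‖f k‖ ^ 2 + ‖d k‖ ^ 2 = φ k + a k ^ 2 := by simp only [hφ]; ring
    rcases le_max_iff.1 h2 with h | h
    · simp only [hφ] at hk
      nlinarith [sq_nonneg (e k)]
    · rw [h3] at h
      rcases le_abs.1 (show 2 * c ≤ |φ k + a k ^ 2| by linarith) with h4 | h4
      · linarith
      · simp only [hφ] at h4
        nlinarith [sq_nonneg (e k), sq_nonneg ‖d k‖]
  have hzero : ∀ k, q k = 0 → c / 4 < φ k := by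
    intro k hk
    obtain ⟨z1, z2⟩ := re_mul_conj_of_add_eq_zero hk
    by_contra hle
    have hle := not_lt.1 hle
    have hfk := hcase k hle
    have hmax : max (‖f k‖ ^ 2) (c / 2) = ‖f k‖ ^ 2 := max_eq_left hfk
    have hf0 : 0 < ‖f k‖ ^ 2 := by linarith
    have hrf : ‖f k‖ ^ 2 * r k = τ k * (a k * e k) := by
      simp only [hr, hmax]
      rw [mul_div_assoc', mul_div_cancel_left₀ _ hf0.ne']
    rcases le_or_gt 0 (φ k) with hp | hn
    · -- `0 ≤ φ ≤ c / 4`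
      have hs0 : s k = 0 := by
        simp only [hs]
        have : -φ k * (2 / δ) ≤ 0 := mul_nonpos_of_nonpos_of_nonneg (by linarith) (by positivity)
        rw [max_eq_left ((min_le_right _ _).trans this), mul_zero]
      have hdk : c ≤ ‖d k‖ ^ 2 := by
        rcases le_max_iff.1 (hcmin k) with h | h
        · exact h
        · exfalso
          have h3 : e k ^ 2 - ‖f k‖ ^ 2 + ‖d k‖ ^ 2 = φ k + a k ^ 2 := by simp only [hφ]; ring
          rw [h3, abs_of_nonneg (by positivity)] at h
          linarith [ha2 k]
      have hτ0 : 0 ≤ τ k := le_max_left _ _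
      have hτ1 : τ k ≤ 1 := max_le zero_le_one (min_le_left _ _)
      have e1 : ‖d k‖ ^ 2 * ‖f k‖ ^ 2 = (τ k * (a k * e k)) ^ 2 := by
        rw [z2, hs0, ← hrf]; ring
      have e2 : (τ k * (a k * e k)) ^ 2 ≤ ν * M := by
        have : τ k ^ 2 ≤ 1 := pow_le_one₀ hτ0 hτ1
        calc (τ k * (a k * e k)) ^ 2 = τ k ^ 2 * (a k ^ 2 * e k ^ 2) := by ring
          _ ≤ 1 * (a k ^ 2 * e k ^ 2) := by gcongr
          _ = a k ^ 2 * e k ^ 2 := one_mul _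
          _ ≤ ν * M := mul_le_mul (ha2 k) (hM k) (sq_nonneg _) hν0.le
      have e3 : c * (c / 2) ≤ ‖d k‖ ^ 2 * ‖f k‖ ^ 2 :=
        mul_le_mul hdk hfk (by positivity) (by positivity)
      nlinarith
    · -- `φ < 0`
      have hτ1 : τ k = 1 := by
        have : 0 ≤ -(4 / c * φ k) := by
          have : 0 < 4 / c := by positivity
          nlinarith
        simp only [hτ]
        rw [min_eq_left (by linarith), max_eq_right zero_le_one]
      rw [hrf, hτ1, one_mul] at z1
      have h1 := hδmin k
      rw [z1, sub_self, abs_zero, max_eq_left (abs_nonneg _), abs_of_neg hn] at h1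
      have hs2 : s k = 2 := by
        simp only [hs]
        have : 1 ≤ -φ k * (2 / δ) := by
          rw [mul_div_assoc', le_div_iff₀ hδ]; linarith
        rw [min_eq_left this, max_eq_right zero_le_one, mul_one]
      rw [hs2] at z2
      have : 4 * ‖f k‖ ^ 2 ≤ ‖d k‖ ^ 2 := by
        rw [z2]; nlinarith [sq_nonneg (r k)]
      have h5 := ha2 k
      simp only [hφ] at hn
      nlinarith [sq_nonneg (e k)]
  refine false_of_removed_zero hb hd hqc (fun G hG k => ?_) hz hd0 (fun h => ?_) (fun k hk => ?_)
  · obtain ⟨c', hc', h, h'⟩ := hper G hG k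
    refine ⟨c', hc', h, ?_⟩
    have hs' : s (k + G) = s k := by simp only [hs, hφper G hG]
    have hr' : r (k + G) = r k := by
      simp only [hr, hτ, hφper G hG, haper G hG, heper G hG, hfn G hG]
    simp only [hq, h, h', hs', hr']
    ring
  · have := hzero 0 h
    simp only [hφ] at this
    nlinarith [sq_nonneg (a 0)]
  · filter_upwards [hφc.continuousAt.eventually_const_lt (hzero k hk)] with k' hk'
    have h1 : s k' = 0 := by
      simp only [hs]
      have : -φ k' * (2 / δ) ≤ 0 :=
        mul_nonpos_of_nonpos_of_nonneg (by linarith) (by positivity)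
      rw [max_eq_left ((min_le_right _ _).trans this), mul_zero]
    have h2 : τ k' = 0 := by
      simp only [hτ]
      have : 1 - 4 / c * φ k' ≤ 0 := by
        have : 1 < 4 / c * φ k' := by
          rw [div_mul_eq_mul_div, lt_div_iff₀ hc]; linarith
        linarith
      rw [max_eq_left ((min_le_right _ _).trans this)]
    have h3 : r k' = 0 := by simp only [hr, h2]; simp
    simp [hq, h1, h3]

end

noncomputable section

set_option linter.unusedSectionVars false

/-! ### Matrix elements in the Chern gauge -/

section

variable {Hp Hm : Type*} [NormedAddCommGroup Hp] [InnerProductSpace ℂ Hp] [CompleteSpace Hp]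
  [NormedAddCommGroup Hm] [InnerProductSpace ℂ Hm] [CompleteSpace Hm]

/-- Polarization: pulling `i` through the antilinear `T` changes its sign, which exchanges the two
imaginary terms. -/
theorem antiunitary_inner_map_map (T : Hp ≃ₗᵢ⋆[ℂ] Hp) (x y : Hp) :
    inner ℂ (T x) (T y) = inner ℂ y x := by
  rw [inner_eq_sum_norm_sq_div_four (T x) (T y), inner_eq_sum_norm_sq_div_four y x]
  have h1 : ‖T x + T y‖ = ‖y + x‖ := by rw [← map_add, T.norm_map, add_comm]
  have h2 : ‖T x - T y‖ = ‖y - x‖ := by rw [← map_sub, T.norm_map, norm_sub_rev]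
  have hI : ∀ z, (RCLike.I : ℂ) • T z = T (-((RCLike.I : ℂ) • z)) := by
    intro z
    rw [map_neg, LinearIsometryEquiv.map_smulₛₗ]; simp
  have h3 : ‖T x - (RCLike.I : ℂ) • T y‖ = ‖y - (RCLike.I : ℂ) • x‖ := by
    rw [hI, ← map_sub, T.norm_map, sub_neg_eq_add]
    have : x + (RCLike.I : ℂ) • y = (RCLike.I : ℂ) • (y - (RCLike.I : ℂ) • x) := by
      rw [smul_sub, smul_smul]; simp [add_comm]
    rw [this, norm_smul]; simp
  have h4 : ‖T x + (RCLike.I : ℂ) • T y‖ = ‖y + (RCLike.I : ℂ) • x‖ := by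
    rw [hI, ← map_add, T.norm_map, ← sub_eq_add_neg]
    have : x - (RCLike.I : ℂ) • y = -(RCLike.I : ℂ) • (y + (RCLike.I : ℂ) • x) := by
      rw [neg_smul, smul_add, smul_smul]; simp [sub_eq_add_neg]
    rw [this, norm_smul]; simp
  rw [h1, h2, h3, h4]

variable {B : MoireBands Hp}

/-- The matrix element `⟨u_a| A |u_c⟩` in the Chern gauge. -/
def gaugeElt (g : ChernGauge B) (A : ℂ → (Hp →L[ℂ] Hp)) (a c : Fin 2) (k : ℂ) : ℂ :=
  inner ℂ (g.u k a) (A k (g.u k c))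

/-- A pairing as an operator on valley `+`. -/
def pairOp (C2 : Hp ≃ₗᵢ[ℂ] Hm) (D : ℂ → (Hm →L[ℂ] Hp)) (k : ℂ) : Hp →L[ℂ] Hp :=
  (D k).comp (C2.toContinuousLinearEquiv : Hp →L[ℂ] Hm)

@[simp] theorem pairOp_apply (C2 : Hp ≃ₗᵢ[ℂ] Hm) (D : ℂ → (Hm →L[ℂ] Hp)) (k : ℂ) (x : Hp) :
    pairOp C2 D k x = D k (C2 x) := rfl

/-- Invariance of a family of operators under reciprocal translations. -/
def TranslationInvariant (B : MoireBands Hp) (A : ℂ → (Hp →L[ℂ] Hp)) : Prop :=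
  ∀ G ∈ recipLattice B.b, ∀ k x, A (k + G) (B.S G x) = B.S G (A k x)

/-- Invariance of a family of operators under the antiunitary `T`. -/
def TInvariant (B : MoireBands Hp) (A : ℂ → (Hp →L[ℂ] Hp)) : Prop :=
  ∀ k x, A k (B.T x) = B.T (A k x)

namespace ChernGauge

variable (g : ChernGauge B)

theorem T_u_one (k : ℂ) : B.T (g.u k 1) = g.u k 0 := by rw [← g.T_u, B.T_T]

theorem inner_self (k : ℂ) (a : Fin 2) : inner ℂ (g.u k a) (g.u k a) = (1 : ℂ) := by
  rw [inner_self_eq_norm_sq_to_K, (g.orthonormal k).1 a]; simp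

theorem norm_u (k : ℂ) (a : Fin 2) : ‖g.u k a‖ = 1 := (g.orthonormal k).1 a

theorem inner_zero_one (k : ℂ) : inner ℂ (g.u k 0) (g.u k 1) = (0 : ℂ) :=
  (g.orthonormal k).2 (by decide)

theorem inner_one_zero (k : ℂ) : inner ℂ (g.u k 1) (g.u k 0) = (0 : ℂ) :=
  (g.orthonormal k).2 (by decide)

theorem P_u (k : ℂ) (a : Fin 2) : B.P k (g.u k a) = g.u k a := by
  have h : g.u k a ∈ LinearMap.range (B.P k : Hp →ₗ[ℂ] Hp) := by
    rw [← g.span_eq]; exact Submodule.subset_span ⟨a, rfl⟩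
  obtain ⟨y, hy⟩ := h
  have hi : B.P k (B.P k y) = B.P k y := by
    have := (B.P_proj k).isIdempotentElem
    exact congrArg (fun A : Hp →L[ℂ] Hp => A y) this
  have hy' : B.P k y = g.u k a := hy
  rw [← hy', hi]

theorem expansion (k : ℂ) {x : Hp} (hx : B.P k x = x) :
    x = inner ℂ (g.u k 0) x • g.u k 0 + inner ℂ (g.u k 1) x • g.u k 1 := by
  have h : x ∈ Submodule.span ℂ (Set.range (g.u k)) := by
    rw [g.span_eq]; exact ⟨x, hx⟩
  obtain ⟨c, hc⟩ := (Submodule.mem_span_range_iff_exists_fun ℂ).1 h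
  rw [Fin.sum_univ_two] at hc
  rw [← hc]
  simp only [inner_add_right, inner_smul_right, g.inner_self, g.inner_zero_one, g.inner_one_zero]
  simp

/-- The second vector is `T` of the first, and `T` is antilinear and commutes with translations, so
the two phases are conjugate. This is the opposite Chern number of the two gauge vectors. -/
theorem exists_phase (G : ℂ) (hG : G ∈ recipLattice B.b) (k : ℂ) :
    ∃ c : ℂ, ‖c‖ = 1 ∧ g.u (k + G) 0 = c • B.S G (g.u k 0) ∧
      g.u (k + G) 1 = conj c • B.S G (g.u k 1) := by
  obtain ⟨c, hc, h⟩ := g.periodic G hG k 0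
  refine ⟨c, hc, h, ?_⟩
  rw [← g.T_u, h, LinearIsometryEquiv.map_smulₛₗ, B.T_S G hG, g.T_u]

/-- All off-diagonal matrix elements transform in the same way under reciprocal translations. -/
theorem exists_cocycle (G : ℂ) (hG : G ∈ recipLattice B.b) (k : ℂ) :
    ∃ c : ℂ, ‖c‖ = 1 ∧ ∀ A : ℂ → (Hp →L[ℂ] Hp), TranslationInvariant B A →
      gaugeElt g A 1 0 (k + G) = c * gaugeElt g A 1 0 k ∧
      gaugeElt g A 0 0 (k + G) = gaugeElt g A 0 0 k := by
  obtain ⟨c, hc, h0, h1⟩ := g.exists_phase G hG k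
  have hcc : conj c * c = 1 := by
    rw [mul_comm, Complex.mul_conj, Complex.normSq_eq_norm_sq, hc]; simp
  -- Bra `u₁` and ket `u₀` both contribute a factor `c`, the bra through the conjugate of `conj c`.
  -- The phase does not depend on the operator.
  refine ⟨c * c, by rw [norm_mul, hc, one_mul], fun A hA => ⟨?_, ?_⟩⟩
  · simp only [gaugeElt, h0, h1, map_smul, hA G hG, inner_smul_left, inner_smul_right,
      LinearIsometryEquiv.inner_map_map, Complex.conj_conj]
    ring
  · simp only [gaugeElt, h0, map_smul, hA G hG, inner_smul_left, inner_smul_right,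
      LinearIsometryEquiv.inner_map_map]
    rw [← mul_assoc, mul_comm c, hcc, one_mul]

theorem gaugeElt_one_one {A : ℂ → (Hp →L[ℂ] Hp)} (hA : TInvariant B A) (k : ℂ) :
    gaugeElt g A 1 1 k = conj (gaugeElt g A 0 0 k) := by
  simp only [gaugeElt]
  rw [← g.T_u, hA, antiunitary_inner_map_map, inner_conj_symm]

theorem gaugeElt_zero_one {A : ℂ → (Hp →L[ℂ] Hp)} (hA : TInvariant B A) (k : ℂ) :
    gaugeElt g A 0 1 k = conj (gaugeElt g A 1 0 k) := by
  simp only [gaugeElt]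
  have h := antiunitary_inner_map_map B.T (g.u k 1) (A k (g.u k 0))
  rw [← hA, g.T_u_one, g.T_u] at h
  rw [h, inner_conj_symm]

theorem contDiff_gaugeElt {A : ℂ → (Hp →L[ℂ] Hp)} (hA : ContDiff ℝ ∞ A) (a c : Fin 2) :
    ContDiff ℝ ∞ (gaugeElt g A a c) := by
  have h2 : ContDiff ℝ ∞ (fun k => A k (g.u k c)) := by
    have hb := (ContinuousLinearMap.restrictScalarsL ℂ Hp Hp ℝ ℝ).contDiff.comp hA
    exact ContDiff.clm_apply (𝕜 := ℝ) (F := Hp) (G := Hp) hb (g.smooth c)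
  exact ContDiff.inner ℂ (g.smooth a) h2

/-- `C_{3z}` preserves the Chern gauge up to phases. -/
theorem exists_C3_phase (k : ℂ) :
    ∃ c : ℂ, ‖c‖ = 1 ∧ B.C3 (g.u k 0) = c • g.u (omega3 * k) 0 ∧
      B.C3 (g.u k 1) = conj c • g.u (omega3 * k) 1 := by
  set α : ℂ → ℂ := fun q => inner ℂ (g.u (omega3 * q) 0) (B.C3 (g.u q 0)) with hα
  set β : ℂ → ℂ := fun q => inner ℂ (g.u (omega3 * q) 1) (B.C3 (g.u q 0)) with hβ
  have hexp : ∀ q, B.C3 (g.u q 0) = α q • g.u (omega3 * q) 0 + β q • g.u (omega3 * q) 1 := by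
    intro q
    refine g.expansion _ ?_
    rw [B.P_C3, g.P_u]
  have hexp1 : ∀ q, B.C3 (g.u q 1) =
      conj (α q) • g.u (omega3 * q) 1 + conj (β q) • g.u (omega3 * q) 0 := by
    intro q
    rw [← g.T_u, ← B.T_C3, hexp, map_add, LinearIsometryEquiv.map_smulₛₗ,
      LinearIsometryEquiv.map_smulₛₗ, g.T_u, g.T_u_one]
  have horth : ∀ q, α q * β q = 0 := by
    intro q
    have h := B.C3.inner_map_map (g.u q 0) (g.u q 1)
    rw [g.inner_zero_one, hexp, hexp1] at h
    simp only [inner_add_left, inner_add_right, inner_smul_left, inner_smul_right, g.inner_self,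
      g.inner_zero_one, g.inner_one_zero] at h
    have h2 : conj (α q * β q) = 0 := by
      rw [map_mul]; linear_combination (1 / 2 : ℂ) * h
    simpa using h2
  have hnorm : ∀ q, ‖α q‖ ^ 2 + ‖β q‖ ^ 2 = 1 := by
    intro q
    have h := B.C3.inner_map_map (g.u q 0) (g.u q 0)
    rw [g.inner_self, hexp] at h
    simp only [inner_add_left, inner_add_right, inner_smul_left, inner_smul_right, g.inner_self,
      g.inner_zero_one, g.inner_one_zero] at h
    rw [← Complex.normSq_eq_norm_sq, ← Complex.normSq_eq_norm_sq]
    have h2 : ((Complex.normSq (α q) + Complex.normSq (β q) : ℝ) : ℂ) = 1 := by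
      push_cast
      rw [← Complex.mul_conj, ← Complex.mul_conj]
      linear_combination h
    exact_mod_cast h2
  -- Orthogonality gives `α β = 0` and unitarity `|α|² + |β|² = 1`, so `|β|` takes only the values 0
  -- and 1. It is continuous and vanishes at Γ_M, where the gauge vectors are fixed; hence it
  -- vanishes everywhere.
  have hβ0 : ∀ q, β q = 0 := by
    have hcont : Continuous fun q => ‖β q‖ := by
      have h0 := (g.smooth 0).continuous
      have h1 := (g.smooth 1).continuous
      refine Continuous.norm (Continuous.inner (𝕜 := ℂ) ?_ ?_)
      · exact h1.comp (by fun_prop)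
      · exact B.C3.continuous.comp h0
    have hvals : ∀ q, ‖β q‖ = 0 ∨ ‖β q‖ = 1 := by
      intro q
      rcases mul_eq_zero.1 (horth q) with h | h
      · right
        have := hnorm q
        rw [h, norm_zero] at this
        nlinarith [norm_nonneg (β q)]
      · left; rw [h, norm_zero]
    have hz : β 0 = 0 := by
      simp only [hβ, mul_zero, g.C3_Gamma, g.inner_one_zero]
    intro q
    by_contra h
    have hq1 : ‖β q‖ = 1 := (hvals q).resolve_left (by simpa using h)
    have hiv := isPreconnected_univ.intermediate_value (Set.mem_univ (0 : ℂ)) (Set.mem_univ q)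
      hcont.continuousOn
    obtain ⟨r, -, hr⟩ := hiv (show (1 / 2 : ℝ) ∈ Set.Icc ‖β 0‖ ‖β q‖ by
      rw [hz, hq1]; norm_num)
    simp only at hr
    rcases hvals r with h' | h' <;> rw [h'] at hr <;> norm_num at hr
  refine ⟨α k, ?_, ?_, ?_⟩
  · have := hnorm k
    rw [hβ0, norm_zero] at this
    nlinarith [norm_nonneg (α k)]
  · rw [hexp, hβ0, zero_smul, add_zero]
  · rw [hexp1, hβ0, map_zero, zero_smul, add_zero]

/-- Two families `A`, `A'` are allowed because the rotation maps a component of the `E` doublet to a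
linear combination of both; for a Hamiltonian `A = A'`. The phase is the same in all these cases. -/
theorem exists_C3_cocycle (k : ℂ) :
    ∃ c : ℂ, ‖c‖ = 1 ∧ ∀ A A' : ℂ → (Hp →L[ℂ] Hp),
      (∀ x, A' (omega3 * k) (B.C3 x) = B.C3 (A k x)) →
      gaugeElt g A' 1 0 (omega3 * k) = c * gaugeElt g A 1 0 k := by
  obtain ⟨c, hc, h0, h1⟩ := g.exists_C3_phase k
  have hcc : c * conj c = 1 := by
    rw [Complex.mul_conj, Complex.normSq_eq_norm_sq, hc]; simp
  have h0' : g.u (omega3 * k) 0 = conj c • B.C3 (g.u k 0) := by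
    rw [h0, smul_smul, mul_comm (conj c), hcc, one_smul]
  have h1' : g.u (omega3 * k) 1 = c • B.C3 (g.u k 1) := by
    rw [h1, smul_smul, hcc, one_smul]
  refine ⟨conj c * conj c, by rw [norm_mul, Complex.norm_conj, hc, one_mul], fun A A' hA => ?_⟩
  simp only [gaugeElt, h0', h1', map_smul, hA, inner_smul_left, inner_smul_right,
    LinearIsometryEquiv.inner_map_map]
  ring

end ChernGauge

/-! ### Hamiltonians and pairings in the Chern gauge -/

theorem fFun_eq (g : ChernGauge B) (Ph : ℂ → (Hp →L[ℂ] Hp)) : fFun g Ph = gaugeElt g Ph 1 0 := rfl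

theorem epsFun_eq (g : ChernGauge B) (Ph : ℂ → (Hp →L[ℂ] Hp)) (k : ℂ) :
    epsFun g Ph k = (gaugeElt g Ph 0 0 k).re := rfl

theorem pairMat_zero (C2 : Hp ≃ₗᵢ[ℂ] Hm) (g : ChernGauge B) (D : ℂ → (Hm →L[ℂ] Hp)) (k : ℂ)
    (a : Fin 2) : pairMat C2 g D k a 0 = gaugeElt g (pairOp C2 D) a 1 k := by
  simp only [pairMat, Matrix.of_apply, gaugeElt, pairOp_apply, g.T_u]

theorem pairMat_one (C2 : Hp ≃ₗᵢ[ℂ] Hm) (g : ChernGauge B) (D : ℂ → (Hm →L[ℂ] Hp)) (k : ℂ)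
    (a : Fin 2) : pairMat C2 g D k a 1 = gaugeElt g (pairOp C2 D) a 0 k := by
  simp only [pairMat, Matrix.of_apply, gaugeElt, pairOp_apply, g.T_u_one]

theorem dFun_eq (C2 : Hp ≃ₗᵢ[ℂ] Hm) (g : ChernGauge B) (D : ℂ → (Hm →L[ℂ] Hp)) :
    dFun C2 g D = gaugeElt g (pairOp C2 D) 1 0 :=
  funext fun k => pairMat_one C2 g D k 1

/-- The amplitude of the trivial channel. -/
def aFun (C2 : Hp ≃ₗᵢ[ℂ] Hm) (g : ChernGauge B) (D : ℂ → (Hm →L[ℂ] Hp)) (k : ℂ) : ℝ :=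
  (gaugeElt g (pairOp C2 D) 0 0 k).re

theorem IsBandHamiltonian.hMat_eq {g : ChernGauge B} {Ph : ℂ → (Hp →L[ℂ] Hp)}
    (h : IsBandHamiltonian B Ph) (k : ℂ) :
    hMat g Ph k = !![(epsFun g Ph k : ℂ), conj (fFun g Ph k); fFun g Ph k, (epsFun g Ph k : ℂ)] := by
  have hr : (epsFun g Ph k : ℂ) = gaugeElt g Ph 0 0 k := by
    rw [epsFun_eq]
    refine Complex.conj_eq_iff_re.1 ?_
    simp only [gaugeElt]
    rw [inner_conj_symm]
    have := (h.selfAdjoint k).isSymmetric (g.u k 0) (g.u k 0)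
    exact this
  ext a c
  fin_cases a <;> fin_cases c
  · exact hr.symm
  · exact g.gaugeElt_zero_one h.c2t k
  · rfl
  · change gaugeElt g Ph 1 1 k = epsFun g Ph k
    rw [g.gaugeElt_one_one h.c2t, ← hr, Complex.conj_ofReal]

theorem IsPairing.contDiff_pairOp {C2 : Hp ≃ₗᵢ[ℂ] Hm} {D : ℂ → (Hm →L[ℂ] Hp)}
    (h : ContDiff ℝ ∞ D) : ContDiff ℝ ∞ (pairOp C2 D) := by
  exact ((((ContinuousLinearMap.compL ℂ Hp Hm Hp).flip
    (C2.toContinuousLinearEquiv : Hp →L[ℂ] Hm)).restrictScalars ℝ).contDiff).comp h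

theorem IsPairing.translationInvariant {C2 : Hp ≃ₗᵢ[ℂ] Hm} {D : ℂ → (Hm →L[ℂ] Hp)}
    (h : IsPairing B C2 D) : TranslationInvariant B (pairOp C2 D) :=
  fun G hG k x => h.periodic G hG k x

theorem IsPairing.tInvariant {C2 : Hp ≃ₗᵢ[ℂ] Hm} {D : ℂ → (Hm →L[ℂ] Hp)}
    (h : IsPairing B C2 D) : TInvariant B (pairOp C2 D) :=
  fun k x => h.c2t k x

/-- `T` conjugates the elements under exchange of the two Chern states, and parity evenness makes
the two perpendicular entries equal; together they force these entries to be real. -/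
theorem IsPairing.pairMat_eq {C2 : Hp ≃ₗᵢ[ℂ] Hm} {g : ChernGauge B} {D : ℂ → (Hm →L[ℂ] Hp)}
    (h : IsPairing B C2 D) (k : ℂ) :
    pairMat C2 g D k = !![conj (dFun C2 g D k), (aFun C2 g D k : ℂ);
      (aFun C2 g D k : ℂ), dFun C2 g D k] := by
  have h10 : gaugeElt g (pairOp C2 D) 1 1 k = gaugeElt g (pairOp C2 D) 0 0 k := by
    have := h.parityEven k (g.u k 0) (g.u k 1)
    rw [g.T_u, g.T_u_one] at this
    exact this
  have hr : (aFun C2 g D k : ℂ) = gaugeElt g (pairOp C2 D) 0 0 k := by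
    refine Complex.conj_eq_iff_re.1 ?_
    rw [← g.gaugeElt_one_one h.tInvariant, h10]
  ext a c
  fin_cases a <;> fin_cases c
  · change pairMat C2 g D k 0 0 = _
    rw [pairMat_zero, g.gaugeElt_zero_one h.tInvariant, dFun_eq]; rfl
  · change pairMat C2 g D k 0 1 = _
    rw [pairMat_one, ← hr]; rfl
  · change pairMat C2 g D k 1 0 = _
    rw [pairMat_zero, h10, ← hr]; rfl
  · rfl

end

end

/-! ### Sections, bands and `Σ` in the Chern gauge -/

noncomputable section

set_option linter.unusedSectionVars false

section

variable {Hp Hm : Type*} [NormedAddCommGroup Hp] [InnerProductSpace ℂ Hp] [CompleteSpace Hp]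
  [NormedAddCommGroup Hm] [InnerProductSpace ℂ Hm] [CompleteSpace Hm] {B : MoireBands Hp}
  {C2 : Hp ≃ₗᵢ[ℂ] Hm} {g : ChernGauge B}

theorem contDiff_dFun {D : ℂ → (Hm →L[ℂ] Hp)} (hD : ContDiff ℝ ∞ D) :
    ContDiff ℝ ∞ (dFun C2 g D) := by
  rw [dFun_eq]
  exact g.contDiff_gaugeElt (IsPairing.contDiff_pairOp hD) 1 0

theorem contDiff_fFun {Ph : ℂ → (Hp →L[ℂ] Hp)} (hPh : ContDiff ℝ ∞ Ph) :
    ContDiff ℝ ∞ (fFun g Ph) :=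
  g.contDiff_gaugeElt hPh 1 0

theorem continuous_epsFun {Ph : ℂ → (Hp →L[ℂ] Hp)} (hPh : ContDiff ℝ ∞ Ph) :
    Continuous (epsFun g Ph) :=
  Complex.continuous_re.comp (g.contDiff_gaugeElt hPh 0 0).continuous

theorem continuous_aFun {D : ℂ → (Hm →L[ℂ] Hp)} (hD : ContDiff ℝ ∞ D) :
    Continuous (aFun C2 g D) :=
  Complex.continuous_re.comp
    (g.contDiff_gaugeElt (IsPairing.contDiff_pairOp hD) 0 0).continuous

/-- `d` and `f` are sections of the same line bundle, so `d ± i s f` is a section as well and `f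
conj d`, `|d|`, `|f|` are periodic. The whole topological argument rests on this. -/
theorem section_cocycle {Ph : ℂ → (Hp →L[ℂ] Hp)} {D : ℂ → (Hm →L[ℂ] Hp)}
    (hPh : IsBandHamiltonian B Ph) (hD : IsPairing B C2 D) :
    ∀ G ∈ recipLattice B.b, ∀ k, ∃ c : ℂ, ‖c‖ = 1 ∧ dFun C2 g D (k + G) = c * dFun C2 g D k ∧
      fFun g Ph (k + G) = c * fFun g Ph k := by
  intro G hG k
  obtain ⟨c, hc, h⟩ := g.exists_cocycle G hG k
  rw [dFun_eq]
  exact ⟨c, hc, (h _ hD.translationInvariant).1, (h Ph hPh.periodic).1⟩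

theorem epsFun_periodic {Ph : ℂ → (Hp →L[ℂ] Hp)} (hPh : IsBandHamiltonian B Ph) :
    ∀ G ∈ recipLattice B.b, ∀ k, epsFun g Ph (k + G) = epsFun g Ph k := by
  intro G hG k
  obtain ⟨c, -, h⟩ := g.exists_cocycle G hG k
  rw [epsFun_eq, (h Ph hPh.periodic).2, epsFun_eq]

theorem aFun_periodic {D : ℂ → (Hm →L[ℂ] Hp)} (hD : IsPairing B C2 D) :
    ∀ G ∈ recipLattice B.b, ∀ k, aFun C2 g D (k + G) = aFun C2 g D k := by
  intro G hG k
  obtain ⟨c, -, h⟩ := g.exists_cocycle G hG k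
  rw [aFun, (h _ hD.translationInvariant).2, aFun]

theorem norm_dFun_periodic {D : ℂ → (Hm →L[ℂ] Hp)} (hD : IsPairing B C2 D) :
    ∀ G ∈ recipLattice B.b, ∀ k, ‖dFun C2 g D (k + G)‖ = ‖dFun C2 g D k‖ := by
  intro G hG k
  obtain ⟨c, hc, h⟩ := g.exists_cocycle G hG k
  rw [dFun_eq, (h _ hD.translationInvariant).1, norm_mul, hc, one_mul]

theorem norm_fFun_periodic {Ph : ℂ → (Hp →L[ℂ] Hp)} (hPh : IsBandHamiltonian B Ph) :
    ∀ G ∈ recipLattice B.b, ∀ k, ‖fFun g Ph (k + G)‖ = ‖fFun g Ph k‖ := by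
  intro G hG k
  obtain ⟨c, hc, h⟩ := g.exists_cocycle G hG k
  rw [fFun_eq, (h _ hPh.periodic).1, norm_mul, hc, one_mul]

theorem bands_set_eq {Ph : ℂ → (Hp →L[ℂ] Hp)} (hPh : IsBandHamiltonian B Ph) (k : ℂ) :
    {E : ℝ | (hMat g Ph k - (E : ℂ) • 1).det = 0} =
      {epsFun g Ph k - ‖fFun g Ph k‖, epsFun g Ph k + ‖fFun g Ph k‖} := by
  ext E
  have h : (hMat g Ph k - (E : ℂ) • 1).det =
      ((((epsFun g Ph k - E) ^ 2 - ‖fFun g Ph k‖ ^ 2 : ℝ)) : ℂ) := by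
    rw [hPh.hMat_eq, ← Complex.normSq_eq_norm_sq]
    push_cast
    rw [← Complex.mul_conj, Matrix.det_fin_two]
    simp
    ring
  rw [Set.mem_ofPred_eq, h, Complex.ofReal_eq_zero, sub_eq_zero, sq_eq_sq_iff_eq_or_eq_neg]
  simp only [Set.mem_insert_iff, Set.mem_singleton_iff]
  constructor
  · rintro (h | h)
    · left; linarith
    · right; linarith
  · rintro (h | h)
    · left; linarith
    · right; linarith

theorem lowerBand_eq {Ph : ℂ → (Hp →L[ℂ] Hp)} (hPh : IsBandHamiltonian B Ph) (k : ℂ) :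
    lowerBand g Ph k = epsFun g Ph k - ‖fFun g Ph k‖ := by
  rw [lowerBand, bands_set_eq hPh, csInf_pair, min_eq_left]
  linarith [norm_nonneg (fFun g Ph k)]

theorem upperBand_eq {Ph : ℂ → (Hp →L[ℂ] Hp)} (hPh : IsBandHamiltonian B Ph) (k : ℂ) :
    upperBand g Ph k = epsFun g Ph k + ‖fFun g Ph k‖ := by
  rw [upperBand, bands_set_eq hPh, csSup_pair, max_eq_right]
  linarith [norm_nonneg (fFun g Ph k)]

/-- A nematic pairing vanishes at momenta where `C_{3z}` acts on the off-diagonal matrix elements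
of the first kind trivially. -/
theorem eq_zero_of_nematic_fixed {d₁ d₂ : ℂ}
    (h₁ : d₁ = Real.cos (2 * Real.pi / 3) * d₁ + Real.sin (2 * Real.pi / 3) * d₂)
    (h₂ : d₂ = -Real.sin (2 * Real.pi / 3) * d₁ + Real.cos (2 * Real.pi / 3) * d₂) :
    d₁ = 0 ∧ d₂ = 0 := by
  have hs : (2 * Real.pi / 3 : ℝ) = Real.pi - Real.pi / 3 := by ring
  have hc' : Real.cos (2 * Real.pi / 3) = -(1 / 2) := by
    rw [hs, Real.cos_pi_sub, Real.cos_pi_div_three]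
  have hs' : Real.sin (2 * Real.pi / 3) = √3 / 2 := by
    rw [hs, Real.sin_pi_sub, Real.sin_pi_div_three]
  have h3 : ((√3 : ℝ) : ℂ) * ((√3 : ℝ) : ℂ) = 3 := by
    rw [← Complex.ofReal_mul, Real.mul_self_sqrt (by norm_num)]; norm_num
  rw [hc', hs'] at h₁ h₂
  push_cast at h₁ h₂
  -- The difference of the identity and the rotation by 2π/3 has determinant 3; the coefficients are
  -- the rows of its inverse.
  constructor
  · linear_combination (1 / 2 : ℂ) * h₁ + (1 / 6 * ((√3 : ℝ) : ℂ)) * h₂ - (d₁ / 12) * h3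
  · linear_combination (-1 / 6 * ((√3 : ℝ) : ℂ)) * h₁ + (1 / 2 : ℂ) * h₂ - (d₂ / 12) * h3

/-- The `E` components of a nematic pairing, as matrix elements. -/
theorem IsNematic.exists_components {D : ℂ → (Hm →L[ℂ] Hp)} (h : IsNematic C2 g D) :
    ∃ (a₁ a₂ : ℂ) (A₁ A₂ : ℂ → (Hp →L[ℂ] Hp)), TranslationInvariant B A₁ ∧
      TranslationInvariant B A₂ ∧
      (∀ k, dFun C2 g D k = a₁ * gaugeElt g A₁ 1 0 k + a₂ * gaugeElt g A₂ 1 0 k) ∧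
      (∀ k, ∃ c : ℂ, ‖c‖ = 1 ∧
        (∀ Ph, IsBandHamiltonian B Ph → fFun g Ph (omega3 * k) = c * fFun g Ph k) ∧
        c * gaugeElt g A₁ 1 0 k = Real.cos (2 * Real.pi / 3) * gaugeElt g A₁ 1 0 (omega3 * k) +
          Real.sin (2 * Real.pi / 3) * gaugeElt g A₂ 1 0 (omega3 * k) ∧
        c * gaugeElt g A₂ 1 0 k = -Real.sin (2 * Real.pi / 3) * gaugeElt g A₁ 1 0 (omega3 * k) +
          Real.cos (2 * Real.pi / 3) * gaugeElt g A₂ 1 0 (omega3 * k)) := by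
  obtain ⟨a₁, a₂, D₁, D₂, p₁, p₂, -, -, hD, r₁, r₂⟩ := h
  refine ⟨a₁, a₂, pairOp C2 D₁, pairOp C2 D₂, p₁.translationInvariant, p₂.translationInvariant,
    fun k => ?_, fun k => ?_⟩
  · rw [dFun_eq]
    simp only [gaugeElt, pairOp_apply, hD, add_apply,
      smul_apply, inner_add_right, inner_smul_right]
  · obtain ⟨c, hc, hcA⟩ := g.exists_C3_cocycle k
    refine ⟨c, hc, fun Ph hPh => ?_, ?_, ?_⟩
    · exact hcA Ph Ph (fun x => hPh.c3 k x)
    · rw [← hcA (pairOp C2 D₁) (fun q => (Real.cos (2 * Real.pi / 3) : ℂ) • pairOp C2 D₁ q +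
        (Real.sin (2 * Real.pi / 3) : ℂ) • pairOp C2 D₂ q) (fun x => by
          simp only [add_apply, smul_apply, pairOp_apply]
          rw [r₁])]
      simp only [gaugeElt, add_apply, smul_apply,
        inner_add_right, inner_smul_right]
    · rw [← hcA (pairOp C2 D₂) (fun q => (-Real.sin (2 * Real.pi / 3) : ℂ) • pairOp C2 D₁ q +
        (Real.cos (2 * Real.pi / 3) : ℂ) • pairOp C2 D₂ q) (fun x => by
          simp only [add_apply, smul_apply, pairOp_apply]
          rw [r₂])]
      simp only [gaugeElt, add_apply, smul_apply,
        inner_add_right, inner_smul_right]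

/-- At Γ_M the rotation fixes the momentum and both gauge vectors, so the two components of the
doublet form a vector fixed by a rotation by 2π/3. -/
theorem IsNematic.dFun_zero {D : ℂ → (Hm →L[ℂ] Hp)} (h : IsNematic C2 g D) :
    dFun C2 g D 0 = 0 := by
  obtain ⟨a₁, a₂, D₁, D₂, -, -, -, -, hD, r₁, r₂⟩ := h
  have hu : ∀ a, B.C3 (g.u 0 a) = g.u 0 a := g.C3_Gamma
  have key : ∀ y : Hp, inner ℂ (g.u 0 1) (B.C3 y) = inner ℂ (g.u 0 1) y := by
    intro y
    conv_lhs => rw [← hu 1]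
    rw [LinearIsometryEquiv.inner_map_map]
  have e₁ := congrArg (inner ℂ (g.u 0 1)) (r₁ 0 (g.u 0 0))
  have e₂ := congrArg (inner ℂ (g.u 0 1)) (r₂ 0 (g.u 0 0))
  rw [key, hu, mul_zero, inner_add_right, inner_smul_right, inner_smul_right] at e₁ e₂
  obtain ⟨z₁, z₂⟩ := eq_zero_of_nematic_fixed e₁ e₂
  rw [dFun_eq]
  simp only [gaugeElt, pairOp_apply, hD, add_apply,
    smul_apply, inner_add_right, inner_smul_right]
  rw [z₁, z₂]; simp

/-- At a momentum fixed by `C_{3z}` modulo the lattice, `d_∥` or `f` vanishes. -/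
theorem Admissible.dFun_eq_zero_or_fFun_eq_zero {x : MeanField Hp Hm} (hx : Admissible C2 g x)
    {k : ℂ} (hk : omega3 * k - k ∈ recipLattice B.b) :
    dFun C2 g x.Ppar k = 0 ∨ fFun g x.Ph k = 0 := by
  obtain ⟨a₁, a₂, A₁, A₂, t₁, t₂, hd, hC⟩ := hx.nematic.exists_components
  obtain ⟨c, -, hf, h₁, h₂⟩ := hC k
  obtain ⟨c', hc', hG⟩ := g.exists_cocycle _ hk k
  rw [add_sub_cancel] at hG
  have hf' := hf _ hx.band
  rw [fFun_eq, (hG _ hx.band.periodic).1] at hf'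
  rw [fFun_eq]
  rcases eq_or_ne (gaugeElt g x.Ph 1 0 k) 0 with h | h
  · exact Or.inr h
  left
  -- A nonzero `f` forces the phase of the rotation to agree with that of the translation bringing
  -- `ω k` back to `k`. The doublet then transforms at `k` as it does at Γ_M and must vanish.
  have hcc := mul_right_cancel₀ h hf'
  have hc0 : c' ≠ 0 := by rintro rfl; simp at hc'
  rw [(hG _ t₁).1, (hG _ t₂).1, ← hcc] at h₁ h₂
  obtain ⟨z₁, z₂⟩ := eq_zero_of_nematic_fixed
    (mul_left_cancel₀ hc0 (h₁.trans (by ring :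
      _ = c' * (Real.cos (2 * Real.pi / 3) * gaugeElt g A₁ 1 0 k +
        Real.sin (2 * Real.pi / 3) * gaugeElt g A₂ 1 0 k))))
    (mul_left_cancel₀ hc0 (h₂.trans (by ring :
      _ = c' * (-Real.sin (2 * Real.pi / 3) * gaugeElt g A₁ 1 0 k +
        Real.cos (2 * Real.pi / 3) * gaugeElt g A₂ 1 0 k))))
  rw [hd, z₁, z₂]; simp

/-! ### The set `Σ` -/

/-- For `f ≠ 0` both sides say that `d / f` is imaginary of modulus at most 1; the sign of its
imaginary part selects the alternative. This description of `Σ` by one equation and one inequality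
is the one used from here on. -/
theorem exists_mem_Icc_iff (d f : ℂ) :
    (∃ s ∈ Set.Icc (0 : ℝ) 1, d + Complex.I * s * f = 0 ∨ d - Complex.I * s * f = 0) ↔
      (f * conj d).re = 0 ∧ ‖d‖ ≤ ‖f‖ := by
  constructor
  · rintro ⟨s, ⟨hs0, hs1⟩, h | h⟩
    · have hd : d = -(Complex.I * s * f) := by linear_combination h
      subst hd
      refine ⟨by simp; ring, ?_⟩
      simp only [norm_neg, norm_mul, Complex.norm_I, one_mul, Complex.norm_real,
        Real.norm_of_nonneg hs0]
      exact mul_le_of_le_one_left (norm_nonneg _) hs1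
    · have hd : d = Complex.I * s * f := by linear_combination h
      subst hd
      refine ⟨by simp; ring, ?_⟩
      simp only [norm_mul, Complex.norm_I, one_mul, Complex.norm_real, Real.norm_of_nonneg hs0]
      exact mul_le_of_le_one_left (norm_nonneg _) hs1
  · rintro ⟨hre, hle⟩
    by_cases hf : f = 0
    · have hd : d = 0 := by simpa [hf] using hle
      exact ⟨0, by simp, by simp [hd]⟩
    have hd : d = Complex.I * (d / f).im * f := by
      have h1 : (d / f).re = 0 := by
        rw [Complex.div_re]
        simp only [Complex.mul_re, Complex.conj_re, Complex.conj_im] at hre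
        rw [← add_div]
        have : d.re * f.re + d.im * f.im = 0 := by linarith
        rw [this, zero_div]
      have h2 : d / f = Complex.I * (d / f).im := by
        apply Complex.ext <;> simp [h1]
      calc d = d / f * f := by field_simp
        _ = _ := by rw [← h2]
    set t := (d / f).im
    have ht : |t| ≤ 1 := by
      have h3 : ‖d‖ = |t| * ‖f‖ := by
        conv_lhs => rw [hd]
        simp
      have hf' := norm_pos_iff.2 hf
      rw [h3] at hle
      exact le_of_mul_le_mul_right (by linarith) hf'
    rcases le_total 0 t with h | h
    · refine ⟨t, ⟨h, (le_abs_self t).trans ht⟩, Or.inr ?_⟩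
      linear_combination hd
    · refine ⟨-t, ⟨by linarith, (neg_le_abs t).trans ht⟩, Or.inl ?_⟩
      push_cast
      linear_combination hd

theorem add_or_sub_eq_zero {d f : ℂ} (hre : (f * conj d).re = 0) (h : ‖d‖ = ‖f‖) :
    d + Complex.I * f = 0 ∨ d - Complex.I * f = 0 := by
  obtain ⟨s, ⟨hs0, hs1⟩, hs⟩ := (exists_mem_Icc_iff d f).2 ⟨hre, h.le⟩
  by_cases hf : f = 0
  · have : d = 0 := by simpa [hf] using h
    left; simp [hf, this]
  have hn : ‖d‖ = s * ‖f‖ := by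
    have hd : d = -(Complex.I * s * f) ∨ d = Complex.I * s * f :=
      hs.imp (fun h => by linear_combination h) (fun h => by linear_combination h)
    rcases hd with hd | hd <;> rw [hd] <;> simp [abs_of_nonneg hs0]
  have hs1' : s = 1 := by
    have hf' := norm_pos_iff.2 hf
    rw [h] at hn
    exact mul_right_cancel₀ hf'.ne' (by linarith)
  subst hs1'
  simpa using hs

theorem mem_SigmaSet {x : MeanField Hp Hm} {k : ℂ} :
    k ∈ SigmaSet C2 g x ↔ (fFun g x.Ph k * conj (dFun C2 g x.Ppar k)).re = 0 ∧
      ‖dFun C2 g x.Ppar k‖ ≤ ‖fFun g x.Ph k‖ :=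
  exists_mem_Icc_iff _ _

end

end

noncomputable section

set_option linter.unusedSectionVars false

section

variable {Hp Hm : Type*} [NormedAddCommGroup Hp] [InnerProductSpace ℂ Hp] [CompleteSpace Hp]
  [NormedAddCommGroup Hm] [InnerProductSpace ℂ Hm] [CompleteSpace Hm] {B : MoireBands Hp}
  {C2 : Hp ≃ₗᵢ[ℂ] Hm} {g : ChernGauge B}

/-! ### The Bogoliubov-de Gennes determinant -/

/-- For real `e`, `a` and `f' = conj f`, `d' = conj d` the two factors are conjugate. The real part
of the first is `e² - a² - |f|² + |d|²` and its imaginary part is `2 (a e - Re (f conj d))`, so a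
node amounts to two real equations. -/
theorem det_bdg_form (e a f f' d d' : ℂ) :
    (Matrix.fromBlocks !![e, f'; f, e] !![d', a; a, d] !![d, a; a, d'] (-!![e, f; f', e])).det =
      ((e + Complex.I * a) ^ 2 - (f + Complex.I * d) * (f' + Complex.I * d')) *
      ((e - Complex.I * a) ^ 2 - (f - Complex.I * d) * (f' - Complex.I * d')) := by
  rw [← Matrix.det_submatrix_equiv_self (finSumFinEquiv (m := 2) (n := 2)).symm]
  have hI : Complex.I * Complex.I = -1 := Complex.I_mul_I
  have h0 : (finSumFinEquiv (m := 2) (n := 2)).symm 0 = Sum.inl 0 := by decide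
  have h1 : (finSumFinEquiv (m := 2) (n := 2)).symm 1 = Sum.inl 1 := by decide
  have h2 : (finSumFinEquiv (m := 2) (n := 2)).symm 2 = Sum.inr 0 := by decide
  have h3 : (finSumFinEquiv (m := 2) (n := 2)).symm 3 = Sum.inr 1 := by decide
  have hM : (Matrix.fromBlocks !![e, f'; f, e] !![d', a; a, d] !![d, a; a, d']
      (-!![e, f; f', e])).submatrix (finSumFinEquiv (m := 2) (n := 2)).symm
        (finSumFinEquiv (m := 2) (n := 2)).symm =
      !![e, f', d', a; f, e, a, d; d, a, -e, -f; a, d', -f', -e] := by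
    ext i j
    fin_cases i <;> fin_cases j <;>
      simp [Matrix.submatrix_apply, h0, h1, h2, h3]
  rw [hM, Matrix.det_succ_row_zero]
  simp [Fin.sum_univ_succ, Matrix.det_fin_three, Fin.succAbove, Matrix.submatrix_apply]
  ring_nf
  simp only [Complex.I_sq, show Complex.I ^ 4 = 1 from Complex.I_pow_four]
  ring

/-- The deviation of the normal-state energy from a node of the parallel channel. -/
def nodeFun (C2 : Hp ≃ₗᵢ[ℂ] Hm) (g : ChernGauge B) (x : MeanField Hp Hm) (k : ℂ) : ℝ :=
  (epsFun g x.Ph k - x.μ) ^ 2 - ‖fFun g x.Ph k‖ ^ 2 + ‖dFun C2 g x.Ppar k‖ ^ 2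

theorem IsParallel.aFun_eq_zero {D : ℂ → (Hm →L[ℂ] Hp)} (h : IsParallel C2 g D) (k : ℂ) :
    aFun C2 g D k = 0 := by
  have := (h k).1
  rw [pairMat_one] at this
  rw [aFun, this]; rfl

theorem IsPerp.dFun_eq_zero {D : ℂ → (Hm →L[ℂ] Hp)} (h : IsPerp C2 g D) (k : ℂ) :
    dFun C2 g D k = 0 := (h k).2

theorem det_bdg_eq_zero {x : MeanField Hp Hm} (hx : Admissible C2 g x)
    {Pperp : ℂ → (Hm →L[ℂ] Hp)} (hP : IsPairing B C2 Pperp) (hperp : IsPerp C2 g Pperp) {k : ℂ}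
    (h : nodeFun C2 g x k - aFun C2 g Pperp k ^ 2 = 0)
    (h' : (fFun g x.Ph k * conj (dFun C2 g x.Ppar k)).re =
      aFun C2 g Pperp k * (epsFun g x.Ph k - x.μ)) :
    (bdg C2 g x Pperp k).det = 0 := by
  have hS : pairMat C2 g Pperp k + pairMat C2 g x.Ppar k =
      !![conj (dFun C2 g x.Ppar k), (aFun C2 g Pperp k : ℂ);
        (aFun C2 g Pperp k : ℂ), dFun C2 g x.Ppar k] := by
    rw [hP.pairMat_eq, hx.pairing.pairMat_eq, hperp.dFun_eq_zero, hx.parallel.aFun_eq_zero]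
    ext i j
    fin_cases i <;> fin_cases j <;> simp
  have hSH : (pairMat C2 g Pperp k + pairMat C2 g x.Ppar k).conjTranspose =
      !![dFun C2 g x.Ppar k, (aFun C2 g Pperp k : ℂ);
        (aFun C2 g Pperp k : ℂ), conj (dFun C2 g x.Ppar k)] := by
    rw [hS]
    ext i j
    fin_cases i <;> fin_cases j <;> simp
  have hh : hMat g x.Ph k - (x.μ : ℂ) • 1 =
      !![((epsFun g x.Ph k - x.μ : ℝ) : ℂ), conj (fFun g x.Ph k);
        fFun g x.Ph k, ((epsFun g x.Ph k - x.μ : ℝ) : ℂ)] := by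
    rw [hx.band.hMat_eq]
    ext i j
    fin_cases i <;> fin_cases j <;> simp
  have hT : (hMat g x.Ph k - (x.μ : ℂ) • 1).transpose =
      !![((epsFun g x.Ph k - x.μ : ℝ) : ℂ), fFun g x.Ph k;
        conj (fFun g x.Ph k), ((epsFun g x.Ph k - x.μ : ℝ) : ℂ)] := by
    rw [hh]
    ext i j
    fin_cases i <;> fin_cases j <;> simp
  rw [bdg, hSH, hT, hS, hh, det_bdg_form]
  refine mul_eq_zero_of_left ?_ _
  simp only [nodeFun] at h
  rw [← Complex.normSq_eq_norm_sq, ← Complex.normSq_eq_norm_sq] at h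
  generalize dFun C2 g x.Ppar k = d at *
  generalize fFun g x.Ph k = f at *
  generalize epsFun g x.Ph k - x.μ = e at *
  generalize aFun C2 g Pperp k = a at *
  simp only [Complex.normSq_apply, Complex.mul_re, Complex.conj_re, Complex.conj_im] at h h'
  apply Complex.ext
  · simp [pow_two]
    linarith
  · simp [pow_two]
    linarith

theorem pairAmp_eq {D : ℂ → (Hm →L[ℂ] Hp)} (hP : IsPairing B C2 D) (hperp : IsPerp C2 g D)
    (k : ℂ) : pairAmp C2 g D k = |aFun C2 g D k| := by
  rw [pairAmp, hP.pairMat_eq, hperp.dFun_eq_zero, ← Real.sqrt_sq_eq_abs]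
  have hH : (!![conj 0, (aFun C2 g D k : ℂ); (aFun C2 g D k : ℂ), 0]).conjTranspose =
      !![0, (aFun C2 g D k : ℂ); (aFun C2 g D k : ℂ), 0] := by
    ext i j
    fin_cases i <;> fin_cases j <;> simp
  rw [hH]
  congr 1
  simp [Matrix.trace_fin_two]
  ring

/-- The open dense condition under which nodes are enforced. -/
def NodeRegular (C2 : Hp ≃ₗᵢ[ℂ] Hm) (g : ChernGauge B) (x : MeanField Hp Hm) : Prop :=
  nodeFun C2 g x 0 < 0 ∧ ∀ k, dFun C2 g x.Ppar k = 0 → nodeFun C2 g x k ≠ 0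

/-- Stated for any periodic amplitude `a`, since two cases are needed: the amplitude of a
perpendicular pairing, for nodal enforcement, and `a = 0`, for the energy window. -/
theorem NodeRegular.exists_node {x : MeanField Hp Hm} (hband : IsBandHamiltonian B x.Ph)
    (hpair : IsPairing B C2 x.Ppar) (hnem : IsNematic C2 g x.Ppar)
    (hz : HasTwoZeros B.b (dFun C2 g x.Ppar)) (hreg : NodeRegular C2 g x) :
    ∃ lam : ℝ, 0 < lam ∧ ∀ a : ℂ → ℝ, Continuous a →
      (∀ G ∈ recipLattice B.b, ∀ k, a (k + G) = a k) → (∀ k, |a k| < lam) →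
      ∃ k, nodeFun C2 g x k - a k ^ 2 = 0 ∧
        (fFun g x.Ph k * conj (dFun C2 g x.Ppar k)).re = a k * (epsFun g x.Ph k - x.μ) := by
  obtain ⟨lam, hlam, h⟩ := exists_node_of_small_perturbation B.b_ne
    (contDiff_dFun (C2 := C2) (g := g) hpair.smooth).continuous
    (contDiff_fFun (g := g) hband.smooth).continuous
    (e := fun k => epsFun g x.Ph k - x.μ)
    ((continuous_epsFun (g := g) hband.smooth).sub continuous_const)
    (section_cocycle hband hpair)
    (fun G hG k => by simp only [epsFun_periodic hband G hG]) hz hnem.dFun_zero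
    hreg.1 hreg.2
  refine ⟨lam, hlam, fun a ha hper hal => ?_⟩
  obtain ⟨k, hk, hk'⟩ := h a ha hper hal
  exact ⟨k, by simp only [nodeFun]; linarith, hk'⟩

theorem NodeRegular.nodalEnforced {x : MeanField Hp Hm} (hx : Admissible C2 g x)
    (hreg : NodeRegular C2 g x) : NodalEnforced C2 g x := by
  obtain ⟨lam, hlam, h⟩ := hreg.exists_node hx.band hx.pairing hx.nematic hx.zeros
  refine ⟨lam, hlam, fun Pperp hP hperp hsmall => ?_⟩
  obtain ⟨k, hk, hk'⟩ := h (aFun C2 g Pperp) (continuous_aFun hP.smooth) (aFun_periodic hP)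
    (fun k => by rw [← pairAmp_eq hP hperp]; exact hsmall k)
  exact ⟨k, det_bdg_eq_zero hx hP hperp hk hk'⟩

/-- The endpoints are the energies at Γ_M itself, where `d = 0`. For an interior energy `E`, the
chemical potential is replaced by `E`. If `E` were not in `E(Σ)`, it would not be a band energy at a
zero of `d`, so the data would be node-regular; but a node for `a = 0` is a point of `Σ` with energy
`E`. -/
theorem Admissible.Icc_subset_ESigma {x : MeanField Hp Hm} (hx : Admissible C2 g x) :
    Set.Icc (epsFun g x.Ph 0 - ‖fFun g x.Ph 0‖) (epsFun g x.Ph 0 + ‖fFun g x.Ph 0‖) ⊆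
      ESigma C2 g x := by
  have hd0 := hx.nematic.dFun_zero
  -- a momentum of `Σ` at which the two energies meet the level `E`
  have key : ∀ (k : ℂ) (E : ℝ), (fFun g x.Ph k * conj (dFun C2 g x.Ppar k)).re = 0 →
      (epsFun g x.Ph k - E) ^ 2 = ‖fFun g x.Ph k‖ ^ 2 - ‖dFun C2 g x.Ppar k‖ ^ 2 →
      E ∈ ESigma C2 g x := by
    intro k E h1 h2
    have hle : ‖dFun C2 g x.Ppar k‖ ≤ ‖fFun g x.Ph k‖ :=
      le_of_sq_le_sq (by nlinarith [sq_nonneg (epsFun g x.Ph k - E)]) (norm_nonneg _)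
    refine ⟨k, mem_SigmaSet.2 ⟨h1, hle⟩, ?_⟩
    rw [← h2, Real.sqrt_sq_eq_abs]
    rcases abs_choice (epsFun g x.Ph k - E) with h | h
    · right; rw [h]; ring
    · left; rw [h]; ring
  intro E hE
  rcases eq_or_lt_of_le hE.1 with h | hlo
  · refine key 0 E (by simp [hd0]) ?_
    rw [← h, hd0]; simp
  rcases eq_or_lt_of_le hE.2 with h | hhi
  · refine key 0 E (by simp [hd0]) ?_
    rw [h, hd0]; simp
  by_contra hnot
  set y : MeanField Hp Hm := ⟨E, x.Ph, x.Ppar⟩ with hy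
  have hreg : NodeRegular C2 g y := by
    constructor
    · simp only [nodeFun, hy, hd0]
      have : |epsFun g x.Ph 0 - E| < ‖fFun g x.Ph 0‖ := abs_lt.2 ⟨by linarith, by linarith⟩
      have := sq_lt_sq' (by linarith [abs_lt.1 this]) (abs_lt.1 this).2
      simp
      linarith
    · intro k hk h
      simp only [nodeFun, hy] at h hk
      exact hnot (key k E (by simp [hk]) (by linarith))
  obtain ⟨lam, hlam, h⟩ := hreg.exists_node (x := y) hx.band hx.pairing hx.nematic hx.zeros
  obtain ⟨k, hk, hk'⟩ := h (fun _ => 0) continuous_const (fun _ _ _ => rfl)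
    (fun _ => by simpa using hlam)
  simp only [nodeFun, hy] at hk hk'
  exact hnot (key k E (by rw [hk', zero_mul]) (by linarith))

/-! ### Continuity of the matrix elements in the data -/

theorem norm_gaugeElt_le (A : ℂ → (Hp →L[ℂ] Hp)) (a c : Fin 2) (k : ℂ) :
    ‖gaugeElt g A a c k‖ ≤ ‖A k‖ := by
  refine (norm_inner_le_norm _ _).trans ?_
  rw [g.norm_u, one_mul]
  refine ((A k).le_opNorm _).trans ?_
  rw [g.norm_u, mul_one]

theorem norm_pairOp_le (D : ℂ → (Hm →L[ℂ] Hp)) (k : ℂ) : ‖pairOp C2 D k‖ ≤ ‖D k‖ := by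
  refine ContinuousLinearMap.opNorm_le_bound _ (norm_nonneg _) fun x => ?_
  rw [pairOp_apply]
  refine ((D k).le_opNorm _).trans ?_
  rw [C2.norm_map]

theorem gaugeElt_sub (A A' : ℂ → (Hp →L[ℂ] Hp)) (a c : Fin 2) (k : ℂ) :
    gaugeElt g (fun q => A q - A' q) a c k = gaugeElt g A a c k - gaugeElt g A' a c k := by
  simp only [gaugeElt, sub_apply, inner_sub_right]

theorem pairOp_sub (D D' : ℂ → (Hm →L[ℂ] Hp)) :
    pairOp C2 (fun q => D q - D' q) = fun q => pairOp C2 D q - pairOp C2 D' q := by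
  ext q x
  simp [pairOp_apply]

theorem CloseTo.bounds {r : ℕ} {δ : ℝ} {x y : MeanField Hp Hm} (h : CloseTo r δ x y) (k : ℂ) :
    ‖fFun g x.Ph k - fFun g y.Ph k‖ < δ ∧ |epsFun g x.Ph k - epsFun g y.Ph k| < δ ∧
      ‖dFun C2 g x.Ppar k - dFun C2 g y.Ppar k‖ < δ := by
  obtain ⟨h1, h2⟩ := h.2 0 (Nat.zero_le _) k
  rw [norm_iteratedFDeriv_zero] at h1 h2
  refine ⟨?_, ?_, ?_⟩
  · rw [fFun_eq, fFun_eq, ← gaugeElt_sub]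
    exact (norm_gaugeElt_le _ 1 0 k).trans_lt h1
  · rw [epsFun_eq, epsFun_eq, ← Complex.sub_re, ← gaugeElt_sub]
    exact (Complex.abs_re_le_norm _).trans_lt ((norm_gaugeElt_le _ 0 0 k).trans_lt h1)
  · rw [dFun_eq, dFun_eq, ← gaugeElt_sub, ← pairOp_sub]
    exact (norm_gaugeElt_le _ 1 0 k).trans_lt ((norm_pairOp_le _ k).trans_lt h2)

theorem continuous_nodeFun {x : MeanField Hp Hm} (hx : Admissible C2 g x) :
    Continuous (nodeFun C2 g x) := by
  have h1 := (contDiff_dFun (C2 := C2) (g := g) hx.pairing.smooth).continuous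
  have h2 := (contDiff_fFun (g := g) hx.band.smooth).continuous
  have h3 := continuous_epsFun (g := g) hx.band.smooth
  unfold nodeFun
  fun_prop

theorem nodeFun_periodic {x : MeanField Hp Hm} (hx : Admissible C2 g x) :
    ∀ G ∈ recipLattice B.b, ∀ k, nodeFun C2 g x (k + G) = nodeFun C2 g x k := by
  intro G hG k
  simp only [nodeFun, norm_dFun_periodic hx.pairing G hG, norm_fFun_periodic hx.band G hG,
    epsFun_periodic hx.band G hG]

theorem abs_sq_sub_sq_le {a b M δ : ℝ} (ha : |a| ≤ M) (h : |a - b| ≤ δ) :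
    |a ^ 2 - b ^ 2| ≤ δ * (2 * M + δ) := by
  have hb : |a + b| ≤ 2 * M + δ := by
    have : a + b = 2 * a - (a - b) := by ring
    rw [this]
    refine (abs_sub _ _).trans ?_
    rw [abs_mul, abs_two]
    linarith
  have : a ^ 2 - b ^ 2 = (a - b) * (a + b) := by ring
  rw [this, abs_mul]
  exact mul_le_mul h hb (abs_nonneg _) ((abs_nonneg _).trans h)

/-- The zeros of `d` move under perturbation, so the condition is bounded uniformly: `max (|d|,
|nodeFun|)` has a positive minimum on the Brillouin zone. At a zero of the perturbed `d` the old
`|d|` is small, hence the old `|nodeFun|` is not. Uniform closeness without derivatives suffices. -/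
theorem relOpen_nodeRegular :
    RelOpen {x | Admissible C2 g x} {x | NodeRegular C2 g x} := by
  rintro x ⟨hx, hreg⟩
  have hx : Admissible C2 g x := hx
  have hd := (contDiff_dFun (C2 := C2) (g := g) hx.pairing.smooth).continuous
  have hf := (contDiff_fFun (g := g) hx.band.smooth).continuous
  have he := continuous_epsFun (g := g) hx.band.smooth
  have hφ := continuous_nodeFun hx
  obtain ⟨c, hc, hcmin⟩ := exists_pos_forall_le_of_periodic B.b_ne
    (φ := fun k => max (‖dFun C2 g x.Ppar k‖) (|nodeFun C2 g x k|)) (by fun_prop)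
    (fun G hG k => by simp only [norm_dFun_periodic hx.pairing G hG, nodeFun_periodic hx G hG])
    (fun k => by
      by_cases h : dFun C2 g x.Ppar k = 0
      · exact lt_max_of_lt_right (abs_pos.2 (hreg.2 k h))
      · exact lt_max_of_lt_left (norm_pos_iff.2 h))
  obtain ⟨M, hM⟩ := exists_forall_le_of_periodic B.b_ne
    (φ := fun k => |epsFun g x.Ph k - x.μ| + ‖fFun g x.Ph k‖) (by fun_prop)
    (fun G hG k => by simp only [epsFun_periodic hx.band G hG, norm_fFun_periodic hx.band G hG])
  have hM0 : 0 ≤ M := (by positivity : (0 : ℝ) ≤ _).trans (hM 0)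
  set η : ℝ := min c (-nodeFun C2 g x 0) with hη
  have hη0 : 0 < η := lt_min hc (by linarith [hreg.1])
  -- The three terms of the node function change by at most `2δ(2M + 2δ) + δ(2M + δ) + δ`, which for
  -- `δ ≤ 1` is at most `6δ(M + 1)`; the factor 20 leaves room.
  set δ : ℝ := min 1 (η / (20 * (M + 1))) with hδ
  have hδ0 : 0 < δ := lt_min one_pos (by positivity)
  have hδ1 : δ ≤ 1 := min_le_left _ _
  have hδη : δ * (20 * (M + 1)) ≤ η := by
    have := min_le_right (1 : ℝ) (η / (20 * (M + 1)))
    rw [← hδ, le_div_iff₀ (by positivity)] at this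
    exact this
  refine ⟨0, δ, hδ0, fun y hy hxy => ?_⟩
  have hy : Admissible C2 g y := hy
  -- at zeros of the new section, the two functions are close
  have hclose : ∀ k, dFun C2 g y.Ppar k = 0 →
      ‖dFun C2 g x.Ppar k‖ < η ∧ |nodeFun C2 g x k - nodeFun C2 g y k| < η := by
    intro k hk
    obtain ⟨b1, b2, b3⟩ := hxy.bounds (C2 := C2) (g := g) k
    have hμ := hxy.1
    rw [hk, sub_zero] at b3
    have m1 : |epsFun g x.Ph k - x.μ| ≤ M := by linarith [hM k, norm_nonneg (fFun g x.Ph k)]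
    have m2 : |‖fFun g x.Ph k‖| ≤ M := by
      rw [abs_norm]; linarith [hM k, abs_nonneg (epsFun g x.Ph k - x.μ)]
    have q1 := abs_sq_sub_sq_le (b := epsFun g y.Ph k - y.μ) (δ := 2 * δ) m1 (by
      have : epsFun g x.Ph k - x.μ - (epsFun g y.Ph k - y.μ) =
        (epsFun g x.Ph k - epsFun g y.Ph k) - (x.μ - y.μ) := by ring
      rw [this]
      refine (abs_sub _ _).trans ?_
      linarith)
    have q2 := abs_sq_sub_sq_le (b := ‖fFun g y.Ph k‖) (δ := δ) m2
      ((abs_norm_sub_norm_le _ _).trans b1.le)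
    have hη1 : δ * 20 ≤ η := by nlinarith
    refine ⟨by linarith, ?_⟩
    have q3 : ‖dFun C2 g x.Ppar k‖ ^ 2 ≤ δ := by
      nlinarith [norm_nonneg (dFun C2 g x.Ppar k)]
    simp only [nodeFun, hk, norm_zero]
    have hexp : (epsFun g x.Ph k - x.μ) ^ 2 - ‖fFun g x.Ph k‖ ^ 2 + ‖dFun C2 g x.Ppar k‖ ^ 2 -
        ((epsFun g y.Ph k - y.μ) ^ 2 - ‖fFun g y.Ph k‖ ^ 2 + 0 ^ 2) =
        ((epsFun g x.Ph k - x.μ) ^ 2 - (epsFun g y.Ph k - y.μ) ^ 2) -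
        (‖fFun g x.Ph k‖ ^ 2 - ‖fFun g y.Ph k‖ ^ 2) + ‖dFun C2 g x.Ppar k‖ ^ 2 := by ring
    rw [hexp]
    have q4 : |‖dFun C2 g x.Ppar k‖ ^ 2| ≤ δ := by rwa [abs_of_nonneg (sq_nonneg _)]
    refine (abs_add_le _ _).trans_lt ?_
    have := abs_sub ((epsFun g x.Ph k - x.μ) ^ 2 - (epsFun g y.Ph k - y.μ) ^ 2)
      (‖fFun g x.Ph k‖ ^ 2 - ‖fFun g y.Ph k‖ ^ 2)
    nlinarith
  refine ⟨?_, fun k hk h0 => ?_⟩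
  · have := (abs_lt.1 (hclose 0 hy.nematic.dFun_zero).2).1
    have h2 : η ≤ -nodeFun C2 g x 0 := min_le_right _ _
    linarith
  · obtain ⟨h1, h2⟩ := hclose k hk
    rw [h0, sub_zero] at h2
    have := hcmin k
    have h3 : η ≤ c := min_le_left _ _
    rcases le_max_iff.1 this with h | h <;> linarith

end

end

noncomputable section

set_option linter.unusedSectionVars false

section

variable {Hp Hm : Type*} [NormedAddCommGroup Hp] [InnerProductSpace ℂ Hp] [CompleteSpace Hp]
  [NormedAddCommGroup Hm] [InnerProductSpace ℂ Hm] [CompleteSpace Hm] {B : MoireBands Hp}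
  {C2 : Hp ≃ₗᵢ[ℂ] Hm} {g : ChernGauge B}

/-! ### Families of symmetric band operators -/

/-- Conjugation of operators by a unitary. -/
def conjIso (U : Hp ≃ₗᵢ[ℂ] Hp) : (Hp →L[ℂ] Hp) →ₗᵢ[ℝ] (Hp →L[ℂ] Hp) where
  toFun A := (U.toLinearIsometry.toContinuousLinearMap).comp
    (A.comp (U.symm : Hp →L[ℂ] Hp))
  map_add' A A' := by ext x; simp
  map_smul' t A := by
    ext x
    simp only [ContinuousLinearMap.comp_apply, smul_apply, RingHom.id_apply]
    change U ((t : ℂ) • A (U.symm x)) = (t : ℂ) • U (A (U.symm x))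
    rw [map_smul]
  norm_map' A := by
    change ‖(U.toLinearIsometry.toContinuousLinearMap).comp
      (A.comp (U.symm : Hp →L[ℂ] Hp))‖ = ‖A‖
    rw [LinearIsometry.norm_toContinuousLinearMap_comp]
    exact ContinuousLinearMap.opNorm_comp_linearIsometryEquiv A U.symm

@[simp] theorem conjIso_apply (U : Hp ≃ₗᵢ[ℂ] Hp) (A : Hp →L[ℂ] Hp) (x : Hp) :
    conjIso U A x = U (A (U.symm x)) := rfl

theorem real_smul_apply (t : ℝ) (A : Hp →L[ℂ] Hp) (x : Hp) : (t • A) x = (t : ℂ) • A x := rfl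

/-- All derivatives of a translation-invariant family are bounded. -/
theorem TranslationInvariant.exists_bound {A : ℂ → (Hp →L[ℂ] Hp)}
    (hA : TranslationInvariant B A) (hs : ContDiff ℝ ∞ A) (r : ℕ) :
    ∃ C : ℝ, 0 ≤ C ∧ ∀ j ≤ r, ∀ k, ‖iteratedFDeriv ℝ j A k‖ ≤ C := by
  have hper : ∀ j : ℕ, ∀ G ∈ recipLattice B.b, ∀ k,
      ‖iteratedFDeriv ℝ j A (k + G)‖ = ‖iteratedFDeriv ℝ j A k‖ := by
    intro j G hG k
    have h1 : (fun q => A (q + G)) = conjIso (B.S G) ∘ A := by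
      funext q
      ext x
      have := hA G hG q ((B.S G).symm x)
      rw [LinearIsometryEquiv.apply_symm_apply] at this
      rw [this]; rfl
    rw [← iteratedFDeriv_comp_add_right, h1]
    exact (conjIso (B.S G)).norm_iteratedFDeriv_comp_left hs.contDiffAt
      (by exact_mod_cast (le_top : (j : ℕ∞) ≤ ⊤))
  have hb : ∀ j : ℕ, ∃ C : ℝ, ∀ k, ‖iteratedFDeriv ℝ j A k‖ ≤ C := fun j =>
    exists_forall_le_of_periodic B.b_ne
      (hs.continuous_iteratedFDeriv (by exact_mod_cast (le_top : (j : ℕ∞) ≤ ⊤))).norm (hper j)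
  choose C hC using hb
  refine ⟨∑ j ∈ Finset.range (r + 1), |C j|, Finset.sum_nonneg fun j _ => abs_nonneg _,
    fun j hj k => (hC j k).trans ((le_abs_self _).trans ?_)⟩
  exact Finset.single_le_sum (f := fun j => |C j|) (fun i _ => abs_nonneg _)
    (Finset.mem_range.2 (by omega))

/-- The conditions at a single momentum on a Hamiltonian of the two bands. -/
structure IsLocalSymm (B : MoireBands Hp) (k : ℂ) (A : Hp →L[ℂ] Hp) : Prop where
  symm : ∀ x y, inner ℂ (A x) y = inner ℂ x (A y)
  supp : ∀ x, B.P k (A (B.P k x)) = A x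
  c2t : ∀ x, A (B.T x) = B.T (A x)

theorem IsBandHamiltonian.isLocalSymm {Ph : ℂ → (Hp →L[ℂ] Hp)} (h : IsBandHamiltonian B Ph)
    (k : ℂ) : IsLocalSymm B k (Ph k) :=
  ⟨fun x y => (h.selfAdjoint k).isSymmetric x y, h.supp k, h.c2t k⟩

theorem isBandHamiltonian_of_isLocalSymm {A : ℂ → (Hp →L[ℂ] Hp)} (hs : ContDiff ℝ ∞ A)
    (hl : ∀ k, IsLocalSymm B k (A k)) (ht : TranslationInvariant B A)
    (hc : ∀ k x, A (omega3 * k) (B.C3 x) = B.C3 (A k x)) : IsBandHamiltonian B A where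
  smooth := hs
  selfAdjoint k := ContinuousLinearMap.isSelfAdjoint_iff_isSymmetric.2 (hl k).symm
  supp k := (hl k).supp
  periodic := ht
  c2t k := (hl k).c2t
  c3 := hc

theorem IsLocalSymm.zero (k : ℂ) : IsLocalSymm B k 0 := ⟨by simp, by simp, by simp⟩

theorem IsLocalSymm.add {k : ℂ} {A A' : Hp →L[ℂ] Hp} (h : IsLocalSymm B k A)
    (h' : IsLocalSymm B k A') : IsLocalSymm B k (A + A') where
  symm x y := by simp only [add_apply, inner_add_left, inner_add_right, h.symm, h'.symm]
  supp x := by simp only [add_apply, map_add, h.supp, h'.supp]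
  c2t x := by simp only [add_apply, map_add, h.c2t, h'.c2t]

theorem IsLocalSymm.smul {k : ℂ} {A : Hp →L[ℂ] Hp} (h : IsLocalSymm B k A) (t : ℝ) :
    IsLocalSymm B k (t • A) where
  symm x y := by
    simp only [real_smul_apply, inner_smul_left, inner_smul_right, h.symm, Complex.conj_ofReal]
  supp x := by simp only [real_smul_apply, map_smul, h.supp]
  c2t x := by
    simp only [real_smul_apply, h.c2t, LinearIsometryEquiv.map_smulₛₗ, Complex.conj_ofReal]

theorem IsBandHamiltonian.add {A A' : ℂ → (Hp →L[ℂ] Hp)} (h : IsBandHamiltonian B A)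
    (h' : IsBandHamiltonian B A') : IsBandHamiltonian B (fun k => A k + A' k) :=
  isBandHamiltonian_of_isLocalSymm (h.smooth.add h'.smooth)
    (fun k => (h.isLocalSymm k).add (h'.isLocalSymm k))
    (fun G hG k x => by simp only [add_apply, map_add, h.periodic G hG, h'.periodic G hG])
    (fun k x => by simp only [add_apply, map_add, h.c3, h'.c3])

theorem IsBandHamiltonian.smul_fun {A : ℂ → (Hp →L[ℂ] Hp)} (h : IsBandHamiltonian B A) {τ : ℂ → ℝ}
    (hτ : ContDiff ℝ ∞ τ) (hper : ∀ G ∈ recipLattice B.b, ∀ k, τ (k + G) = τ k)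
    (hrot : ∀ k, τ (omega3 * k) = τ k) : IsBandHamiltonian B (fun k => τ k • A k) :=
  isBandHamiltonian_of_isLocalSymm (hτ.smul h.smooth) (fun k => (h.isLocalSymm k).smul _)
    (fun G hG k x => by simp only [real_smul_apply, map_smul, h.periodic G hG, hper G hG])
    (fun k x => by simp only [real_smul_apply, map_smul, h.c3, hrot])

theorem IsBandHamiltonian.smul {A : ℂ → (Hp →L[ℂ] Hp)} (h : IsBandHamiltonian B A) (t : ℝ) :
    IsBandHamiltonian B (fun k => t • A k) :=
  h.smul_fun (τ := fun _ => t) contDiff_const (fun _ _ _ => rfl) (fun _ => rfl)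

/-! ### Averages over rotations and over the lattice -/

theorem B_C3_symm_apply (B : MoireBands Hp) (x : Hp) : B.C3.symm x = B.C3 (B.C3 x) := by
  rw [LinearIsometryEquiv.symm_apply_eq, B.C3_cubed]

theorem B_S_swap (B : MoireBands Hp) {G G' : ℂ} (hG : G ∈ recipLattice B.b)
    (hG' : G' ∈ recipLattice B.b) (x : Hp) : B.S (G + G') x = B.S G' (B.S G x) := by
  rw [add_comm, B.S_add G' hG' G hG]

/-- The rotated family `k ↦ C_{3z} A(ω⁻¹ k) C_{3z}⁻¹`. -/
def rotFamily (B : MoireBands Hp) (A : ℂ → (Hp →L[ℂ] Hp)) (k : ℂ) : Hp →L[ℂ] Hp :=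
  conjIso B.C3 (A (omega3 * omega3 * k))

theorem rotFamily_apply (A : ℂ → (Hp →L[ℂ] Hp)) (k : ℂ) (x : Hp) :
    rotFamily B A (omega3 * k) (B.C3 x) = B.C3 (A k x) := by
  have : omega3 * omega3 * (omega3 * k) = k := by
    rw [← mul_assoc, omega3_cubed, one_mul]
  simp only [rotFamily, conjIso_apply, LinearIsometryEquiv.symm_apply_apply, this]

theorem rotFamily_iterate (A : ℂ → (Hp →L[ℂ] Hp)) :
    rotFamily B (rotFamily B (rotFamily B A)) = A := by
  funext k
  ext x
  have h : omega3 * omega3 * (omega3 * omega3 * (omega3 * omega3 * k)) = k := by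
    have := omega3_cubed
    linear_combination (omega3 * omega3 * omega3 + 1) * k * this
  simp only [rotFamily, conjIso_apply, h, B_C3_symm_apply, B.C3_cubed]

theorem contDiff_rotFamily {A : ℂ → (Hp →L[ℂ] Hp)} (hA : ContDiff ℝ ∞ A) :
    ContDiff ℝ ∞ (rotFamily B A) :=
  (conjIso B.C3).contDiff.comp (hA.comp (contDiff_const.mul contDiff_id))

theorem isLocalSymm_rotFamily {A : ℂ → (Hp →L[ℂ] Hp)} (hA : ∀ k, IsLocalSymm B k (A k)) (k : ℂ) :
    IsLocalSymm B k (rotFamily B A k) := by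
  set q := omega3 * omega3 * k with hq
  have hk : omega3 * q = k := by
    rw [hq, ← mul_assoc, ← mul_assoc, omega3_cubed, one_mul]
  have hP : ∀ y, B.C3.symm (B.P k y) = B.P q (B.C3.symm y) := by
    intro y
    rw [LinearIsometryEquiv.symm_apply_eq, ← B.P_C3, hk, LinearIsometryEquiv.apply_symm_apply]
  have hT : ∀ y, B.C3.symm (B.T y) = B.T (B.C3.symm y) := by
    intro y
    rw [LinearIsometryEquiv.symm_apply_eq, ← B.T_C3, LinearIsometryEquiv.apply_symm_apply]
  refine ⟨fun x y => ?_, fun x => ?_, fun x => ?_⟩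
  · simp only [rotFamily, conjIso_apply, ← hq]
    rw [← LinearIsometryEquiv.inner_map_map B.C3.symm, LinearIsometryEquiv.symm_apply_apply,
      (hA q).symm, ← LinearIsometryEquiv.inner_map_map B.C3,
      LinearIsometryEquiv.apply_symm_apply]
  · simp only [rotFamily, conjIso_apply, ← hq, hP]
    rw [← hk, B.P_C3, (hA q).supp]
  · simp only [rotFamily, conjIso_apply, ← hq, hT, (hA q).c2t, B.T_C3]

theorem translationInvariant_rotFamily {A : ℂ → (Hp →L[ℂ] Hp)} (hA : TranslationInvariant B A) :
    TranslationInvariant B (rotFamily B A) := by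
  intro G hG k x
  have h1 := omega3_mul_mem_recipLattice hG
  have h2 := omega3_mul_mem_recipLattice h1
  have h3 : omega3 * (omega3 * (omega3 * G)) = G := by
    rw [← mul_assoc, ← mul_assoc, omega3_cubed, one_mul]
  simp only [rotFamily, conjIso_apply, B_C3_symm_apply]
  rw [B.C3_S G hG, B.C3_S _ h1, mul_add, show omega3 * omega3 * G = omega3 * (omega3 * G) by ring,
    hA _ h2, B.C3_S _ h2, h3]

/-- The average of a family over the rotations is a band Hamiltonian. -/
theorem isBandHamiltonian_average {A : ℂ → (Hp →L[ℂ] Hp)} (hs : ContDiff ℝ ∞ A)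
    (hl : ∀ k, IsLocalSymm B k (A k)) (ht : TranslationInvariant B A) :
    IsBandHamiltonian B
      (fun k => (1 / 3 : ℝ) • (A k + rotFamily B A k + rotFamily B (rotFamily B A) k)) := by
  have ht1 := translationInvariant_rotFamily ht
  have ht2 := translationInvariant_rotFamily ht1
  refine isBandHamiltonian_of_isLocalSymm
    (((hs.add (contDiff_rotFamily hs)).add (contDiff_rotFamily (contDiff_rotFamily hs))).const_smul
      (1 / 3 : ℝ))
    (fun k => (((hl k).add (isLocalSymm_rotFamily hl k)).add
      (isLocalSymm_rotFamily (isLocalSymm_rotFamily hl) k)).smul _)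
    (fun G hG k x => ?_) (fun k x => ?_)
  · simp only [real_smul_apply, add_apply, map_smul, map_add, ht G hG, ht1 G hG, ht2 G hG]
  · simp only [real_smul_apply, add_apply, map_smul, map_add]
    rw [rotFamily_apply, rotFamily_apply, ← rotFamily_apply (rotFamily B (rotFamily B A)) k x,
      rotFamily_iterate]
    congr 1
    abel

theorem norm_cross_le (a k : ℂ) : |cross a k| ≤ ‖a‖ * ‖k‖ := by
  have : cross a k = (conj a * k).im := by
    simp [cross]; ring
  rw [this]
  refine (Complex.abs_im_le_norm _).trans ?_
  rw [norm_mul, Complex.norm_conj]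

/-- The reciprocal lattice is discrete. -/
theorem exists_pos_forall_norm_lt_eq_zero {b : ℂ} (hb : b ≠ 0) :
    ∃ r : ℝ, 0 < r ∧ ∀ G ∈ recipLattice b, ‖G‖ < r → G = 0 := by
  have hD := cross_lattice_pos hb
  have hb' := norm_pos_iff.2 hb
  refine ⟨cross b (omega3 * b) / ‖b‖, by positivity, fun G hG hGr => ?_⟩
  rw [lt_div_iff₀ hb'] at hGr
  obtain ⟨i, j, rfl⟩ := mem_recipLattice.1 hG
  set D := cross b (omega3 * b) with hDdef
  set G := (i : ℂ) * b + j * (omega3 * b) with hGdef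
  have hG' : G = ((i : ℝ) : ℂ) * b + ((j : ℝ) : ℂ) * (omega3 * b) := by rw [hGdef]; push_cast; ring
  have h1 : cross b G = j * D := by
    rw [hG', cross_add_right, cross_smul_right, cross_smul_right, cross_same]; ring
  have h2 : cross G (omega3 * b) = i * D := by
    rw [hG', cross_add_left, cross_smul_left, cross_smul_left, cross_same]; ring
  have e1 := norm_cross_le b G
  have e2 := norm_cross_le G (omega3 * b)
  rw [norm_mul, norm_omega3, one_mul] at e2
  rw [h1, abs_mul, abs_of_pos hD] at e1
  rw [h2, abs_mul, abs_of_pos hD] at e2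
  have hint : ∀ n : ℤ, |(n : ℝ)| * D < D → n = 0 := by
    intro n hn
    have h3 : |(n : ℝ)| < 1 := by
      by_contra h
      nlinarith [mul_le_mul_of_nonneg_right (not_lt.1 h) hD.le]
    have h4 : |n| < 1 := by exact_mod_cast h3
    exact Int.abs_lt_one_iff.1 h4
  have hi := hint i (by linarith)
  have hj := hint j (by linarith)
  simp [hGdef, hi, hj]

open Classical in
/-- The sum of the lattice translates of a family supported in a small disc. -/
def latticeSum (B : MoireBands Hp) (ρ : ℝ) (N : ℂ → (Hp →L[ℂ] Hp)) (k : ℂ) : Hp →L[ℂ] Hp :=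
  if h : ∃ G ∈ recipLattice B.b, ‖k - G‖ < ρ then
    conjIso (B.S h.choose) (N (k - h.choose)) else 0

section latticeSum

variable {ρ : ℝ} (hρ : ∀ G ∈ recipLattice B.b, ‖G‖ < 2 * ρ → G = 0) {N : ℂ → (Hp →L[ℂ] Hp)}

include hρ

/-- Distinct lattice points are at least `2ρ` apart, so at most one lies within `ρ` of `k` and the
choice in the definition is forced. -/
theorem latticeSum_eq {k G : ℂ} (hG : G ∈ recipLattice B.b) (hk : ‖k - G‖ < ρ) :
    latticeSum B ρ N k = conjIso (B.S G) (N (k - G)) := by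
  have h : ∃ G ∈ recipLattice B.b, ‖k - G‖ < ρ := ⟨G, hG, hk⟩
  have hGG : h.choose = G := by
    refine sub_eq_zero.1 (hρ _ (sub_mem h.choose_spec.1 hG) ?_)
    have : h.choose - G = (k - G) - (k - h.choose) := by ring
    rw [this]
    refine (norm_sub_le _ _).trans_lt ?_
    linarith [h.choose_spec.2]
  rw [latticeSum, dif_pos h, hGG]

/-- The support has half the radius of the discs in the definition: a point lies either in an open
disc where one smooth formula holds, or at distance `ρ/2` from everything that is nonzero. -/
theorem contDiff_latticeSum (hρ0 : 0 < ρ) (hN : ContDiff ℝ ∞ N)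
    (hsupp : ∀ k, ρ / 2 ≤ ‖k‖ → N k = 0) : ContDiff ℝ ∞ (latticeSum B ρ N) := by
  rw [contDiff_iff_contDiffAt]
  intro k₀
  by_cases h : ∃ G ∈ recipLattice B.b, ‖k₀ - G‖ < ρ
  · obtain ⟨G, hG, hk⟩ := h
    have hs : ContDiff ℝ ∞ (fun k => conjIso (B.S G) (N (k - G))) :=
      (conjIso (B.S G)).contDiff.comp (hN.comp (contDiff_id.sub contDiff_const))
    refine hs.contDiffAt.congr_of_eventuallyEq ?_
    have hc : ContinuousAt (fun k : ℂ => ‖k - G‖) k₀ := by fun_prop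
    filter_upwards [hc.eventually_lt_const hk] with k hk'
    exact latticeSum_eq hρ hG hk'
  · push Not at h
    refine (contDiffAt_const (c := (0 : Hp →L[ℂ] Hp))).congr_of_eventuallyEq ?_
    filter_upwards [Metric.ball_mem_nhds k₀ (half_pos hρ0)] with k hk
    by_cases h' : ∃ G ∈ recipLattice B.b, ‖k - G‖ < ρ
    · obtain ⟨G, hG, hkG⟩ := h'
      rw [latticeSum_eq hρ hG hkG, hsupp, map_zero]
      have h1 := h G hG
      have h2 : k₀ - G = (k - G) - (k - k₀) := by ring
      rw [h2] at h1
      have h3 := h1.trans (norm_sub_le _ _)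
      rw [mem_ball_iff_norm] at hk
      linarith
    · rw [latticeSum, dif_neg h']

theorem isLocalSymm_latticeSum (hN : ∀ k, IsLocalSymm B k (N k)) (k : ℂ) :
    IsLocalSymm B k (latticeSum B ρ N k) := by
  by_cases h : ∃ G ∈ recipLattice B.b, ‖k - G‖ < ρ
  · obtain ⟨G, hG, hk⟩ := h
    rw [latticeSum_eq hρ hG hk]
    set q := k - G with hq
    have hkq : q + G = k := by rw [hq, sub_add_cancel]
    have hP : ∀ y, (B.S G).symm (B.P k y) = B.P q ((B.S G).symm y) := by
      intro y
      rw [LinearIsometryEquiv.symm_apply_eq, ← B.P_S G hG, hkq,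
        LinearIsometryEquiv.apply_symm_apply]
    have hT : ∀ y, (B.S G).symm (B.T y) = B.T ((B.S G).symm y) := by
      intro y
      rw [LinearIsometryEquiv.symm_apply_eq, ← B.T_S G hG, LinearIsometryEquiv.apply_symm_apply]
    refine ⟨fun x y => ?_, fun x => ?_, fun x => ?_⟩
    · simp only [conjIso_apply]
      rw [← LinearIsometryEquiv.inner_map_map (B.S G).symm, LinearIsometryEquiv.symm_apply_apply,
        (hN q).symm, ← LinearIsometryEquiv.inner_map_map (B.S G),
        LinearIsometryEquiv.apply_symm_apply]
    · simp only [conjIso_apply, hP]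
      rw [← hkq, B.P_S G hG, (hN q).supp]
    · simp only [conjIso_apply, hT, (hN q).c2t, B.T_S G hG]
  · rw [latticeSum, dif_neg h]
    exact IsLocalSymm.zero k

theorem translationInvariant_latticeSum : TranslationInvariant B (latticeSum B ρ N) := by
  intro G hG k x
  by_cases h : ∃ G' ∈ recipLattice B.b, ‖k - G'‖ < ρ
  · obtain ⟨G', hG', hk⟩ := h
    have hk' : ‖k + G - (G' + G)‖ < ρ := by rwa [add_sub_add_right_eq_sub]
    rw [latticeSum_eq hρ hG' hk, latticeSum_eq hρ (add_mem hG' hG) hk',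
      add_sub_add_right_eq_sub]
    have hs : (B.S (G' + G)).symm (B.S G x) = (B.S G').symm x := by
      rw [LinearIsometryEquiv.symm_apply_eq, B_S_swap B hG' hG,
        LinearIsometryEquiv.apply_symm_apply]
    simp only [conjIso_apply, hs, B_S_swap B hG' hG]
  · have h' : ¬∃ G' ∈ recipLattice B.b, ‖k + G - G'‖ < ρ := by
      rintro ⟨G', hG', hk⟩
      refine h ⟨G' - G, sub_mem hG' hG, ?_⟩
      rwa [show k - (G' - G) = k + G - G' by ring]
    rw [latticeSum, dif_neg h', latticeSum, dif_neg h]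
    simp

end latticeSum

end

end

noncomputable section

set_option linter.unusedSectionVars false

section

variable {Hp Hm : Type*} [NormedAddCommGroup Hp] [InnerProductSpace ℂ Hp] [CompleteSpace Hp]
  [NormedAddCommGroup Hm] [InnerProductSpace ℂ Hm] [CompleteSpace Hm] {B : MoireBands Hp}
  {C2 : Hp ≃ₗᵢ[ℂ] Hm} {g : ChernGauge B}

/-! ### Band operators with given off-diagonal matrix elements -/

/-- The operator `|v⟩⟨w|`. -/
def ketBra (v w : Hp) : Hp →L[ℂ] Hp := InnerProductSpace.rankOne ℂ v w

@[simp] theorem ketBra_apply (v w x : Hp) : ketBra v w x = inner ℂ w x • v := by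
  simp [ketBra]

theorem contDiff_ketBra : ContDiff ℝ ∞ (fun p : Hp × Hp => ketBra p.1 p.2) := by
  have h : IsBoundedBilinearMap ℝ (fun p : Hp × Hp => ketBra p.1 p.2) := by
    refine ⟨?_, ?_, ?_, ?_, 1, one_pos, ?_⟩
    · intro x y z; ext q; simp [smul_add]
    · intro c x y
      ext q
      rw [real_smul_apply]
      simp only [ketBra_apply]
      rw [show c • x = (c : ℂ) • x from rfl, smul_comm]
    · intro x y z; ext q; simp [add_smul]
    · intro c x y
      ext q
      rw [real_smul_apply]
      simp only [ketBra_apply]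
      rw [show c • y = (c : ℂ) • y from rfl, inner_smul_left, smul_smul, Complex.conj_ofReal]
    · intro x y
      refine ContinuousLinearMap.opNorm_le_bound _ (by positivity) fun q => ?_
      rw [ketBra_apply, norm_smul, one_mul]
      have := norm_inner_le_norm (𝕜 := ℂ) y q
      nlinarith [norm_nonneg x]
  exact h.contDiff

/-- The symmetric family with off-diagonal matrix elements `q`, `conj q` in the Chern gauge. -/
def offDiag (g : ChernGauge B) (q : ℂ → ℂ) (k : ℂ) : Hp →L[ℂ] Hp :=
  ketBra (q k • g.u k 1) (g.u k 0) + ketBra (conj (q k) • g.u k 0) (g.u k 1)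

theorem offDiag_apply (q : ℂ → ℂ) (k : ℂ) (x : Hp) :
    offDiag g q k x = (inner ℂ (g.u k 0) x * q k) • g.u k 1 +
      (inner ℂ (g.u k 1) x * conj (q k)) • g.u k 0 := by
  simp [offDiag, smul_smul]

theorem contDiff_offDiag {q : ℂ → ℂ} (hq : ContDiff ℝ ∞ q) : ContDiff ℝ ∞ (offDiag g q) := by
  have hc : ContDiff ℝ ∞ (fun k => conj (q k)) := Complex.conjCLE.contDiff.comp hq
  exact (contDiff_ketBra.comp ((hq.smul (g.smooth 1)).prodMk (g.smooth 0))).add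
    (contDiff_ketBra.comp ((hc.smul (g.smooth 0)).prodMk (g.smooth 1)))

theorem ChernGauge.inner_P (g : ChernGauge B) (k : ℂ) (a : Fin 2) (x : Hp) :
    inner ℂ (g.u k a) (B.P k x) = inner ℂ (g.u k a) x := by
  have h := (B.P_proj k).isSelfAdjoint.isSymmetric (g.u k a) x
  have h' : inner ℂ (B.P k (g.u k a)) x = inner ℂ (g.u k a) (B.P k x) := h
  rw [← h', g.P_u]

theorem isLocalSymm_offDiag (q : ℂ → ℂ) (k : ℂ) : IsLocalSymm B k (offDiag g q k) where
  symm x y := by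
    simp only [offDiag_apply, inner_add_left, inner_add_right, inner_smul_left, inner_smul_right,
      map_mul, Complex.conj_conj, inner_conj_symm]
    ring
  supp x := by simp only [offDiag_apply, map_add, map_smul, g.P_u, g.inner_P]
  c2t x := by
    have h0 : inner ℂ (g.u k 0) (B.T x) = conj (inner ℂ (g.u k 1) x) := by
      rw [← g.T_u_one, antiunitary_inner_map_map, inner_conj_symm]
    have h1 : inner ℂ (g.u k 1) (B.T x) = conj (inner ℂ (g.u k 0) x) := by
      rw [← g.T_u, antiunitary_inner_map_map, inner_conj_symm]
    simp only [offDiag_apply, h0, h1, map_add, LinearIsometryEquiv.map_smulₛₗ, g.T_u, g.T_u_one,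
      map_mul, Complex.conj_conj]
    rw [add_comm]

theorem fFun_offDiag (q : ℂ → ℂ) (k : ℂ) : fFun g (offDiag g q) k = q k := by
  simp only [fFun_eq, gaugeElt, offDiag_apply, inner_add_right, inner_smul_right, g.inner_self,
    g.inner_one_zero]
  simp

theorem epsFun_offDiag (q : ℂ → ℂ) (k : ℂ) : epsFun g (offDiag g q) k = 0 := by
  simp only [epsFun_eq, gaugeElt, offDiag_apply, inner_add_right, inner_smul_right, g.inner_self,
    g.inner_zero_one, g.inner_one_zero]
  simp

/-- Multiplication of the off-diagonal matrix elements of a band Hamiltonian by a constant. -/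
theorem isBandHamiltonian_offDiag {Ph : ℂ → (Hp →L[ℂ] Hp)} (h : IsBandHamiltonian B Ph) (z : ℂ) :
    IsBandHamiltonian B (offDiag g fun k => z * fFun g Ph k) := by
  refine isBandHamiltonian_of_isLocalSymm
    (contDiff_offDiag (contDiff_const.mul (contDiff_fFun h.smooth)))
    (isLocalSymm_offDiag _) (fun G hG k x => ?_) (fun k x => ?_)
  · obtain ⟨c, hc, h0, h1⟩ := g.exists_phase G hG k
    have hcc : c * conj c = 1 := by
      rw [Complex.mul_conj, Complex.normSq_eq_norm_sq, hc]; simp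
    have hf : fFun g Ph (k + G) = c * c * fFun g Ph k := by
      simp only [fFun_eq, gaugeElt, h0, h1, map_smul, h.periodic G hG, inner_smul_left,
        inner_smul_right, LinearIsometryEquiv.inner_map_map, Complex.conj_conj]
      ring
    simp only [offDiag_apply, h0, h1, hf, map_add, map_smul, inner_smul_left,
      LinearIsometryEquiv.inner_map_map, smul_smul, map_mul, Complex.conj_conj]
    congr 2
    · linear_combination (inner ℂ (g.u k 0) x * z * fFun g Ph k) * (c * conj c + 1) * hcc
    · linear_combination (inner ℂ (g.u k 1) x * conj z * conj (fFun g Ph k)) *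
        (c * conj c + 1) * hcc
  · obtain ⟨c, hc, h0, h1⟩ := g.exists_C3_phase k
    have hcc : c * conj c = 1 := by
      rw [Complex.mul_conj, Complex.normSq_eq_norm_sq, hc]; simp
    have h0' : g.u (omega3 * k) 0 = conj c • B.C3 (g.u k 0) := by
      rw [h0, smul_smul, mul_comm (conj c), hcc, one_smul]
    have h1' : g.u (omega3 * k) 1 = c • B.C3 (g.u k 1) := by
      rw [h1, smul_smul, hcc, one_smul]
    have hf : fFun g Ph (omega3 * k) = conj c * conj c * fFun g Ph k := by
      simp only [fFun_eq, gaugeElt, h0', h1', map_smul, h.c3, inner_smul_left,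
        inner_smul_right, LinearIsometryEquiv.inner_map_map]
      ring
    simp only [offDiag_apply, h0', h1', hf, map_add, map_smul, inner_smul_left,
      LinearIsometryEquiv.inner_map_map, smul_smul, map_mul, Complex.conj_conj]
    congr 2
    · linear_combination (inner ℂ (g.u k 0) x * z * fFun g Ph k) * (c * conj c + 1) * hcc
    · linear_combination (inner ℂ (g.u k 1) x * conj z * conj (fFun g Ph k)) *
        (c * conj c + 1) * hcc

theorem fFun_add_smul (A A' : ℂ → (Hp →L[ℂ] Hp)) (τ : ℂ → ℝ) (k : ℂ) :
    fFun g (fun q => A q + τ q • A' q) k = fFun g A k + τ k * fFun g A' k := by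
  simp only [fFun_eq, gaugeElt, add_apply, real_smul_apply, inner_add_right, inner_smul_right]

theorem epsFun_add_smul (A A' : ℂ → (Hp →L[ℂ] Hp)) (τ : ℂ → ℝ) (k : ℂ) :
    epsFun g (fun q => A q + τ q • A' q) k = epsFun g A k + τ k * epsFun g A' k := by
  simp only [epsFun_eq, gaugeElt, add_apply, real_smul_apply, inner_add_right, inner_smul_right,
    Complex.add_re, Complex.re_ofReal_mul]

/-- There is a band Hamiltonian whose off-diagonal matrix element does not vanish at `Γ_M`. -/
theorem exists_isBandHamiltonian_fFun_zero (g : ChernGauge B) :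
    ∃ A : ℂ → (Hp →L[ℂ] Hp), IsBandHamiltonian B A ∧ fFun g A 0 = 1 ∧ epsFun g A 0 = 0 := by
  obtain ⟨r, hr, hdisc⟩ := exists_pos_forall_norm_lt_eq_zero B.b_ne
  set ρ := r / 2 with hρdef
  have hρ0 : 0 < ρ := half_pos hr
  have hρ : ∀ G ∈ recipLattice B.b, ‖G‖ < 2 * ρ → G = 0 := fun G hG h =>
    hdisc G hG (by rw [hρdef] at h; linarith)
  let χ : ContDiffBump (0 : ℂ) := ⟨ρ / 4, ρ / 2, by positivity, by linarith⟩
  set N : ℂ → (Hp →L[ℂ] Hp) := offDiag g fun k => (χ k : ℂ) with hN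
  have hNs : ContDiff ℝ ∞ N := contDiff_offDiag (Complex.ofRealCLM.contDiff.comp χ.contDiff)
  have hsupp : ∀ k, ρ / 2 ≤ ‖k‖ → N k = 0 := by
    intro k hk
    have h0 : χ k = 0 := χ.zero_of_le_dist (by rwa [dist_zero_right])
    ext x
    simp [hN, offDiag_apply, h0]
  have hL0 : latticeSum B ρ N 0 = N 0 := by
    rw [latticeSum_eq hρ (zero_mem _) (by simpa using hρ0)]
    have hS0 : ∀ x, B.S 0 x = x := by
      intro x
      have := B.S_add 0 (zero_mem _) 0 (zero_mem _) ((B.S 0).symm x)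
      rw [LinearIsometryEquiv.apply_symm_apply, add_zero,
        LinearIsometryEquiv.apply_symm_apply] at this
      exact this.symm
    ext x
    rw [conjIso_apply, hS0, sub_zero, (LinearIsometryEquiv.symm_apply_eq _).2 (hS0 x).symm]
  set L := latticeSum B ρ N with hL
  have hχ0 : χ 0 = 1 := χ.one_of_mem_closedBall (by simp [χ.rIn_pos.le])
  -- The rotation fixes Γ_M and the gauge vectors there, so averaging over rotations leaves the
  -- matrix elements at Γ_M unchanged and the bump survives.
  have hf0 : ∀ A : ℂ → (Hp →L[ℂ] Hp), ∀ a c, gaugeElt g (rotFamily B A) a c 0 =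
      gaugeElt g A a c 0 := by
    intro A a c
    have := rotFamily_apply (B := B) A 0 (g.u 0 c)
    rw [mul_zero, g.C3_Gamma] at this
    simp only [gaugeElt, this]
    conv_lhs => rw [← g.C3_Gamma a]
    rw [LinearIsometryEquiv.inner_map_map]
  have havg : ∀ a c, gaugeElt g (fun k => (1 / 3 : ℝ) •
      (L k + rotFamily B L k + rotFamily B (rotFamily B L) k)) a c 0 = gaugeElt g N a c 0 := by
    intro a c
    have h1 := hf0 L a c
    have h2 := hf0 (rotFamily B L) a c
    rw [h1] at h2
    have h3 : gaugeElt g L a c 0 = gaugeElt g N a c 0 := by simp only [gaugeElt, hL0]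
    rw [h3] at h1 h2
    simp only [gaugeElt] at h1 h2 h3 ⊢
    simp only [real_smul_apply, add_apply, inner_smul_right, inner_add_right, h1, h2, h3]
    push_cast
    ring
  refine ⟨_, isBandHamiltonian_average (contDiff_latticeSum hρ hρ0 hNs hsupp)
    (isLocalSymm_latticeSum hρ (isLocalSymm_offDiag _)) (translationInvariant_latticeSum hρ), ?_, ?_⟩
  · rw [fFun_eq, havg, ← fFun_eq, hN, fFun_offDiag, hχ0]; simp
  · rw [epsFun_eq, havg, ← epsFun_eq, hN, epsFun_offDiag]

/-! ### Density of the regular mean fields -/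

theorem iteratedFDeriv_sub_self_zero (D : ℂ → (Hm →L[ℂ] Hp)) (j : ℕ) (k : ℂ) :
    iteratedFDeriv ℝ j (fun q => D q - D q) k = 0 := by
  simp only [sub_self]
  exact congrFun (iteratedFDeriv_fun_zero (n := j)) k

/-- The density arguments change only the Hamiltonian and `μ`, never the pairing. The zeros of `d`
are kept, and only the window condition at Γ_M has to be checked again. -/
theorem Admissible.of_band {x y : MeanField Hp Hm} (hx : Admissible C2 g x)
    (hpar : y.Ppar = x.Ppar) (hb : IsBandHamiltonian B y.Ph)
    (hμ : |y.μ - epsFun g y.Ph 0| ≤ ‖fFun g y.Ph 0‖) : Admissible C2 g y where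
  band := hb
  pairing := hpar ▸ hx.pairing
  parallel := hpar ▸ hx.parallel
  nematic := hpar ▸ hx.nematic
  mu_mem := by
    rw [lowerBand_eq hb, upperBand_eq hb, Set.mem_Icc]
    have := abs_le.1 hμ
    constructor <;> linarith
  zeros := hpar ▸ hx.zeros

theorem Admissible.abs_sub_le {x : MeanField Hp Hm} (hx : Admissible C2 g x) :
    |x.μ - epsFun g x.Ph 0| ≤ ‖fFun g x.Ph 0‖ := by
  have h := hx.mu_mem
  rw [lowerBand_eq hx.band, upperBand_eq hx.band, Set.mem_Icc] at h
  rw [abs_le]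
  constructor <;> linarith

theorem HasTwoZeros.exists_representatives {b : ℂ} {q : ℂ → ℂ} (h : HasTwoZeros b q) :
    ∃ p p' : ℂ, ∀ k, q k = 0 ↔ k - p ∈ recipLattice b ∨ k - p' ∈ recipLattice b := by
  obtain ⟨p, p', h, -⟩ := h
  exact ⟨p, p', h⟩

/-- A chemical potential inside the window at `Γ_M` can be moved off the energies of the zeros. -/
theorem exists_nodeRegular_mu {x : MeanField Hp Hm} (hx : Admissible C2 g x)
    (hf : fFun g x.Ph 0 ≠ 0) {δ : ℝ} (hδ : 0 < δ) :
    ∃ μ : ℝ, |x.μ - μ| < δ ∧ Admissible C2 g ⟨μ, x.Ph, x.Ppar⟩ ∧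
      NodeRegular C2 g ⟨μ, x.Ph, x.Ppar⟩ := by
  obtain ⟨p, p', hp⟩ := hx.zeros.exists_representatives
  set e := epsFun g x.Ph
  set F : ℝ := ‖fFun g x.Ph 0‖ with hF
  have hF0 : 0 < F := norm_pos_iff.2 hf
  set n : ℂ → ℝ := fun k => ‖fFun g x.Ph k‖
  -- Modulo the lattice `d` has at most two zeros with two band energies each, and the node function
  -- is periodic, so four values of `μ` are to be avoided.
  set bad : Finset ℝ := {e p - n p, e p + n p, e p' - n p', e p' + n p'}
  have hμ := abs_le.1 hx.abs_sub_le
  -- an interval inside the window and close to the given value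
  have hint : ∃ a c : ℝ, a < c ∧ ∀ t ∈ Set.Ioo a c, |x.μ - t| < δ ∧ |t - e 0| < F := by
    rcases le_total x.μ (e 0) with h | h
    · refine ⟨x.μ, min (x.μ + δ) (x.μ + F), by simp [hδ, hF0], fun t ht => ?_⟩
      have h1 := lt_min_iff.1 ht.2
      rw [abs_lt, abs_lt]
      have := ht.1
      refine ⟨⟨by linarith, by linarith⟩, by linarith, by linarith⟩
    · refine ⟨max (x.μ - δ) (x.μ - F), x.μ, by simp [hδ, hF0], fun t ht => ?_⟩
      have h1 := max_lt_iff.1 ht.1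
      rw [abs_lt, abs_lt]
      have := ht.2
      refine ⟨⟨by linarith, by linarith⟩, by linarith, by linarith⟩
  obtain ⟨a, c, hac, hI⟩ := hint
  obtain ⟨μ, hμI, hμb⟩ := ((Set.Ioo_infinite hac).exists_notMem_finset bad)
  obtain ⟨h1, h2⟩ := hI μ hμI
  have hy : Admissible C2 g ⟨μ, x.Ph, x.Ppar⟩ := hx.of_band rfl hx.band h2.le
  refine ⟨μ, h1, hy, ?_, fun k hk => ?_⟩
  · have hd := hx.nematic.dFun_zero
    simp only [nodeFun, hd, norm_zero]
    have := sq_lt_sq' (by linarith [(abs_lt.1 h2).2] : -F < e 0 - μ)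
      (by linarith [(abs_lt.1 h2).1] : e 0 - μ < F)
    simp only [e] at this
    linarith
  · have key : ∀ z, dFun C2 g x.Ppar z = 0 → e z - n z ≠ μ → e z + n z ≠ μ →
        nodeFun C2 g ⟨μ, x.Ph, x.Ppar⟩ z ≠ 0 := by
      intro z hz hz1 hz2 h0
      simp only [nodeFun, hz, norm_zero] at h0
      have : (e z - n z - μ) * (e z + n z - μ) = 0 := by linear_combination h0
      rcases mul_eq_zero.1 this with h | h
      · exact hz1 (by linarith)
      · exact hz2 (by linarith)
    simp only [bad, Finset.mem_insert, Finset.mem_singleton, not_or] at hμb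
    have hk' : dFun C2 g x.Ppar k = 0 := hk
    rcases (hp k).1 hk' with h | h
    · have := nodeFun_periodic hy _ h p
      rw [add_sub_cancel] at this
      rw [this]
      exact key p ((hp p).2 (Or.inl (by simp))) (Ne.symm hμb.1) (Ne.symm hμb.2.1)
    · have := nodeFun_periodic hy _ h p'
      rw [add_sub_cancel] at this
      rw [this]
      exact key p' ((hp p').2 (Or.inr (by simp))) (Ne.symm hμb.2.2.1) (Ne.symm hμb.2.2.2)

/-- A mean field is close to the one with a slightly changed band Hamiltonian. -/
theorem exists_closeTo_smul {A : ℂ → (Hp →L[ℂ] Hp)} (hA : IsBandHamiltonian B A) (r : ℕ) {δ : ℝ}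
    (hδ : 0 < δ) : ∃ η > 0, ∀ t : ℝ, |t| < η → ∀ (x : MeanField Hp Hm) (μ : ℝ), |x.μ - μ| < δ →
      CloseTo r δ x ⟨μ, fun k => x.Ph k + t • A k, x.Ppar⟩ := by
  obtain ⟨C, hC0, hC⟩ := TranslationInvariant.exists_bound hA.periodic hA.smooth r
  refine ⟨δ / (C + 1), by positivity, fun t ht x μ hμ => ⟨hμ, fun j hj k => ⟨?_, ?_⟩⟩⟩
  · have h1 : (fun q => x.Ph q - (x.Ph q + t • A q)) = (-t) • A := by
      funext q
      simp
    rw [h1, iteratedFDeriv_const_smul_apply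
      (hA.smooth.contDiffAt.of_le (by exact_mod_cast (le_top : (j : ℕ∞) ≤ ⊤))), norm_smul,
      norm_neg, Real.norm_eq_abs]
    have h2 := hC j hj k
    rw [lt_div_iff₀ (by positivity)] at ht
    nlinarith [abs_nonneg t]
  · rw [iteratedFDeriv_sub_self_zero, norm_zero]
    exact hδ

/-- If the window at Γ_M is a single point, it is opened by a small Hamiltonian with nonzero
off-diagonal element there; then `μ` can be moved inside the window off the finitely many bad
energies. -/
theorem relDense_nodeRegular :
    RelDense {x | Admissible C2 g x} {x | NodeRegular C2 g x} := by
  intro x hx r δ hδ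
  have hx : Admissible C2 g x := hx
  obtain ⟨A, hA, hA1, hA0⟩ := exists_isBandHamiltonian_fFun_zero g
  obtain ⟨η, hη, hclose⟩ := exists_closeTo_smul (Hm := Hm) hA r hδ
  have ht : ∃ t : ℝ, |t| < η ∧ fFun g x.Ph 0 + t ≠ 0 ∧
      ‖fFun g x.Ph 0‖ ≤ ‖fFun g x.Ph 0 + t‖ := by
    by_cases h : fFun g x.Ph 0 = 0
    · refine ⟨η / 2, by rw [abs_of_pos (half_pos hη)]; linarith, ?_, by
        rw [h, norm_zero]; exact norm_nonneg _⟩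
      rw [h, zero_add]
      exact_mod_cast (half_pos hη).ne'
    · exact ⟨0, by simpa using hη, by simpa using h, by simp⟩
  obtain ⟨t, htη, ht0, htn⟩ := ht
  set Ph' : ℂ → (Hp →L[ℂ] Hp) := fun k => x.Ph k + t • A k with hPh'
  have hb : IsBandHamiltonian B Ph' := hx.band.add (hA.smul t)
  have hf : fFun g Ph' 0 = fFun g x.Ph 0 + t := by
    rw [hPh', fFun_add_smul (τ := fun _ => t), hA1, mul_one]
  have he : epsFun g Ph' 0 = epsFun g x.Ph 0 := by
    rw [hPh', epsFun_add_smul (τ := fun _ => t), hA0, mul_zero, add_zero]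
  have hy : Admissible C2 g ⟨x.μ, Ph', x.Ppar⟩ := by
    refine hx.of_band rfl hb ?_
    simp only [hf, he]
    exact hx.abs_sub_le.trans htn
  obtain ⟨μ, hμ, hadm, hreg⟩ := exists_nodeRegular_mu hy (by simp only [hf]; exact ht0) hδ
  exact ⟨_, ⟨hadm, hreg⟩, hclose t htη x μ hμ⟩

end

end

noncomputable section

/-! ### A three-dimensional set of parameters is negligible -/

instance isAddHaarMeasure_volume_real4 :
    (MeasureTheory.volume : MeasureTheory.Measure (ℝ × ℝ × ℝ × ℝ)).IsAddHaarMeasure := by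
  have h2 : (MeasureTheory.volume : MeasureTheory.Measure (ℝ × ℝ)).IsAddHaarMeasure :=
    MeasureTheory.Measure.prod.instIsAddHaarMeasure _ _
  have h3 : (MeasureTheory.volume : MeasureTheory.Measure (ℝ × ℝ × ℝ)).IsAddHaarMeasure :=
    MeasureTheory.Measure.prod.instIsAddHaarMeasure _ _
  exact MeasureTheory.Measure.prod.instIsAddHaarMeasure _ _

/-- Dimension count: for each `k` in a plane, three independent affine equations leave a line in ℝ⁴,
so the union is the image of a three-dimensional set. Differentiability of the parametrization is
enough, as differentiable maps send null sets to null sets in equal dimension. -/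
theorem volume_fiber_eq_zero {W : Set ℂ} {m mx my a a₁ a₂ b b₁ b₂ c c₁ c₂ : ℂ → ℝ}
    (hm : ∀ k ∈ W, DifferentiableAt ℝ m k) (hmx : ∀ k ∈ W, DifferentiableAt ℝ mx k)
    (hmy : ∀ k ∈ W, DifferentiableAt ℝ my k)
    (ha : Differentiable ℝ a) (ha₁ : Differentiable ℝ a₁) (ha₂ : Differentiable ℝ a₂)
    (hb : Differentiable ℝ b) (hb₁ : Differentiable ℝ b₁) (hb₂ : Differentiable ℝ b₂)
    (hc : Differentiable ℝ c) (hc₁ : Differentiable ℝ c₁) (hc₂ : Differentiable ℝ c₂)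
    (hdet : ∀ k ∈ W, a₁ k * b₂ k - a₂ k * b₁ k ≠ 0) :
    MeasureTheory.volume {p : ℝ × ℝ × ℝ × ℝ | ∃ k ∈ W,
      p.1 + p.2.1 * a k + p.2.2.1 * b k + p.2.2.2 * c k = m k ∧
      p.2.1 * a₁ k + p.2.2.1 * b₁ k + p.2.2.2 * c₁ k = mx k ∧
      p.2.1 * a₂ k + p.2.2.1 * b₂ k + p.2.2.2 * c₂ k = my k} = 0 := by
  set κ : ℝ × ℝ × ℝ × ℝ → ℂ := fun p => p.1 + p.2.1 * Complex.I with hκ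
  have hκd : Differentiable ℝ κ := by
    have h1 : Differentiable ℝ (fun x : ℝ => (x : ℂ)) := Complex.ofRealCLM.differentiable
    exact (h1.comp differentiable_fst).add
      ((h1.comp (differentiable_fst.comp differentiable_snd)).mul_const _)
  -- The parameters `(k.re, k.im, p₃)` are padded by a zero to the hyperplane of a space of the same
  -- dimension as the target. `t₁` and `t₂` solve the two gradient equations by Cramer's rule, and
  -- the value equation then determines the first coordinate.
  set s : Set (ℝ × ℝ × ℝ × ℝ) := {p | κ p ∈ W ∧ p.2.2.2 = 0} with hs
  set det : ℂ → ℝ := fun k => a₁ k * b₂ k - a₂ k * b₁ k with hdet'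
  set t₁ : ℝ × ℝ × ℝ × ℝ → ℝ := fun p => ((mx (κ p) - p.2.2.1 * c₁ (κ p)) * b₂ (κ p) -
    (my (κ p) - p.2.2.1 * c₂ (κ p)) * b₁ (κ p)) / det (κ p) with ht₁
  set t₂ : ℝ × ℝ × ℝ × ℝ → ℝ := fun p => (a₁ (κ p) * (my (κ p) - p.2.2.1 * c₂ (κ p)) -
    a₂ (κ p) * (mx (κ p) - p.2.2.1 * c₁ (κ p))) / det (κ p) with ht₂
  set F : ℝ × ℝ × ℝ × ℝ → ℝ × ℝ × ℝ × ℝ := fun p =>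
    (m (κ p) - t₁ p * a (κ p) - t₂ p * b (κ p) - p.2.2.1 * c (κ p), t₁ p, t₂ p, p.2.2.1) with hF
  have hs0 : MeasureTheory.volume s = 0 := by
    refine MeasureTheory.measure_mono_null (t := (LinearMap.ker
      ((LinearMap.snd ℝ ℝ ℝ).comp ((LinearMap.snd ℝ ℝ (ℝ × ℝ)).comp
        (LinearMap.snd ℝ ℝ (ℝ × ℝ × ℝ)))) : Set (ℝ × ℝ × ℝ × ℝ))) (fun p hp => hp.2) ?_
    refine MeasureTheory.Measure.addHaar_submodule _ _ fun h => ?_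
    have h1 : ((0, 0, 0, 1) : ℝ × ℝ × ℝ × ℝ) ∈ (⊤ : Submodule ℝ (ℝ × ℝ × ℝ × ℝ)) := trivial
    rw [← h, LinearMap.mem_ker] at h1
    exact one_ne_zero (α := ℝ) h1
  have hFd : DifferentiableOn ℝ F s := by
    intro p hp
    have hW := hp.1
    have k0 := hκd p
    have e : ∀ {h : ℂ → ℝ}, Differentiable ℝ h → DifferentiableAt ℝ (fun p => h (κ p)) p :=
      fun hh => (hh (κ p)).comp p k0
    have e' : ∀ {h : ℂ → ℝ}, (∀ k ∈ W, DifferentiableAt ℝ h k) →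
        DifferentiableAt ℝ (fun p => h (κ p)) p := fun hh => (hh _ hW).comp p k0
    have m0 := e' hm
    have m1 := e' hmx
    have m2 := e' hmy
    have x0 := e ha
    have x1 := e ha₁
    have x2 := e ha₂
    have y0 := e hb
    have y1 := e hb₁
    have y2 := e hb₂
    have z0 := e hc
    have z1 := e hc₁
    have z2 := e hc₂
    have hl : DifferentiableAt ℝ (fun p : ℝ × ℝ × ℝ × ℝ => p.2.2.1) p := by fun_prop
    have d0 : DifferentiableAt ℝ (fun p => det (κ p)) p := (x1.mul y2).sub (x2.mul y1)
    have hd0 : det (κ p) ≠ 0 := hdet _ hW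
    have N1 := ((m1.fun_sub (hl.fun_mul z1)).fun_mul y2).fun_sub
      ((m2.fun_sub (hl.fun_mul z2)).fun_mul y1)
    have N2 := (x1.fun_mul (m2.fun_sub (hl.fun_mul z2))).fun_sub
      (x2.fun_mul (m1.fun_sub (hl.fun_mul z1)))
    have hdiv : ∀ n d : ℝ × ℝ × ℝ × ℝ → ℝ, DifferentiableAt ℝ n p → DifferentiableAt ℝ d p →
        d p ≠ 0 → DifferentiableAt ℝ (fun q => n q / d q) p := fun _ _ hn hd h => by
      fun_prop (disch := assumption)
    have T1 : DifferentiableAt ℝ t₁ p := hdiv _ (fun p => det (κ p)) N1 d0 hd0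
    have T2 : DifferentiableAt ℝ t₂ p := hdiv _ (fun p => det (κ p)) N2 d0 hd0
    exact ((((m0.sub (T1.mul x0)).sub (T2.mul y0)).sub (hl.mul z0)).prodMk
      (T1.prodMk (T2.prodMk hl))).differentiableWithinAt
  refine MeasureTheory.measure_mono_null ?_
    (MeasureTheory.addHaar_image_eq_zero_of_differentiableOn_of_addHaar_eq_zero _ hFd hs0)
  rintro ⟨p0, p1, p2, p3⟩ ⟨k, hk, h0, h1, h2⟩
  simp only at h0 h1 h2
  have hκk : κ (k.re, k.im, p3, 0) = k := by
    rw [hκ]; exact Complex.re_add_im k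
  have hd := hdet k hk
  refine ⟨(k.re, k.im, p3, 0), ⟨by rw [hκk]; exact hk, rfl⟩, ?_⟩
  have e1 : t₁ (k.re, k.im, p3, 0) = p1 := by
    simp only [ht₁, hκk]
    rw [div_eq_iff hd, ← h1, ← h2]
    ring
  have e2 : t₂ (k.re, k.im, p3, 0) = p2 := by
    simp only [ht₂, hκk]
    rw [div_eq_iff hd, ← h1, ← h2]
    ring
  simp only [hF, hκk, e1, e2, Prod.mk.injEq, and_true]
  linarith

/-! ### Three invariant functions on the Brillouin zone -/

/-- The expression equals `4 sin (A/2) sin (C/2) sin ((A + C)/2)`. -/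
theorem sin_half_eq_zero_cases {A C : ℝ} (h : Real.sin A + Real.sin C - Real.sin (A + C) = 0) :
    Real.cos A = 1 ∨ Real.cos C = 1 ∨ Real.cos (A + C) = 1 := by
  have key : Real.sin (A / 2) * Real.sin (C / 2) * Real.sin ((A + C) / 2) = 0 := by
    have e1 : A = 2 * (A / 2) := by ring
    have e2 : C = 2 * (C / 2) := by ring
    have e3 : (A + C) / 2 = A / 2 + C / 2 := by ring
    rw [Real.sin_add] at h
    rw [e3, Real.sin_add]
    generalize A / 2 = p at *
    generalize C / 2 = q at *
    subst e1 e2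
    rw [Real.sin_two_mul, Real.sin_two_mul, Real.cos_two_mul, Real.cos_two_mul] at h
    have hp := Real.sin_sq_add_cos_sq p
    have hq := Real.sin_sq_add_cos_sq q
    linear_combination (1 / 4 : ℝ) * h + Real.sin p * Real.cos p * hq + Real.sin q * Real.cos q * hp
  have hz : ∀ t : ℝ, Real.sin (t / 2) = 0 → Real.cos t = 1 := by
    intro t ht
    have : t = 2 * (t / 2) := by ring
    rw [this, Real.cos_two_mul, Real.cos_sq', ht]
    norm_num
  rcases mul_eq_zero.1 key with h' | h'
  · exact (mul_eq_zero.1 h').imp (hz _) (fun h => Or.inl (hz _ h))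
  · exact Or.inr (Or.inr (hz _ h'))

theorem cos_sub_eq_one_iff_eq {p q : ℝ} :
    Real.cos (p - q) = 1 ↔ Real.cos p = Real.cos q ∧ Real.sin p = Real.sin q := by
  rw [Real.cos_sub]
  have hp := Real.sin_sq_add_cos_sq p
  have hq := Real.sin_sq_add_cos_sq q
  constructor
  · intro h
    have h1 : (Real.cos p - Real.cos q) ^ 2 + (Real.sin p - Real.sin q) ^ 2 = 0 := by
      linear_combination hp + hq - 2 * h
    constructor
    · nlinarith [sq_nonneg (Real.cos p - Real.cos q), sq_nonneg (Real.sin p - Real.sin q)]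
    · nlinarith [sq_nonneg (Real.cos p - Real.cos q), sq_nonneg (Real.sin p - Real.sin q)]
  · rintro ⟨h1, h2⟩
    rw [h1, h2]
    linear_combination hq

/-- The gradients of the three invariant functions are parallel only if the three phases agree. -/
theorem phases_eq_of_dets_eq_zero {p q r : ℝ}
    (h12 : (-Real.sin p + Real.sin r) * (Real.cos r - Real.cos q) -
      (Real.sin q - Real.sin r) * (Real.cos p - Real.cos r) = 0)
    (h13 : (-Real.sin p + Real.sin r) *
        (-Real.cos (p - r) - Real.cos (q - p) + 2 * Real.cos (r - q)) -
      (Real.sin q - Real.sin r) *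
        (2 * Real.cos (p - r) - Real.cos (q - p) - Real.cos (r - q)) = 0)
    (h23 : (Real.cos p - Real.cos r) *
        (-Real.cos (p - r) - Real.cos (q - p) + 2 * Real.cos (r - q)) -
      (Real.cos r - Real.cos q) *
        (2 * Real.cos (p - r) - Real.cos (q - p) - Real.cos (r - q)) = 0) :
    Real.cos (p - q) = 1 ∧ Real.cos (p - r) = 1 := by
  -- The first determinant is a product of sines of half differences, so two of the three phases
  -- agree modulo 2π. In each case the other determinants bring in the third phase.
  have h := sin_half_eq_zero_cases (A := p - r) (C := r - q) (by
    rw [show p - r + (r - q) = p - q by ring, Real.sin_sub, Real.sin_sub, Real.sin_sub]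
    linear_combination -h12)
  rw [show p - r + (r - q) = p - q by ring] at h
  rw [Real.cos_sub p r, Real.cos_sub q p, Real.cos_sub r q] at h13 h23
  have hp := Real.sin_sq_add_cos_sq p
  have hq := Real.sin_sq_add_cos_sq q
  have hr := Real.sin_sq_add_cos_sq r
  rcases h with h | h | h
  · refine ⟨?_, h⟩
    obtain ⟨e1, e2⟩ := cos_sub_eq_one_iff_eq.1 h
    rw [← e1, ← e2] at h13 h23
    rw [Real.cos_sub]
    set z := Real.cos p * Real.cos q + Real.sin p * Real.sin q with hz
    -- `z` is the cosine of the remaining difference. The determinants give `1 - z` times both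
    -- components of a difference of unit vectors whose squared length is `2 (1 - z)`. The next two
    -- cases are alike.
    have hs : (1 - z) * (1 - z) = 0 := by
      have k1 : (Real.sin q - Real.sin p) * (1 - z) = 0 := by
        rw [hz]
        linear_combination (-1 / 2 : ℝ) * h13 + (Real.sin p - Real.sin q) * hp
      have k2 : (Real.cos p - Real.cos q) * (1 - z) = 0 := by
        rw [hz]
        linear_combination (-1 / 2 : ℝ) * h23 + (Real.cos q - Real.cos p) * hp
      linear_combination (1 / 2 : ℝ) * (Real.sin q - Real.sin p) * k1 +
        (1 / 2 : ℝ) * (Real.cos p - Real.cos q) * k2 - (1 / 2 : ℝ) * (1 - z) * (hp + hq)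
    have := mul_self_eq_zero.1 hs
    linarith
  · obtain ⟨e1, e2⟩ := cos_sub_eq_one_iff_eq.1 h
    rw [e1, e2] at h13 h23
    rw [Real.cos_sub, Real.cos_sub, e1, e2]
    set z := Real.cos p * Real.cos q + Real.sin p * Real.sin q with hz
    have hs : (1 - z) * (1 - z) = 0 := by
      have k1 : (Real.sin q - Real.sin p) * (1 - z) = 0 := by
        rw [hz]
        linear_combination (1 / 2 : ℝ) * h13 + (Real.sin p - Real.sin q) * hq
      have k2 : (Real.cos p - Real.cos q) * (1 - z) = 0 := by
        rw [hz]
        linear_combination (1 / 2 : ℝ) * h23 + (Real.cos q - Real.cos p) * hq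
      linear_combination (1 / 2 : ℝ) * (Real.sin q - Real.sin p) * k1 +
        (1 / 2 : ℝ) * (Real.cos p - Real.cos q) * k2 - (1 / 2 : ℝ) * (1 - z) * (hp + hq)
    have := mul_self_eq_zero.1 hs
    constructor <;> linarith
  · refine ⟨h, ?_⟩
    obtain ⟨e1, e2⟩ := cos_sub_eq_one_iff_eq.1 h
    rw [← e1, ← e2] at h13 h23
    rw [Real.cos_sub]
    set z := Real.cos p * Real.cos r + Real.sin p * Real.sin r with hz
    have hs : (1 - z) * (1 - z) = 0 := by
      have k1 : (Real.sin r - Real.sin p) * (1 - z) = 0 := by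
        rw [hz]
        linear_combination (-1 / 2 : ℝ) * h13 + (Real.sin p - Real.sin r) * hp
      have k2 : (Real.cos p - Real.cos r) * (1 - z) = 0 := by
        rw [hz]
        linear_combination (-1 / 2 : ℝ) * h23 + (Real.cos r - Real.cos p) * hp
      linear_combination (1 / 2 : ℝ) * (Real.sin r - Real.sin p) * k1 +
        (1 / 2 : ℝ) * (Real.cos p - Real.cos r) * k2 - (1 / 2 : ℝ) * (1 - z) * (hp + hr)
    have := mul_self_eq_zero.1 hs
    linarith

end

/-! ### Lattice phases and invariant functions -/

noncomputable section

set_option linter.unusedSectionVars false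

/-- `cross a` as a continuous linear map. -/
def crossL (a : ℂ) : ℂ →L[ℝ] ℝ := a.re • Complex.imCLM - a.im • Complex.reCLM

@[simp] theorem crossL_apply (a k : ℂ) : crossL a k = cross a k := by
  simp [crossL, cross]

/-- The first of three phases of the Brillouin zone that are permuted by the rotation. -/
def phaseX (b : ℂ) : ℂ →L[ℝ] ℝ := (-(2 * Real.pi / cross b (omega3 * b))) • crossL (omega3 * b)

def phaseY (b : ℂ) : ℂ →L[ℝ] ℝ := (-(2 * Real.pi / cross b (omega3 * b))) • crossL b

def phaseZ (b : ℂ) : ℂ →L[ℝ] ℝ := -(phaseX b + phaseY b)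

theorem phaseX_b {b : ℂ} (hb : b ≠ 0) : phaseX b b = 2 * Real.pi := by
  have := (cross_lattice_pos hb).ne'
  simp only [phaseX, smul_apply, crossL_apply, smul_eq_mul]
  rw [cross_swap (omega3 * b) b]
  field_simp

theorem phaseX_omega3_b (b : ℂ) : phaseX b (omega3 * b) = 0 := by
  simp [phaseX]

theorem phaseY_b (b : ℂ) : phaseY b b = 0 := by
  simp [phaseY]

theorem phaseY_omega3_b {b : ℂ} (hb : b ≠ 0) : phaseY b (omega3 * b) = -(2 * Real.pi) := by
  have := (cross_lattice_pos hb).ne'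
  simp only [phaseY, smul_apply, crossL_apply, smul_eq_mul]
  field_simp

theorem phaseZ_b {b : ℂ} (hb : b ≠ 0) : phaseZ b b = -(2 * Real.pi) := by
  simp [phaseZ, phaseX_b hb, phaseY_b]

theorem phaseZ_omega3_b {b : ℂ} (hb : b ≠ 0) : phaseZ b (omega3 * b) = 2 * Real.pi := by
  simp [phaseZ, phaseX_omega3_b, phaseY_omega3_b hb]

/-- Coordinates with respect to the lattice basis. -/
theorem exists_coordinates {b : ℂ} (hb : b ≠ 0) (k : ℂ) :
    ∃ s t : ℝ, k = s • b + t • (omega3 * b) := by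
  refine ⟨cross k (omega3 * b) / cross b (omega3 * b), cross b k / cross b (omega3 * b),
    (eq_coord_add b (omega3 * b) (cross_lattice_pos hb).ne' k).trans ?_⟩
  rw [Complex.real_smul, Complex.real_smul]

theorem omega3_mul_coordinates (b : ℂ) (s t : ℝ) :
    omega3 * (s • b + t • (omega3 * b)) = (-t) • b + (s - t) • (omega3 * b) := by
  simp only [Complex.real_smul]
  push_cast
  linear_combination (t * b : ℂ) * omega3_sq

theorem phaseX_omega3_mul {b : ℂ} (hb : b ≠ 0) (k : ℂ) : phaseX b (omega3 * k) = phaseY b k := by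
  obtain ⟨s, t, rfl⟩ := exists_coordinates hb k
  rw [omega3_mul_coordinates]
  simp only [map_add, map_smul, phaseX_b hb, phaseX_omega3_b, phaseY_b, phaseY_omega3_b hb,
    smul_eq_mul]
  ring

theorem phaseY_omega3_mul {b : ℂ} (hb : b ≠ 0) (k : ℂ) : phaseY b (omega3 * k) = phaseZ b k := by
  obtain ⟨s, t, rfl⟩ := exists_coordinates hb k
  rw [omega3_mul_coordinates]
  simp only [map_add, map_smul, phaseZ_b hb, phaseZ_omega3_b hb, phaseY_b, phaseY_omega3_b hb,
    smul_eq_mul]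
  ring

theorem phaseZ_omega3_mul {b : ℂ} (hb : b ≠ 0) (k : ℂ) : phaseZ b (omega3 * k) = phaseX b k := by
  have h1 := phaseX_omega3_mul hb k
  have h2 := phaseY_omega3_mul hb k
  simp only [phaseZ, neg_apply, add_apply] at h2 ⊢
  rw [h1, h2]
  ring

theorem exists_phase_lattice {b : ℂ} (hb : b ≠ 0) {G : ℂ} (hG : G ∈ recipLattice b) :
    ∃ m n : ℤ, phaseX b G = m * (2 * Real.pi) ∧ phaseY b G = n * (2 * Real.pi) := by
  obtain ⟨i, j, rfl⟩ := mem_recipLattice.1 hG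
  have h : (i : ℂ) * b + j * (omega3 * b) = (i : ℝ) • b + (j : ℝ) • (omega3 * b) := by
    simp only [Complex.real_smul]; push_cast; ring
  refine ⟨i, -j, ?_, ?_⟩
  · rw [h]; simp only [map_add, map_smul, phaseX_b hb, phaseX_omega3_b, smul_eq_mul]; ring
  · rw [h]
    simp only [map_add, map_smul, phaseY_b, phaseY_omega3_b hb, smul_eq_mul]
    push_cast; ring

/-- Three smooth functions that are invariant under the lattice and the rotation. -/
def invCos (b k : ℂ) : ℝ :=
  Real.cos (phaseX b k) + Real.cos (phaseY b k) + Real.cos (phaseZ b k)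

def invSin (b k : ℂ) : ℝ :=
  Real.sin (phaseX b k) + Real.sin (phaseY b k) + Real.sin (phaseZ b k)

/-- Wherever two of the three phases agree modulo 2π, the gradients of the other two functions are
parallel; this third function supplies the missing direction there, except where all three phases
agree. -/
def invDiff (b k : ℂ) : ℝ :=
  Real.sin ((phaseX b - phaseZ b) k) + Real.sin ((phaseY b - phaseX b) k) +
    Real.sin ((phaseZ b - phaseY b) k)

theorem contDiff_invCos (b : ℂ) : ContDiff ℝ ∞ (invCos b) := by
  unfold invCos; fun_prop

theorem contDiff_invSin (b : ℂ) : ContDiff ℝ ∞ (invSin b) := by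
  unfold invSin; fun_prop

theorem contDiff_invDiff (b : ℂ) : ContDiff ℝ ∞ (invDiff b) := by
  unfold invDiff; fun_prop

theorem fderiv_sum_cos (α β γ : ℂ →L[ℝ] ℝ) (k v : ℂ) :
    fderiv ℝ (fun k => Real.cos (α k) + Real.cos (β k) + Real.cos (γ k)) k v =
      -(Real.sin (α k) * α v + Real.sin (β k) * β v + Real.sin (γ k) * γ v) := by
  have h := ((α.hasFDerivAt (x := k)).cos.fun_add (β.hasFDerivAt (x := k)).cos).fun_add
    (γ.hasFDerivAt (x := k)).cos
  rw [h.fderiv]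
  simp
  ring

theorem fderiv_sum_sin (α β γ : ℂ →L[ℝ] ℝ) (k v : ℂ) :
    fderiv ℝ (fun k => Real.sin (α k) + Real.sin (β k) + Real.sin (γ k)) k v =
      Real.cos (α k) * α v + Real.cos (β k) * β v + Real.cos (γ k) * γ v := by
  have h := ((α.hasFDerivAt (x := k)).sin.fun_add (β.hasFDerivAt (x := k)).sin).fun_add
    (γ.hasFDerivAt (x := k)).sin
  rw [h.fderiv]
  simp

theorem inv_rotation {b : ℂ} (hb : b ≠ 0) (k : ℂ) :
    invCos b (omega3 * k) = invCos b k ∧ invSin b (omega3 * k) = invSin b k ∧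
      invDiff b (omega3 * k) = invDiff b k := by
  simp only [invCos, invSin, invDiff, sub_apply, phaseX_omega3_mul hb,
    phaseY_omega3_mul hb, phaseZ_omega3_mul hb]
  refine ⟨by ring, by ring, by ring⟩

theorem inv_translation {b : ℂ} (hb : b ≠ 0) {G : ℂ} (hG : G ∈ recipLattice b) (k : ℂ) :
    invCos b (k + G) = invCos b k ∧ invSin b (k + G) = invSin b k ∧
      invDiff b (k + G) = invDiff b k := by
  obtain ⟨m, n, hm, hn⟩ := exists_phase_lattice hb hG
  have hZ : phaseZ b G = ((-(m + n) : ℤ) : ℝ) * (2 * Real.pi) := by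
    simp only [phaseZ, neg_apply, add_apply, hm, hn]; push_cast; ring
  have e1 : phaseX b G - phaseZ b G = ((2 * m + n : ℤ) : ℝ) * (2 * Real.pi) := by
    rw [hm, hZ]; push_cast; ring
  have e2 : phaseY b G - phaseX b G = ((n - m : ℤ) : ℝ) * (2 * Real.pi) := by
    rw [hm, hn]; push_cast; ring
  have e3 : phaseZ b G - phaseY b G = ((-m - 2 * n : ℤ) : ℝ) * (2 * Real.pi) := by
    rw [hn, hZ]; push_cast; ring
  simp only [invCos, invSin, invDiff, sub_apply, map_add]
  rw [e1, e2, e3, hm, hn, hZ]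
  simp only [Real.cos_add_int_mul_two_pi, Real.sin_add_int_mul_two_pi, and_self]

/-- Away from the momenta fixed by the rotation modulo the lattice, the gradients of the three
invariant functions span the plane. -/
theorem exists_det_ne_zero {b : ℂ} (hb : b ≠ 0) {k : ℂ} (hk : omega3 * k - k ∉ recipLattice b) :
    (fderiv ℝ (invCos b) k b * fderiv ℝ (invSin b) k (omega3 * b) -
      fderiv ℝ (invCos b) k (omega3 * b) * fderiv ℝ (invSin b) k b ≠ 0) ∨
    (fderiv ℝ (invCos b) k b * fderiv ℝ (invDiff b) k (omega3 * b) -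
      fderiv ℝ (invCos b) k (omega3 * b) * fderiv ℝ (invDiff b) k b ≠ 0) ∨
    (fderiv ℝ (invSin b) k b * fderiv ℝ (invDiff b) k (omega3 * b) -
      fderiv ℝ (invSin b) k (omega3 * b) * fderiv ℝ (invDiff b) k b ≠ 0) := by
  by_contra! hcon
  obtain ⟨h1, h2, h3⟩ := hcon
  have hc := fderiv_sum_cos (phaseX b) (phaseY b) (phaseZ b) k
  have hs := fderiv_sum_sin (phaseX b) (phaseY b) (phaseZ b) k
  have hd := fderiv_sum_sin (phaseX b - phaseZ b) (phaseY b - phaseX b) (phaseZ b - phaseY b) k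
  change ∀ v, fderiv ℝ (invCos b) k v = _ at hc
  change ∀ v, fderiv ℝ (invSin b) k v = _ at hs
  change ∀ v, fderiv ℝ (invDiff b) k v = _ at hd
  rw [hc, hc, hs, hs] at h1
  rw [hc, hc, hd, hd] at h2
  rw [hs, hs, hd, hd] at h3
  simp only [sub_apply, phaseX_b hb, phaseX_omega3_b, phaseY_b, phaseY_omega3_b hb, phaseZ_b hb,
    phaseZ_omega3_b hb] at h1 h2 h3
  have hpi : (2 * Real.pi) ^ 2 ≠ 0 := by positivity
  obtain ⟨c1, c2⟩ := phases_eq_of_dets_eq_zero (p := phaseX b k) (q := phaseY b k)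
    (r := phaseZ b k)
    (mul_left_cancel₀ hpi (by linear_combination h1))
    (mul_left_cancel₀ hpi (by linear_combination h2))
    (mul_left_cancel₀ hpi (by linear_combination h3))
  obtain ⟨m, hm⟩ := (Real.cos_eq_one_iff _).1 c1
  obtain ⟨n, hn⟩ := (Real.cos_eq_one_iff _).1 c2
  refine hk ?_
  obtain ⟨s, t, rfl⟩ := exists_coordinates hb k
  simp only [map_add, map_smul, phaseX_b hb, phaseX_omega3_b, phaseY_b, phaseY_omega3_b hb,
    phaseZ_b hb, phaseZ_omega3_b hb, smul_eq_mul] at hm hn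
  have hpi' : (2 * Real.pi) ≠ 0 := by positivity
  have hm' : (m : ℝ) = s + t := mul_left_cancel₀ hpi' (by linear_combination hm)
  have hn' : (n : ℝ) = 2 * s - t := mul_left_cancel₀ hpi' (by linear_combination hn)
  rw [mem_recipLattice]
  refine ⟨-m, n - m, ?_⟩
  rw [omega3_mul_coordinates]
  simp only [Complex.real_smul]
  have hm2 : (m : ℂ) = s + t := by exact_mod_cast hm'
  have hn2 : (n : ℂ) = 2 * s - t := by exact_mod_cast hn'
  push_cast
  rw [hm2, hn2]
  ring

/-! ### The curve `Re (f conj d) = 0` and its regularity -/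

section

variable {Hp Hm : Type*} [NormedAddCommGroup Hp] [InnerProductSpace ℂ Hp] [CompleteSpace Hp]
  [NormedAddCommGroup Hm] [InnerProductSpace ℂ Hm] [CompleteSpace Hm] {B : MoireBands Hp}
  {C2 : Hp ≃ₗᵢ[ℂ] Hm} {g : ChernGauge B}

/-- The function `Re (f conj d)`, which vanishes on `Σ`. -/
def reProd (C2 : Hp ≃ₗᵢ[ℂ] Hm) (g : ChernGauge B) (x : MeanField Hp Hm) (k : ℂ) : ℝ :=
  (fFun g x.Ph k * conj (dFun C2 g x.Ppar k)).re

def imProd (C2 : Hp ≃ₗᵢ[ℂ] Hm) (g : ChernGauge B) (x : MeanField Hp Hm) (k : ℂ) : ℝ :=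
  (fFun g x.Ph k * conj (dFun C2 g x.Ppar k)).im

/-- `Σ` is a regular curve away from the zeros of `d_∥`. -/
def PathRegular (C2 : Hp ≃ₗᵢ[ℂ] Hm) (g : ChernGauge B) (x : MeanField Hp Hm) : Prop :=
  ∀ k, reProd C2 g x k = 0 → ‖dFun C2 g x.Ppar k‖ ≤ ‖fFun g x.Ph k‖ → dFun C2 g x.Ppar k ≠ 0 →
    fderiv ℝ (reProd C2 g x) k ≠ 0

theorem contDiff_fFun_mul_conj_dFun {x : MeanField Hp Hm} (h : ContDiff ℝ ∞ x.Ph) (h' : ContDiff ℝ ∞ x.Ppar) :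
    ContDiff ℝ ∞ (fun k => fFun g x.Ph k * conj (dFun C2 g x.Ppar k)) :=
  (contDiff_fFun h).mul (Complex.conjCLE.contDiff.comp (contDiff_dFun h'))

theorem contDiff_reProd {x : MeanField Hp Hm} (h : ContDiff ℝ ∞ x.Ph) (h' : ContDiff ℝ ∞ x.Ppar) :
    ContDiff ℝ ∞ (reProd C2 g x) :=
  Complex.reCLM.contDiff.comp (contDiff_fFun_mul_conj_dFun h h')

theorem contDiff_imProd {x : MeanField Hp Hm} (h : ContDiff ℝ ∞ x.Ph) (h' : ContDiff ℝ ∞ x.Ppar) :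
    ContDiff ℝ ∞ (imProd C2 g x) :=
  Complex.imCLM.contDiff.comp (contDiff_fFun_mul_conj_dFun h h')

theorem CloseTo.trans {r : ℕ} {δ ε : ℝ} {x y z : MeanField Hp Hm} (h : CloseTo r δ x y)
    (h' : CloseTo r ε y z) (hx : ContDiff ℝ ∞ x.Ph) (hy : ContDiff ℝ ∞ y.Ph)
    (hz : ContDiff ℝ ∞ z.Ph) (hx' : ContDiff ℝ ∞ x.Ppar) (hy' : ContDiff ℝ ∞ y.Ppar)
    (hz' : ContDiff ℝ ∞ z.Ppar) : CloseTo r (δ + ε) x z := by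
  refine ⟨?_, fun j hj k => ?_⟩
  · have := abs_add_le (x.μ - y.μ) (y.μ - z.μ)
    rw [sub_add_sub_cancel] at this
    linarith [h.1, h'.1]
  · have hle : ((j : ℕ∞) : WithTop ℕ∞) ≤ ∞ := by exact_mod_cast (le_top : (j : ℕ∞) ≤ ⊤)
    obtain ⟨a1, a2⟩ := h.2 j hj k
    obtain ⟨b1, b2⟩ := h'.2 j hj k
    have e1 : (fun q => x.Ph q - z.Ph q) = (fun q => x.Ph q - y.Ph q) +
      (fun q => y.Ph q - z.Ph q) := by funext q; simp
    have e2 : (fun q => x.Ppar q - z.Ppar q) = (fun q => x.Ppar q - y.Ppar q) +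
      (fun q => y.Ppar q - z.Ppar q) := by funext q; simp
    constructor
    · rw [e1, iteratedFDeriv_add_apply (((hx.sub hy).of_le hle).contDiffAt)
        (((hy.sub hz).of_le hle).contDiffAt)]
      exact (norm_add_le _ _).trans_lt (by linarith)
    · rw [e2, iteratedFDeriv_add_apply (((hx'.sub hy').of_le hle).contDiffAt)
        (((hy'.sub hz').of_le hle).contDiffAt)]
      exact (norm_add_le _ _).trans_lt (by linarith)

end

end

noncomputable section

set_option linter.unusedSectionVars false

section

variable {Hp Hm : Type*} [NormedAddCommGroup Hp] [InnerProductSpace ℂ Hp] [CompleteSpace Hp]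
  [NormedAddCommGroup Hm] [InnerProductSpace ℂ Hm] [CompleteSpace Hm] {B : MoireBands Hp}
  {C2 : Hp ≃ₗᵢ[ℂ] Hm} {g : ChernGauge B}

/-! ### Density of the path-regular mean fields -/

/-- The combination of the three invariant functions with coefficients `p`. -/
def invComb (b : ℂ) (p : ℝ × ℝ × ℝ × ℝ) (k : ℂ) : ℝ :=
  p.1 + p.2.1 * invCos b k + p.2.2.1 * invSin b k + p.2.2.2 * invDiff b k

theorem contDiff_invComb (b : ℂ) (p : ℝ × ℝ × ℝ × ℝ) : ContDiff ℝ ∞ (invComb b p) :=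
  ((contDiff_const.add (contDiff_const.mul (contDiff_invCos b))).add
    (contDiff_const.mul (contDiff_invSin b))).add (contDiff_const.mul (contDiff_invDiff b))

theorem fderiv_invComb (b : ℂ) (p : ℝ × ℝ × ℝ × ℝ) (k v : ℂ) :
    fderiv ℝ (invComb b p) k v = p.2.1 * fderiv ℝ (invCos b) k v +
      p.2.2.1 * fderiv ℝ (invSin b) k v + p.2.2.2 * fderiv ℝ (invDiff b) k v := by
  have h1 := ((contDiff_invCos b).differentiable (by simp) k).hasFDerivAt
  have h2 := ((contDiff_invSin b).differentiable (by simp) k).hasFDerivAt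
  have h3 := ((contDiff_invDiff b).differentiable (by simp) k).hasFDerivAt
  have h := (((hasFDerivAt_const p.1 k).fun_add (h1.const_mul p.2.1)).fun_add
    (h2.const_mul p.2.2.1)).fun_add (h3.const_mul p.2.2.2)
  rw [show fderiv ℝ (invComb b p) k = _ from h.fderiv]
  simp

/-- For almost all coefficients, the curve `ψ = τ χ` is regular at the relevant momenta. -/
theorem ae_regular {b : ℂ} (hb : b ≠ 0) {ψ χ : ℂ → ℝ} (hψ : ContDiff ℝ ∞ ψ)
    (hχ : ContDiff ℝ ∞ χ) :
    ∀ᵐ p : ℝ × ℝ × ℝ × ℝ, ∀ k, χ k ≠ 0 → omega3 * k - k ∉ recipLattice b →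
      ψ k - invComb b p k * χ k = 0 →
      fderiv ℝ (fun q => ψ q - invComb b p q * χ q) k ≠ 0 := by
  have hdir : ∀ {h : ℂ → ℝ}, ContDiff ℝ ∞ h → ∀ v, Differentiable ℝ (fun k => fderiv ℝ h k v) :=
    fun hh v => ((hh.fderiv_right (m := ∞) (by simp)).clm_apply contDiff_const).differentiable
      (by simp)
  set a := invCos b with ha'
  set c := invSin b with hc'
  set e := invDiff b with he'
  have ha : ContDiff ℝ ∞ a := contDiff_invCos b
  have hc : ContDiff ℝ ∞ c := contDiff_invSin b
  have he : ContDiff ℝ ∞ e := contDiff_invDiff b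
  -- Where `χ ≠ 0`, the curve is irregular at `k` exactly when `τ = m` and the derivative of `τ` in
  -- direction `v` is `M v`; testing `v` on the lattice basis gives three equations for the
  -- coefficients of `τ`.
  set m : ℂ → ℝ := fun k => ψ k / χ k with hm
  set M : ℂ → ℂ → ℝ := fun v k => (fderiv ℝ ψ k v - m k * fderiv ℝ χ k v) / χ k with hM
  have hmd : ∀ k, χ k ≠ 0 → DifferentiableAt ℝ m k := fun k hk => by
    have h1 := hψ.differentiable (by simp) k
    have h2 := hχ.differentiable (by simp) k
    simp only [hm]
    fun_prop (disch := assumption)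
  have hMd : ∀ v k, χ k ≠ 0 → DifferentiableAt ℝ (M v) k := fun v k hk => by
    have h1 := hdir hψ v k
    have h2 := hχ.differentiable (by simp) k
    have h3 := hdir hχ v k
    have h4 := hmd k hk
    simp only [hM]
    fun_prop (disch := assumption)
  set w := omega3 * b with hw
  have null : ∀ a₀ c₀ e₀ : ℂ → ℝ, ContDiff ℝ ∞ a₀ → ContDiff ℝ ∞ c₀ → ContDiff ℝ ∞ e₀ →
      MeasureTheory.volume {p : ℝ × ℝ × ℝ × ℝ | ∃ k ∈ {k | χ k ≠ 0 ∧
        fderiv ℝ a₀ k b * fderiv ℝ c₀ k w - fderiv ℝ a₀ k w * fderiv ℝ c₀ k b ≠ 0},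
        p.1 + p.2.1 * a₀ k + p.2.2.1 * c₀ k + p.2.2.2 * e₀ k = m k ∧
        p.2.1 * fderiv ℝ a₀ k b + p.2.2.1 * fderiv ℝ c₀ k b + p.2.2.2 * fderiv ℝ e₀ k b = M b k ∧
        p.2.1 * fderiv ℝ a₀ k w + p.2.2.1 * fderiv ℝ c₀ k w + p.2.2.2 * fderiv ℝ e₀ k w =
          M w k} = 0 := by
    intro a₀ c₀ e₀ ha₀ hc₀ he₀
    exact volume_fiber_eq_zero (fun k hk => hmd k hk.1) (fun k hk => hMd b k hk.1)
      (fun k hk => hMd w k hk.1) (ha₀.differentiable (by simp)) (hdir ha₀ b) (hdir ha₀ w)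
      (hc₀.differentiable (by simp)) (hdir hc₀ b) (hdir hc₀ w)
      (he₀.differentiable (by simp)) (hdir he₀ b) (hdir he₀ w) (fun k hk => hk.2)
  have image : ∀ {s : Set (ℝ × ℝ × ℝ × ℝ)} (F : ℝ × ℝ × ℝ × ℝ → ℝ × ℝ × ℝ × ℝ),
      Differentiable ℝ F → MeasureTheory.volume s = 0 → MeasureTheory.volume (F '' s) = 0 :=
    fun F hF hs => MeasureTheory.addHaar_image_eq_zero_of_differentiableOn_of_addHaar_eq_zero _
      hF.differentiableOn hs
  -- Which two gradients are independent depends on `k`. The three cases differ by a permutation of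
  -- the coefficients, which preserves null sets.
  have n1 := null a c e ha hc he
  have n2 := image (fun p => (p.1, p.2.1, p.2.2.2, p.2.2.1)) (by fun_prop) (null a e c ha he hc)
  have n3 := image (fun p => (p.1, p.2.2.2, p.2.1, p.2.2.1)) (by fun_prop) (null c e a hc he ha)
  filter_upwards [MeasureTheory.measure_eq_zero_iff_ae_notMem.1 n1,
    MeasureTheory.measure_eq_zero_iff_ae_notMem.1 n2,
    MeasureTheory.measure_eq_zero_iff_ae_notMem.1 n3] with p h1 h2 h3 k hχk hk h0 hder
  have hτ := (contDiff_invComb b p).differentiable (by simp) k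
  have hfd : ∀ v, fderiv ℝ (fun q => ψ q - invComb b p q * χ q) k v =
      fderiv ℝ ψ k v - (invComb b p k * fderiv ℝ χ k v + χ k * fderiv ℝ (invComb b p) k v) := by
    intro v
    have := ((hψ.differentiable (by simp) k).hasFDerivAt.fun_sub
      (hτ.hasFDerivAt.fun_mul (hχ.differentiable (by simp) k).hasFDerivAt)).fderiv
    rw [this]
    simp
  have hval : invComb b p k = m k := by
    simp only [hm]; rw [eq_div_iff hχk]; linarith
  have hgrad : ∀ v, fderiv ℝ (invComb b p) k v = M v k := by
    intro v
    have := hfd v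
    rw [hder, hval] at this
    simp only [hM]
    rw [eq_div_iff hχk]
    simp only [zero_apply] at this
    linarith
  have g1 := hgrad b
  have g2 := hgrad w
  rw [fderiv_invComb] at g1 g2
  rw [invComb] at hval
  rcases exists_det_ne_zero hb hk with hd | hd | hd
  · exact h1 ⟨k, ⟨hχk, hd⟩, hval, g1, g2⟩
  · refine h2 ⟨(p.1, p.2.1, p.2.2.2, p.2.2.1), ⟨k, ⟨hχk, hd⟩, ?_, ?_, ?_⟩, rfl⟩
    · simp only; linarith
    · simp only; linarith
    · simp only; linarith
  · refine h3 ⟨(p.1, p.2.2.1, p.2.2.2, p.2.1), ⟨k, ⟨hχk, hd⟩, ?_, ?_, ?_⟩, rfl⟩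
    · simp only; linarith
    · simp only; linarith
    · simp only; linarith

theorem invComb_invariant {b : ℂ} (hb : b ≠ 0) (p : ℝ × ℝ × ℝ × ℝ) :
    (∀ G ∈ recipLattice b, ∀ k, invComb b p (k + G) = invComb b p k) ∧
      ∀ k, invComb b p (omega3 * k) = invComb b p k := by
  refine ⟨fun G hG k => ?_, fun k => ?_⟩
  · obtain ⟨h1, h2, h3⟩ := inv_translation hb hG k
    simp only [invComb, h1, h2, h3]
  · obtain ⟨h1, h2, h3⟩ := inv_rotation hb k
    simp only [invComb, h1, h2, h3]

/-- The mean field with `f` replaced by `f (1 + i τ)`. -/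
def twist (g : ChernGauge B) (x : MeanField Hp Hm) (τ : ℂ → ℝ) : MeanField Hp Hm :=
  ⟨x.μ, fun k => x.Ph k + τ k • offDiag g (fun k => Complex.I * fFun g x.Ph k) k, x.Ppar⟩

theorem fFun_twist (x : MeanField Hp Hm) (τ : ℂ → ℝ) (k : ℂ) :
    fFun g (twist g x τ).Ph k = fFun g x.Ph k * (1 + Complex.I * τ k) := by
  simp only [twist]
  rw [fFun_add_smul, fFun_offDiag]
  ring

theorem reProd_twist (x : MeanField Hp Hm) (τ : ℂ → ℝ) :
    reProd C2 g (twist g x τ) = fun k => reProd C2 g x k - τ k * imProd C2 g x k := by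
  funext k
  simp only [reProd, imProd, fFun_twist]
  simp [twist]
  ring

/-- The twist leaves `ε` unchanged and multiplies `|f|` by `|1 + i τ| ≥ 1`, so the window at Γ_M
only grows and `μ` stays inside. -/
theorem Admissible.twist {x : MeanField Hp Hm} (hx : Admissible C2 g x) {τ : ℂ → ℝ}
    (hτ : ContDiff ℝ ∞ τ) (hper : ∀ G ∈ recipLattice B.b, ∀ k, τ (k + G) = τ k)
    (hrot : ∀ k, τ (omega3 * k) = τ k) : Admissible C2 g (twist g x τ) := by
  refine hx.of_band rfl
    (hx.band.add ((isBandHamiltonian_offDiag hx.band Complex.I).smul_fun hτ hper hrot)) ?_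
  rw [fFun_twist]
  have he : epsFun g (_root_.twist g x τ).Ph 0 = epsFun g x.Ph 0 := by
    simp only [_root_.twist]
    rw [epsFun_add_smul, epsFun_offDiag, mul_zero, add_zero]
  rw [he, norm_mul]
  have h1 : (1 : ℝ) ≤ ‖1 + Complex.I * (τ 0 : ℂ)‖ := by
    have := Complex.abs_re_le_norm (1 + Complex.I * (τ 0 : ℂ))
    simpa using this
  exact hx.abs_sub_le.trans (le_mul_of_one_le_right (norm_nonneg _) h1)

theorem exists_closeTo_twist {x : MeanField Hp Hm} (hx : Admissible C2 g x) (r : ℕ) {δ : ℝ}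
    (hδ : 0 < δ) : ∃ η > 0, ∀ p : ℝ × ℝ × ℝ × ℝ, |p.1| < η → |p.2.1| < η → |p.2.2.1| < η →
      |p.2.2.2| < η → CloseTo r δ x (twist g x (invComb B.b p)) := by
  have hK := isBandHamiltonian_offDiag (g := g) hx.band Complex.I
  set K := offDiag g (fun k => Complex.I * fFun g x.Ph k) with hKdef
  have A1 := hK.smul_fun (contDiff_invCos B.b) (fun G hG k => (inv_translation B.b_ne hG k).1)
    (fun k => (inv_rotation B.b_ne k).1)
  have A2 := hK.smul_fun (contDiff_invSin B.b) (fun G hG k => (inv_translation B.b_ne hG k).2.1)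
    (fun k => (inv_rotation B.b_ne k).2.1)
  have A3 := hK.smul_fun (contDiff_invDiff B.b) (fun G hG k => (inv_translation B.b_ne hG k).2.2)
    (fun k => (inv_rotation B.b_ne k).2.2)
  have hδ4 : 0 < δ / 4 := by positivity
  obtain ⟨η0, h0, c0⟩ := exists_closeTo_smul (Hm := Hm) hK r hδ4
  obtain ⟨η1, h1, c1⟩ := exists_closeTo_smul (Hm := Hm) A1 r hδ4
  obtain ⟨η2, h2, c2⟩ := exists_closeTo_smul (Hm := Hm) A2 r hδ4
  obtain ⟨η3, h3, c3⟩ := exists_closeTo_smul (Hm := Hm) A3 r hδ4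
  refine ⟨min (min η0 η1) (min η2 η3), by positivity, fun p p0 p1 p2 p3 => ?_⟩
  simp only [lt_min_iff] at p0 p1 p2 p3
  have hμ : |x.μ - x.μ| < δ / 4 := by simpa using hδ4
  have B0 := hx.band.add (hK.smul p.1)
  have B1 := B0.add (A1.smul p.2.1)
  have B2 := B1.add (A2.smul p.2.2.1)
  have B3 := B2.add (A3.smul p.2.2.2)
  have d := hx.pairing.smooth
  have t0 := c0 p.1 p0.1.1 x x.μ hμ
  have t1 := t0.trans (c1 p.2.1 p1.1.2 _ x.μ hμ) hx.band.smooth B0.smooth B1.smooth d d d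
  have t2 := t1.trans (c2 p.2.2.1 p2.2.1 _ x.μ hμ) hx.band.smooth B1.smooth B2.smooth d d d
  have t3 := t2.trans (c3 p.2.2.2 p3.2.2 _ x.μ hμ) hx.band.smooth B2.smooth B3.smooth d d d
  have e1 : δ / 4 + δ / 4 + δ / 4 + δ / 4 = δ := by ring
  rw [e1] at t3
  have e2 : (twist g x (invComb B.b p)).Ph = fun k => x.Ph k + p.1 • K k +
      p.2.1 • invCos B.b k • K k + p.2.2.1 • invSin B.b k • K k +
      p.2.2.2 • invDiff B.b k • K k := by
    funext k
    simp only [twist, invComb, add_smul, mul_smul, hKdef]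
    abel
  have e3 : twist g x (invComb B.b p) =
      ⟨x.μ, (twist g x (invComb B.b p)).Ph, x.Ppar⟩ := rfl
  rw [e3, e2]
  exact t3

/-- The twist replaces `Re (f conj d)` by `Re (f conj d) - τ Im (f conj d)`. At a point of the new
`Σ` with `d ≠ 0` also `f ≠ 0`, hence the momentum is not fixed by the rotation modulo the lattice
and `Im (f conj d) ≠ 0`. There almost every small choice of coefficients gives a regular curve. -/
theorem relDense_pathRegular :
    RelDense {x | Admissible C2 g x} {x | PathRegular C2 g x} := by
  intro x hx r δ hδ
  have hx : Admissible C2 g x := hx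
  obtain ⟨η, hη, hclose⟩ := exists_closeTo_twist hx r hδ
  have hae := ae_regular B.b_ne (contDiff_reProd (C2 := C2) (g := g) hx.band.smooth
    hx.pairing.smooth) (contDiff_imProd (C2 := C2) (g := g) hx.band.smooth hx.pairing.smooth)
  have hdense := MeasureTheory.Measure.dense_of_ae hae
  obtain ⟨p, hp, hreg⟩ := hdense.exists_dist_lt 0 hη
  rw [dist_zero_left] at hreg
  simp only [Prod.norm_def, max_lt_iff, Real.norm_eq_abs] at hreg
  obtain ⟨hinv, hrot⟩ := invComb_invariant B.b_ne p
  have hy := hx.twist (contDiff_invComb B.b p) hinv hrot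
  refine ⟨twist g x (invComb B.b p), ⟨hy, ?_⟩,
    hclose p hreg.1 hreg.2.1 hreg.2.2.1 hreg.2.2.2⟩
  intro k h0 hle hd
  have hfy : fFun g (twist g x (invComb B.b p)).Ph k ≠ 0 := by
    intro h
    rw [h, norm_zero] at hle
    exact hd (norm_le_zero_iff.1 hle)
  have hk : omega3 * k - k ∉ recipLattice B.b := fun h =>
    (hy.dFun_eq_zero_or_fFun_eq_zero h).elim hd hfy
  have hd' : dFun C2 g x.Ppar k ≠ 0 := hd
  have hf : fFun g x.Ph k ≠ 0 := by
    intro h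
    rw [fFun_twist, h, zero_mul] at hfy
    exact hfy rfl
  rw [reProd_twist] at h0 ⊢
  have hχ : imProd C2 g x k ≠ 0 := by
    intro h
    simp only [h, mul_zero, sub_zero] at h0
    have : fFun g x.Ph k * conj (dFun C2 g x.Ppar k) = 0 := Complex.ext h0 h
    rcases mul_eq_zero.1 this with h | h
    · exact hf h
    · exact hd' (by simpa using h)
  exact hp k hχ hk h0

end

end

noncomputable section

set_option linter.unusedSectionVars false

section

variable {Hp Hm : Type*} [NormedAddCommGroup Hp] [InnerProductSpace ℂ Hp] [CompleteSpace Hp]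
  [NormedAddCommGroup Hm] [InnerProductSpace ℂ Hm] [CompleteSpace Hm] {B : MoireBands Hp}
  {C2 : Hp ≃ₗᵢ[ℂ] Hm} {g : ChernGauge B}

/-! ### Openness of the path-regular mean fields -/

/-- The scale `t` is 1 when values are compared and `‖v‖` when derivatives in direction `v` are. -/
theorem abs_re_mul_conj_sub_le {a b a' b' : ℂ} {η M t : ℝ} (ht : 0 ≤ t)
    (h1 : ‖a - a'‖ ≤ η * t) (h2 : ‖b - b'‖ ≤ η) (ha : ‖a‖ ≤ M * t) (hb : ‖b‖ ≤ M) :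
    |(a * conj b).re - (a' * conj b').re| ≤ η * (2 * M + η) * t := by
  have e : (a * conj b).re - (a' * conj b').re =
      ((a - a') * conj b + a' * conj (b - b')).re := by
    rw [← Complex.sub_re]
    congr 1
    rw [map_sub]; ring
  have ha' : ‖a'‖ ≤ (M + η) * t := by
    have := norm_sub_norm_le a' a
    rw [norm_sub_rev] at this
    linarith
  have hη : 0 ≤ η := (norm_nonneg _).trans h2
  rw [e]
  refine (Complex.abs_re_le_norm _).trans ((norm_add_le _ _).trans ?_)
  rw [norm_mul, norm_mul, Complex.norm_conj, Complex.norm_conj]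
  have e1 := mul_le_mul h1 hb (norm_nonneg _) (by positivity)
  have e2 := mul_le_mul ha' h2 (norm_nonneg _) ((norm_nonneg _).trans ha')
  linarith

/-- The derivatives of the gauge enter the bound. The gauge is periodic only up to phases, so these
need not be bounded on the plane; the bound is applied on a compact fundamental domain. -/
theorem ChernGauge.norm_fderiv_gaugeElt_le (g : ChernGauge B) {A : ℂ → (Hp →L[ℂ] Hp)}
    (hA : ContDiff ℝ ∞ A) (a c : Fin 2) (k : ℂ) {δ : ℝ} (h0 : ‖A k‖ ≤ δ)
    (h1 : ‖fderiv ℝ A k‖ ≤ δ) :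
    ‖fderiv ℝ (gaugeElt g A a c) k‖ ≤ δ * (1 + ‖fderiv ℝ (fun k => g.u k a) k‖ +
      ‖fderiv ℝ (fun k => g.u k c) k‖) := by
  have hδ : 0 ≤ δ := (norm_nonneg _).trans h0
  have ha := ((g.smooth a).differentiable (by simp) k).hasFDerivAt
  have hc := ((g.smooth c).differentiable (by simp) k).hasFDerivAt
  have hAk := (hA.differentiable (by simp) k).hasFDerivAt
  set R := ContinuousLinearMap.restrictScalarsL ℂ Hp Hp ℝ ℝ
  have hR : HasFDerivAt (fun k => R (A k)) (R.comp (fderiv ℝ A k)) k := R.hasFDerivAt.comp k hAk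
  have hAc : HasFDerivAt (fun k => A k (g.u k c)) _ k := hR.clm_apply hc
  have hin := ha.inner ℂ hAc
  refine ContinuousLinearMap.opNorm_le_bound _ (by positivity) fun v => ?_
  rw [show fderiv ℝ (gaugeElt g A a c) k = _ from hin.fderiv]
  have hval : (A k) ((fderiv ℝ (fun k => g.u k c) k) v) + (fderiv ℝ A k v) (g.u k c) =
      ((R (A k)).comp (fderiv ℝ (fun k => g.u k c) k) +
        (R.comp (fderiv ℝ A k)).flip (g.u k c)) v := rfl
  have hn1 : ‖(A k) ((fderiv ℝ (fun k => g.u k c) k) v)‖ ≤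
      δ * (‖fderiv ℝ (fun k => g.u k c) k‖ * ‖v‖) :=
    ((A k).le_opNorm _).trans (mul_le_mul h0 (ContinuousLinearMap.le_opNorm _ _)
      (norm_nonneg _) hδ)
  have hn2 : ‖(fderiv ℝ A k v) (g.u k c)‖ ≤ δ * ‖v‖ := by
    refine (ContinuousLinearMap.le_opNorm _ _).trans ?_
    rw [g.norm_u, mul_one]
    exact (ContinuousLinearMap.le_opNorm _ _).trans
      (mul_le_mul_of_nonneg_right h1 (norm_nonneg _))
  have hn3 : ‖A k (g.u k c)‖ ≤ δ := by
    refine ((A k).le_opNorm _).trans ?_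
    rw [g.norm_u, mul_one]; exact h0
  simp only [ContinuousLinearMap.comp_apply, ContinuousLinearMap.prod_apply,
    fderivInnerCLM_apply]
  rw [← hval]
  refine (norm_add_le _ _).trans ?_
  have e1 := norm_inner_le_norm (𝕜 := ℂ) (g.u k a)
    ((A k) ((fderiv ℝ (fun k => g.u k c) k) v) + (fderiv ℝ A k v) (g.u k c))
  have e2 := norm_inner_le_norm (𝕜 := ℂ) (fderiv ℝ (fun k => g.u k a) k v) (A k (g.u k c))
  rw [g.norm_u, one_mul] at e1
  have e3 := norm_add_le ((A k) ((fderiv ℝ (fun k => g.u k c) k) v))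
    ((fderiv ℝ A k v) (g.u k c))
  have e4 := mul_le_mul (ContinuousLinearMap.le_opNorm (fderiv ℝ (fun k => g.u k a) k) v) hn3
    (norm_nonneg _) (by positivity)
  linarith

theorem norm_fderiv_pairOp_le {D : ℂ → (Hm →L[ℂ] Hp)} (hD : ContDiff ℝ ∞ D) (k : ℂ) :
    ‖fderiv ℝ (pairOp C2 D) k‖ ≤ ‖fderiv ℝ D k‖ := by
  set L : (Hm →L[ℂ] Hp) →L[ℝ] (Hp →L[ℂ] Hp) := ((ContinuousLinearMap.compL ℂ Hp Hm Hp).flip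
    (C2.toContinuousLinearEquiv : Hp →L[ℂ] Hm)).restrictScalars ℝ with hL
  have hL1 : ∀ A, ‖L A‖ ≤ ‖A‖ := fun A => norm_pairOp_le (C2 := C2) (fun _ => A) 0
  have h : HasFDerivAt (pairOp C2 D) (L.comp (fderiv ℝ D k)) k :=
    L.hasFDerivAt.comp k (hD.differentiable (by simp) k).hasFDerivAt
  rw [h.fderiv]
  refine ContinuousLinearMap.opNorm_le_bound _ (ContinuousLinearMap.opNorm_nonneg _) fun v => ?_
  exact (hL1 _).trans (ContinuousLinearMap.le_opNorm _ _)

theorem CloseTo.deriv_bounds {δ : ℝ} {x y : MeanField Hp Hm} (h : CloseTo 1 δ x y)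
    (hx : ContDiff ℝ ∞ x.Ph) (hy : ContDiff ℝ ∞ y.Ph)
    (hx' : ContDiff ℝ ∞ x.Ppar) (hy' : ContDiff ℝ ∞ y.Ppar) (k : ℂ) :
    ‖fderiv ℝ (fFun g x.Ph) k - fderiv ℝ (fFun g y.Ph) k‖ ≤
      δ * (1 + ‖fderiv ℝ (fun k => g.u k 1) k‖ + ‖fderiv ℝ (fun k => g.u k 0) k‖) ∧
    ‖fderiv ℝ (dFun C2 g x.Ppar) k - fderiv ℝ (dFun C2 g y.Ppar) k‖ ≤
      δ * (1 + ‖fderiv ℝ (fun k => g.u k 1) k‖ + ‖fderiv ℝ (fun k => g.u k 0) k‖) := by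
  obtain ⟨a1, a2⟩ := h.2 0 (by norm_num) k
  obtain ⟨b1, b2⟩ := h.2 1 le_rfl k
  rw [norm_iteratedFDeriv_zero] at a1 a2
  rw [norm_iteratedFDeriv_one] at b1 b2
  have hdiff : ∀ {F : Type _} [NormedAddCommGroup F] [NormedSpace ℝ F] {q : ℂ → F},
      ContDiff ℝ ∞ q → DifferentiableAt ℝ q k := fun hq => hq.differentiable (by simp) k
  constructor
  · rw [← fderiv_sub (hdiff (contDiff_fFun hx)) (hdiff (contDiff_fFun hy))]
    have e : fFun g x.Ph - fFun g y.Ph = gaugeElt g (fun q => x.Ph q - y.Ph q) 1 0 := by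
      funext q; exact (gaugeElt_sub x.Ph y.Ph 1 0 q).symm
    rw [e]
    exact g.norm_fderiv_gaugeElt_le (hx.sub hy) 1 0 k a1.le b1.le
  · rw [← fderiv_sub (hdiff (contDiff_dFun hx')) (hdiff (contDiff_dFun hy'))]
    have e : dFun C2 g x.Ppar - dFun C2 g y.Ppar =
        gaugeElt g (pairOp C2 (fun q => x.Ppar q - y.Ppar q)) 1 0 := by
      rw [pairOp_sub, dFun_eq, dFun_eq]
      funext q; exact (gaugeElt_sub _ _ 1 0 q).symm
    rw [e]
    exact g.norm_fderiv_gaugeElt_le (IsPairing.contDiff_pairOp (hx'.sub hy')) 1 0 k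
      ((norm_pairOp_le (C2 := C2) (fun q => x.Ppar q - y.Ppar q) k).trans a2.le)
      ((norm_fderiv_pairOp_le (hx'.sub hy') k).trans b2.le)

theorem fderiv_reProd {x : MeanField Hp Hm} (h : ContDiff ℝ ∞ x.Ph) (h' : ContDiff ℝ ∞ x.Ppar)
    (k v : ℂ) : fderiv ℝ (reProd C2 g x) k v =
      (fderiv ℝ (fFun g x.Ph) k v * conj (dFun C2 g x.Ppar k)).re +
      (fFun g x.Ph k * conj (fderiv ℝ (dFun C2 g x.Ppar) k v)).re := by
  have h1 := ((contDiff_fFun (g := g) h).differentiable (by simp) k).hasFDerivAt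
  have h2 := ((contDiff_dFun (C2 := C2) (g := g) h').differentiable (by simp) k).hasFDerivAt
  have h3 : HasFDerivAt (fun k => conj (dFun C2 g x.Ppar k)) _ k :=
    (Complex.conjCLE : ℂ →L[ℝ] ℂ).hasFDerivAt.comp k h2
  have h4 : HasFDerivAt (reProd C2 g x) _ k := Complex.reCLM.hasFDerivAt.comp k (h1.fun_mul h3)
  rw [h4.fderiv]
  simp
  ring

theorem reProd_periodic {x : MeanField Hp Hm} (hx : Admissible C2 g x) :
    ∀ G ∈ recipLattice B.b, ∀ k, reProd C2 g x (k + G) = reProd C2 g x k := by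
  intro G hG k
  obtain ⟨c, hc, hd, hf⟩ := section_cocycle (C2 := C2) (g := g) hx.band hx.pairing G hG k
  have hcc : c * conj c = 1 := by
    rw [Complex.mul_conj, Complex.normSq_eq_norm_sq, hc]; simp
  simp only [reProd, hd, hf, map_mul]
  congr 1
  linear_combination fFun g x.Ph k * conj (dFun C2 g x.Ppar k) * hcc

theorem fderiv_reProd_periodic {x : MeanField Hp Hm} (hx : Admissible C2 g x) :
    ∀ G ∈ recipLattice B.b, ∀ k, fderiv ℝ (reProd C2 g x) (k + G) =
      fderiv ℝ (reProd C2 g x) k := by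
  intro G hG k
  rw [← fderiv_comp_add_right]
  congr 1
  funext q
  exact reProd_periodic hx G hG q

/-- The positive function that measures regularity of `Σ` where `|d_∥| ≥ ε`. -/
def pathFun (C2 : Hp ≃ₗᵢ[ℂ] Hm) (g : ChernGauge B) (ε : ℝ) (x : MeanField Hp Hm) (k : ℂ) : ℝ :=
  max (max |reProd C2 g x k| (‖dFun C2 g x.Ppar k‖ - ‖fFun g x.Ph k‖))
    (max (ε - ‖dFun C2 g x.Ppar k‖) ‖fderiv ℝ (reProd C2 g x) k‖)

theorem pathFun_pos_iff {ε : ℝ} {x : MeanField Hp Hm} {k : ℂ} : 0 < pathFun C2 g ε x k ↔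
    (reProd C2 g x k = 0 → ‖dFun C2 g x.Ppar k‖ ≤ ‖fFun g x.Ph k‖ → ε ≤ ‖dFun C2 g x.Ppar k‖ →
      fderiv ℝ (reProd C2 g x) k ≠ 0) := by
  rw [pathFun, lt_max_iff, lt_max_iff, lt_max_iff, abs_pos, sub_pos, sub_pos, norm_pos_iff,
    ← not_le, ← not_le]
  tauto

theorem continuous_pathFun {x : MeanField Hp Hm} (hx : Admissible C2 g x) (ε : ℝ) :
    Continuous (pathFun C2 g ε x) := by
  have h1 := (contDiff_reProd (C2 := C2) (g := g) hx.band.smooth hx.pairing.smooth)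
  have h2 := (contDiff_dFun (C2 := C2) (g := g) hx.pairing.smooth).continuous
  have h3 := (contDiff_fFun (g := g) hx.band.smooth).continuous
  have h4 := h1.continuous_fderiv (by simp)
  have h5 := h1.continuous
  unfold pathFun
  fun_prop

theorem pathFun_periodic {x : MeanField Hp Hm} (hx : Admissible C2 g x) (ε : ℝ) :
    ∀ G ∈ recipLattice B.b, ∀ k, pathFun C2 g ε x (k + G) = pathFun C2 g ε x k := by
  intro G hG k
  simp only [pathFun, reProd_periodic hx G hG, fderiv_reProd_periodic hx G hG,
    norm_dFun_periodic hx.pairing G hG, norm_fFun_periodic hx.band G hG]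

/-- `pathFun` is periodic and depends only on values and first derivatives of `f` and `d`, so its
positive minimum over the Brillouin zone survives perturbations that are small in `C¹`. -/
theorem relOpen_pathFun_pos (ε : ℝ) :
    RelOpen {x | Admissible C2 g x} {x | ∀ k, 0 < pathFun C2 g ε x k} := by
  rintro x ⟨hx, hpos⟩
  have hx : Admissible C2 g x := hx
  obtain ⟨c, hc, hcle⟩ := exists_pos_forall_le_of_periodic B.b_ne (continuous_pathFun hx ε)
    (pathFun_periodic hx ε) hpos
  -- bounds on a fundamental domain
  set S := Metric.closedBall (0 : ℂ) (2 * ‖B.b‖)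
  have hS : IsCompact S := isCompact_closedBall _ _
  have hfs := contDiff_fFun (g := g) hx.band.smooth
  have hds := contDiff_dFun (C2 := C2) (g := g) hx.pairing.smooth
  have hbd : ∀ {F : ℂ → ℝ}, Continuous F → ∃ M, ∀ k ∈ S, F k ≤ M := fun hF => by
    obtain ⟨M, hM⟩ := hS.bddAbove_image hF.continuousOn
    exact ⟨M, fun k hk => hM ⟨k, hk, rfl⟩⟩
  have cf' := (hfs.continuous_fderiv (by simp)).norm
  have cd' := (hds.continuous_fderiv (by simp)).norm
  have cu0 := ((g.smooth 0).continuous_fderiv (by simp)).norm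
  have cu1 := ((g.smooth 1).continuous_fderiv (by simp)).norm
  obtain ⟨M, hM⟩ := hbd (F := fun k => ‖fFun g x.Ph k‖ + ‖dFun C2 g x.Ppar k‖ +
    ‖fderiv ℝ (fFun g x.Ph) k‖ + ‖fderiv ℝ (dFun C2 g x.Ppar) k‖ + 1)
    ((((hfs.continuous.norm.add hds.continuous.norm).add cf').add cd').add continuous_const)
  obtain ⟨m, hm⟩ := hbd (F := fun k => 1 + ‖fderiv ℝ (fun k => g.u k 1) k‖ +
    ‖fderiv ℝ (fun k => g.u k 0) k‖) ((continuous_const.add cu1).add cu0)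
  have h0S : (0 : ℂ) ∈ S := Metric.mem_closedBall_self (by positivity)
  have hm1 : 1 ≤ m := by
    refine le_trans ?_ (hm 0 h0S)
    linarith [norm_nonneg (fderiv ℝ (fun k => g.u k 1) 0),
      norm_nonneg (fderiv ℝ (fun k => g.u k 0) 0)]
  have hM1 : 1 ≤ M := by
    refine le_trans ?_ (hM 0 h0S)
    have h1 := norm_nonneg (fFun g x.Ph 0)
    have h2 := norm_nonneg (dFun C2 g x.Ppar 0)
    have h3 := norm_nonneg (fderiv ℝ (fFun g x.Ph) 0)
    have h4 := norm_nonneg (fderiv ℝ (dFun C2 g x.Ppar) 0)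
    linarith
  -- the tolerance
  set η := min 1 (c / (4 * (2 * M + 1))) with hη
  have hη0 : 0 < η := by positivity
  have hη1 : η ≤ 1 := min_le_left _ _
  have hη2 : 2 * (η * (2 * M + η)) < c := by
    have h1 : η * (4 * (2 * M + 1)) ≤ c := by
      rw [← le_div_iff₀ (by positivity)]; exact min_le_right _ _
    have h2 : η * (2 * M + η) ≤ η * (2 * M + 1) :=
      mul_le_mul_of_nonneg_left (by linarith) hη0.le
    linarith
  -- Division by `m` absorbs the derivatives of the gauge on the fundamental domain.
  refine ⟨1, η / m, by positivity, fun y hy hclose k => ?_⟩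
  have hy : Admissible C2 g y := hy
  obtain ⟨G, hG, hkS⟩ := exists_mem_closedBall_sub_mem B.b_ne k
  rw [← pathFun_periodic hy ε G hG k]
  set z := k + G
  have hMz := hM z hkS
  have hmz := hm z hkS
  have n1 := norm_nonneg (fFun g x.Ph z)
  have n2 := norm_nonneg (dFun C2 g x.Ppar z)
  have n3 := norm_nonneg (fderiv ℝ (fFun g x.Ph) z)
  have n4 := norm_nonneg (fderiv ℝ (dFun C2 g x.Ppar) z)
  have hδη : η / m ≤ η := div_le_self hη0.le hm1
  obtain ⟨bf, -, bd⟩ := hclose.bounds (g := g) (C2 := C2) z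
  obtain ⟨bf', bd'⟩ := hclose.deriv_bounds (g := g) (C2 := C2) hx.band.smooth hy.band.smooth
    hx.pairing.smooth hy.pairing.smooth z
  have hδm : η / m * (1 + ‖fderiv ℝ (fun k => g.u k 1) z‖ +
      ‖fderiv ℝ (fun k => g.u k 0) z‖) ≤ η := by
    refine (mul_le_mul_of_nonneg_left hmz (by positivity)).trans ?_
    rw [div_mul_cancel₀ _ (by positivity)]
  have hψ : |reProd C2 g x z - reProd C2 g y z| ≤ η * (2 * M + η) := by
    have := abs_re_mul_conj_sub_le (t := 1) (M := M) (η := η) zero_le_one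
      (a := fFun g x.Ph z) (a' := fFun g y.Ph z) (b := dFun C2 g x.Ppar z)
      (b' := dFun C2 g y.Ppar z) (by linarith) (by linarith) (by linarith) (by linarith)
    rw [mul_one] at this
    exact this
  have hDψ : ‖fderiv ℝ (reProd C2 g x) z - fderiv ℝ (reProd C2 g y) z‖ ≤
      2 * (η * (2 * M + η)) := by
    refine ContinuousLinearMap.opNorm_le_bound _ (by positivity) fun v => ?_
    have hv := norm_nonneg v
    have lin : ∀ {L L' : ℂ →L[ℝ] ℂ}, ‖L - L'‖ ≤ η → ‖L v - L' v‖ ≤ η * ‖v‖ := fun hL =>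
      (ContinuousLinearMap.le_opNorm (_ - _) v).trans (mul_le_mul_of_nonneg_right hL hv)
    have lin' : ∀ {L : ℂ →L[ℝ] ℂ}, ‖L‖ ≤ M → ‖L v‖ ≤ M * ‖v‖ := fun hL =>
      (ContinuousLinearMap.le_opNorm _ v).trans (mul_le_mul_of_nonneg_right hL hv)
    rw [sub_apply, fderiv_reProd hx.band.smooth hx.pairing.smooth,
      fderiv_reProd hy.band.smooth hy.pairing.smooth, Real.norm_eq_abs]
    have s1 := abs_re_mul_conj_sub_le (t := ‖v‖) (M := M) (η := η) hv
      (lin (bf'.trans hδm)) (b := dFun C2 g x.Ppar z) (b' := dFun C2 g y.Ppar z)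
      (by linarith) (lin' (by linarith)) (by linarith)
    have s2 := abs_re_mul_conj_sub_le (t := ‖v‖) (M := M) (η := η) hv
      (lin (bd'.trans hδm)) (b := fFun g x.Ph z) (b' := fFun g y.Ph z)
      (by linarith) (lin' (by linarith)) (by linarith)
    have sw : ∀ p q : ℂ, (p * conj q).re = (q * conj p).re := fun p q => by
      simp [Complex.mul_re]; ring
    rw [sw, sw (fderiv ℝ (dFun C2 g y.Ppar) z v)] at s2
    rw [abs_le] at s1 s2 ⊢
    constructor <;> linarith [s1.1, s1.2, s2.1, s2.2]
  -- the function changes by less than its lower bound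
  have hxz := hcle z
  rw [pathFun, le_max_iff, le_max_iff, le_max_iff] at hxz
  rw [pathFun, lt_max_iff, lt_max_iff, lt_max_iff]
  have hηc : 2 * η < c := by nlinarith
  have tf := abs_le.1 (abs_norm_sub_norm_le (fFun g x.Ph z) (fFun g y.Ph z))
  have td := abs_le.1 (abs_norm_sub_norm_le (dFun C2 g x.Ppar z) (dFun C2 g y.Ppar z))
  rcases hxz with (h | h) | (h | h)
  · left; left
    have := abs_sub_abs_le_abs_sub (reProd C2 g x z) (reProd C2 g y z)
    have : 0 ≤ η * (2 * M + η) := by positivity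
    linarith
  · left; right; linarith [tf.1, tf.2, td.1, td.2]
  · right; left; linarith [td.1, td.2]
  · right; right
    have := norm_sub_norm_le (fderiv ℝ (reProd C2 g x) z) (fderiv ℝ (reProd C2 g y) z)
    linarith

/-- Regularity may degenerate towards the zeros of `d`, so a uniform bound is available only where
`|d| ≥ ε`. Exhausting by `ε = 1/(n+1)` exhibits the condition as a countable intersection of open
ones. -/
theorem pathRegular_iff {x : MeanField Hp Hm} :
    PathRegular C2 g x ↔ ∀ n : ℕ, ∀ k, 0 < pathFun C2 g (1 / (n + 1)) x k := by
  simp only [pathFun_pos_iff]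
  constructor
  · intro h n k h0 hle hn
    refine h k h0 hle (norm_pos_iff.1 (lt_of_lt_of_le (by positivity) hn))
  · intro h k h0 hle hd
    obtain ⟨n, hn⟩ := exists_nat_one_div_lt (norm_pos_iff.2 hd)
    exact h n k h0 hle hn.le

end

end

noncomputable section

/-! ### Paths in closed planar sets -/

/-- Near `z`, all points of `Z` are joined to `z` by short paths in `Z`. -/
def LocallyJoined (Z : Set ℂ) (z : ℂ) : Prop :=
  ∀ ε > 0, ∃ η > 0, ∀ y ∈ Z, dist y z < η → JoinedIn (Z ∩ Metric.ball z ε) z y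

theorem JoinedIn.exists_path {F : Set ℂ} {x y : ℂ} (h : JoinedIn F x y) :
    ∃ γ : ℝ → ℂ, Continuous γ ∧ (∀ t ≤ 0, γ t = x) ∧ (∀ t, 1 ≤ t → γ t = y) ∧ ∀ t, γ t ∈ F := by
  obtain ⟨γ, hγ⟩ := h
  refine ⟨γ.extend, γ.continuous_extend, fun t ht => γ.extend_of_le_zero ht,
    fun t ht => γ.extend_of_one_le ht, fun t => ?_⟩
  have : γ.extend t ∈ Set.range γ.extend := ⟨t, rfl⟩
  rw [Path.extend_range] at this
  obtain ⟨s, hs⟩ := this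
  rw [← hs]; exact hγ s

theorem joinedIn_of_path {F : Set ℂ} {γ : ℝ → ℂ} (hγ : Continuous γ) {a c : ℝ} (hac : a ≤ c)
    (h : ∀ t ∈ Set.Icc a c, γ t ∈ F) : JoinedIn F (γ a) (γ c) := by
  refine JoinedIn.ofLine (f := fun t => γ (a + t * (c - a))) (by fun_prop) (by simp) (by simp) ?_
  rintro _ ⟨t, ht, rfl⟩
  refine h _ ⟨?_, ?_⟩
  · nlinarith [ht.1]
  · nlinarith [ht.2]

theorem JoinedIn.add_right {F : Set ℂ} {x y : ℂ} (h : JoinedIn F x y) {G : ℂ}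
    (hF : ∀ z ∈ F, z + G ∈ F) : JoinedIn F (x + G) (y + G) :=
  (h.map (f := fun z => z + G) (by fun_prop)).mono (by rintro _ ⟨z, hz, rfl⟩; exact hF z hz)

/-- A path that enters a disc has a last crossing with its boundary circle. -/
theorem JoinedIn.exists_last_crossing {F : Set ℂ} {y x p : ℂ} {σ : ℝ} (h : JoinedIn F y x)
    (hy : σ ≤ dist y p) (hx : dist x p < σ) :
    ∃ w, dist w p = σ ∧ JoinedIn F y w ∧ JoinedIn (F ∩ Metric.closedBall p σ) w x := by
  obtain ⟨γ, hγ, h0, h1, hF⟩ := h.exists_path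
  have hc : Continuous fun t => dist (γ t) p := by fun_prop
  set T := {t | σ ≤ dist (γ t) p} ∩ Set.Icc (0 : ℝ) 1
  have hT : IsCompact T := isCompact_Icc.inter_left (isClosed_le continuous_const hc)
  obtain ⟨t₀, ⟨ht₀, ht01⟩, hmax⟩ := hT.exists_isGreatest ⟨0, by
    change σ ≤ dist (γ 0) p; rw [h0 0 le_rfl]; exact hy, by simp⟩
  have hafter : ∀ t ∈ Set.Icc t₀ 1, dist (γ t) p ≤ σ := by
    by_contra! hcon
    obtain ⟨t, ht, hσ⟩ := hcon
    have hiv := intermediate_value_Icc' ht.2 hc.continuousOn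
    have hmem : σ ∈ Set.Icc (dist (γ 1) p) (dist (γ t) p) := ⟨by rw [h1 1 le_rfl]; exact hx.le, hσ.le⟩
    obtain ⟨s, hs, hsσ⟩ := hiv hmem
    have hle : s ≤ t₀ := hmax ⟨hsσ.ge, ht01.1.trans (ht.1.trans hs.1), hs.2⟩
    have : t = s := le_antisymm hs.1 (hle.trans ht.1)
    rw [this] at hσ
    exact hσ.ne' hsσ
  refine ⟨γ t₀, le_antisymm (hafter t₀ ⟨le_rfl, ht01.2⟩) ht₀, ?_, ?_⟩
  · have := joinedIn_of_path hγ ht01.1 (F := F) fun t _ => hF t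
    rwa [h0 0 le_rfl] at this
  · have := joinedIn_of_path hγ ht01.2 (F := F ∩ Metric.closedBall p σ)
      fun t ht => ⟨hF t, hafter t ht⟩
    rwa [h1 1 le_rfl] at this

/-- Infinite concatenation of paths that shrink to a point. -/
theorem joinedIn_of_seq {Z : Set ℂ} {p : ℂ} (hp : p ∈ Z) {ρ : ℝ} {w : ℕ → ℂ}
    (h : ∀ n, JoinedIn (Z ∩ Metric.ball p (ρ / 2 ^ n)) (w n) (w (n + 1))) : JoinedIn Z (w 0) p := by
  choose γ hγ h0 h1 hF using fun n => (h n).exists_path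
  have hρ : ∀ n t, dist (γ n t) p < ρ * (1 / 2) ^ n := fun n t => by
    have := (hF n t).2
    rw [Metric.mem_ball] at this
    rwa [div_eq_mul_inv, ← inv_pow, inv_eq_one_div] at this
  have hwn : ∀ n, dist (w n) p < ρ * (1 / 2) ^ n := fun n => by
    have := hρ n 0
    rwa [h0 n 0 le_rfl] at this
  -- The `n`-th path is run through for `1 - t` between `2⁻ⁿ` and `2⁻⁽ⁿ⁺¹⁾` and is constant
  -- otherwise. Writing the concatenation as a series of increments makes its continuity, also at `t
  -- = 1`, a case of uniform summability.
  set φ : ℕ → ℝ → ℝ := fun n t => 2 - 2 ^ (n + 1) * (1 - t) with hφ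
  set e : ℕ → ℝ → ℂ := fun n t => γ n (φ n t) - w n with he
  have hsum : Summable fun n : ℕ => 2 * ρ * (1 / 2 : ℝ) ^ n :=
    (summable_geometric_of_lt_one (by norm_num) (by norm_num)).mul_left _
  have hbound : ∀ n t, ‖e n t‖ ≤ 2 * ρ * (1 / 2 : ℝ) ^ n := fun n t => by
    have e1 := hρ n (φ n t)
    have e2 := hwn n
    have e3 := dist_triangle_right (γ n (φ n t)) (w n) p
    rw [dist_eq_norm (γ n (φ n t)) (w n)] at e3
    simp only [he]
    linarith
  set Γ : ℝ → ℂ := fun t => w 0 + ∑' n, e n t with hΓ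
  have hΓc : Continuous Γ := by
    refine continuous_const.add (continuous_tsum (fun n => ?_) hsum hbound)
    have := hγ n
    simp only [he, hφ]
    fun_prop
  have hfin : ∀ (n : ℕ) (t : ℝ), (∀ m < n, 1 ≤ φ m t) → (∀ m, n < m → φ m t ≤ 0) →
      Γ t = γ n (φ n t) := by
    intro n t hlt hgt
    have hz : ∀ m ∉ Finset.range (n + 1), e m t = 0 := by
      intro m hm
      have : n < m := by simpa [Nat.lt_succ_iff] using hm
      simp only [he]
      rw [h0 m _ (hgt m this), sub_self]
    simp only [hΓ]
    rw [tsum_eq_sum hz, Finset.sum_range_succ]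
    have hs : ∑ m ∈ Finset.range n, e m t = w n - w 0 := by
      rw [← Finset.sum_range_sub w n]
      refine Finset.sum_congr rfl fun m hm => ?_
      simp only [he]
      rw [h1 m _ (hlt m (Finset.mem_range.1 hm))]
    rw [hs]
    simp only [he]
    ring
  have hΓ0 : Γ 0 = w 0 := by
    rw [hfin 0 0 (fun m hm => absurd hm (Nat.not_lt_zero m)) (fun m hm => ?_), h0 0]
    · simp [hφ]
    · have : (2 : ℝ) ^ 1 ≤ 2 ^ (m + 1) := pow_le_pow_right₀ (by norm_num) (by omega)
      simp only [hφ]; linarith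
  have hmem : ∀ t < 1, Γ t ∈ Z := by
    intro t ht
    have hex : ∃ n : ℕ, φ n t ≤ 1 := by
      obtain ⟨n, hn⟩ := pow_unbounded_of_one_lt (1 / (1 - t)) (by norm_num : (1 : ℝ) < 2)
      refine ⟨n, ?_⟩
      have h1t : 0 < 1 - t := by linarith
      rw [div_lt_iff₀ h1t] at hn
      simp only [hφ]
      rw [pow_succ]
      nlinarith
    classical
    rw [hfin (Nat.find hex) t (fun m hm => (not_le.1 (Nat.find_min hex hm)).le) (fun m hm => ?_)]
    · exact (hF _ _).1
    · have h2 := Nat.find_spec hex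
      set n := Nat.find hex
      have h3 : (2 : ℝ) ^ (n + 2) ≤ 2 ^ (m + 1) := pow_le_pow_right₀ (by norm_num) (by omega)
      have h4 : (2 : ℝ) ^ (n + 2) = 2 * 2 ^ (n + 1) := by ring
      simp only [hφ] at h2 ⊢
      nlinarith
  have hΓ1 : Γ 1 = p := by
    have hw : Filter.Tendsto w Filter.atTop (𝓝 p) := by
      rw [tendsto_iff_dist_tendsto_zero]
      refine squeeze_zero (fun _ => dist_nonneg) (fun n => (hwn n).le) ?_
      have := (tendsto_pow_atTop_nhds_zero_of_lt_one (by norm_num : (0 : ℝ) ≤ 1 / 2)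
        (by norm_num)).const_mul ρ
      simpa using this
    have he1 : ∀ n, e n 1 = w (n + 1) - w n := fun n => by
      simp only [he]
      rw [h1 n _ (by simp [hφ])]
    have hs : Summable fun n => e n 1 := Summable.of_norm_bounded hsum fun n => hbound n 1
    have ht := hs.hasSum.tendsto_sum_nat
    have ht' : Filter.Tendsto (fun n => ∑ i ∈ Finset.range n, e i 1) Filter.atTop
        (𝓝 (p - w 0)) := by
      have : (fun n => ∑ i ∈ Finset.range n, e i 1) = fun n => w n - w 0 := by
        funext n
        rw [← Finset.sum_range_sub w n]
        exact Finset.sum_congr rfl fun i _ => he1 i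
      rw [this]
      exact hw.sub_const _
    simp only [hΓ]
    rw [tendsto_nhds_unique ht ht']
    ring
  have := joinedIn_of_path hΓc zero_le_one (F := Z) fun t ht => by
    rcases ht.2.lt_or_eq with h | h
    · exact hmem t h
    · rw [h, hΓ1]; exact hp
  rwa [hΓ0, hΓ1] at this

/-- `y` can be joined in `Z` to points arbitrarily close to `p`, inside the disc of radius `τ`. -/
def Accesses (Z : Set ℂ) (p : ℂ) (τ : ℝ) (y : ℂ) : Prop :=
  ∀ ε > 0, ∃ x, dist x p < ε ∧ JoinedIn (Z ∩ Metric.ball p τ) y x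

/-- Paths that enter small discs around `p` from outside of a circle accumulate at a point of the
circle. -/
theorem exists_crossing_limit {Z : Set ℂ} {p : ℂ} {σ τ : ℝ} (hσ : 0 < σ)
    (hστ : σ < τ) {Y O : Set ℂ} (hO : Metric.ball p τ ⊆ O)
    (hgood : ∀ w ∈ closure {v | ∃ y ∈ Y, JoinedIn (Z ∩ O) y v}, dist w p = σ → LocallyJoined Z w)
    (hY : ∀ y ∈ Y, σ ≤ dist y p)
    (h : ∀ ε > 0, ∃ x, dist x p < ε ∧ ∃ y ∈ Y, JoinedIn (Z ∩ O) y x) :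
    ∃ w, dist w p = σ ∧ Accesses Z p τ w ∧ ∃ y ∈ Y, JoinedIn (Z ∩ O) y w := by
  choose! x hx y hyY hyx using h
  have hε : ∀ n : ℕ, 0 < σ / (n + 1) := fun n => by positivity
  have hεσ : ∀ n : ℕ, σ / (n + 1) ≤ σ := fun n => div_le_self hσ.le (by simp)
  choose w hwσ hyw hwx using fun n : ℕ => (hyx _ (hε n)).exists_last_crossing
    (hY _ (hyY _ (hε n))) ((hx _ (hε n)).trans_le (hεσ n))
  -- The last crossings accumulate on the circle. The limit point is good, so infinitely many
  -- crossings are joined to it by short paths; it inherits both the connection to `Y` and access to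
  -- points arbitrarily near `p`.
  have hK : IsCompact (Metric.sphere p σ) := isCompact_sphere p σ
  obtain ⟨v, hv, φ, hφ, hlim⟩ := hK.tendsto_subseq (x := w) fun n => hwσ n
  have hvcl : v ∈ closure {v | ∃ y ∈ Y, JoinedIn (Z ∩ O) y v} :=
    mem_closure_of_tendsto hlim (Filter.Eventually.of_forall fun n =>
      ⟨_, hyY _ (hε (φ n)), hyw (φ n)⟩)
  have hvσ : dist v p = σ := hv
  obtain ⟨η, hη, hjoin⟩ := hgood v hvcl hvσ (τ - σ) (by linarith)
  have hsub : Metric.ball v (τ - σ) ⊆ Metric.ball p τ := by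
    refine Metric.ball_subset_ball' ?_
    rw [hvσ]; linarith
  have hev := (Metric.tendsto_nhds.1 hlim η hη)
  have hjn : ∀ᶠ n in Filter.atTop, JoinedIn (Z ∩ Metric.ball p τ) v (w (φ n)) := by
    filter_upwards [hev] with n hn
    exact (hjoin _ (hyw (φ n)).target_mem.1 hn).mono (Set.inter_subset_inter_right _ hsub)
  refine ⟨v, hvσ, fun ε hε' => ?_, ?_⟩
  · have hsmall : ∀ᶠ n : ℕ in Filter.atTop, σ / ((φ n : ℕ) + 1 : ℝ) < ε := by
      have h1 : Filter.Tendsto (fun n : ℕ => σ / ((n : ℝ) + 1)) Filter.atTop (𝓝 0) := by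
        have := tendsto_one_div_add_atTop_nhds_zero_nat (𝕜 := ℝ)
        have := this.const_mul σ
        simpa [div_eq_mul_inv] using this
      exact (h1.comp hφ.tendsto_atTop).eventually_lt_const hε'
    obtain ⟨n, hn1, hn2⟩ := (hjn.and hsmall).exists
    refine ⟨_, (hx _ (hε (φ n))).trans hn2, hn1.trans ((hwx (φ n)).mono ?_)⟩
    exact fun q hq => ⟨hq.1.1, Metric.closedBall_subset_ball hστ hq.2⟩
  · obtain ⟨n, hn⟩ := hjn.exists
    exact ⟨_, hyY _ (hε (φ n)), (hyw (φ n)).trans (hn.symm.mono (Set.inter_subset_inter_right _ hO))⟩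

/-- A point that is joined to points arbitrarily close to an isolated singular point is joined to
the singular point. -/
theorem joinedIn_of_accesses {Z : Set ℂ} {p : ℂ} (hp : p ∈ Z) {ρ : ℝ}
    (hρ : 0 < ρ) {y : ℂ}
    (hgood : ∀ v ∈ closure {v | JoinedIn Z y v}, v ≠ p → dist v p < ρ → LocallyJoined Z v)
    (hacc : ∀ ε > 0, ∃ x, dist x p < ε ∧ JoinedIn Z y x) : JoinedIn Z y p := by
  -- One stage of the construction: from `z` with access to `p` inside `O`, a point `w` is reached
  -- which still has access to `p`, but inside the smaller disc of radius `τ`. Iterating over `ρ /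
  -- 2ⁿ` gives pieces that shrink to `p`.
  have step : ∀ (O : Set ℂ) (τ : ℝ) (z : ℂ), 0 < τ → τ ≤ ρ → Metric.ball p τ ⊆ O →
      JoinedIn Z y z → (∀ ε > 0, ∃ x, dist x p < ε ∧ JoinedIn (Z ∩ O) z x) →
      ∃ w, Accesses Z p τ w ∧ JoinedIn (Z ∩ O) z w := by
    intro O τ z hτ hτρ hO hyz hz
    have hzO : z ∈ Z ∩ O := by
      obtain ⟨x, -, hx⟩ := hz 1 one_pos
      exact hx.source_mem
    by_cases hzp : z = p
    · subst hzp
      refine ⟨z, fun ε hε => ⟨z, by simpa using hε, JoinedIn.refl ⟨hzO.1, by simpa using hτ⟩⟩,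
        JoinedIn.refl hzO⟩
    have hd : 0 < dist z p := dist_pos.2 hzp
    set σ := min τ (dist z p) / 2 with hσdef
    have hσ : 0 < σ := by positivity
    have hστ : σ < τ := by
      have := min_le_left τ (dist z p)
      have := lt_min hτ hd
      linarith
    have hσz : σ ≤ dist z p := by
      have := min_le_right τ (dist z p)
      have := lt_min hτ hd
      linarith
    obtain ⟨w, -, hw, y', hy', hyw⟩ := exists_crossing_limit hσ hστ (Y := {z}) hO
      (fun w hw hwσ => hgood w (closure_mono (fun v hv => by
          obtain ⟨q, rfl, hq⟩ := hv
          exact hyz.trans (hq.mono Set.inter_subset_left)) hw)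
        (dist_pos.1 (by rw [hwσ]; exact hσ)) (by rw [hwσ]; linarith))
      (by rintro _ rfl; exact hσz)
      (fun ε hε => by
        obtain ⟨x, hx, hj⟩ := hz ε hε
        exact ⟨x, hx, z, rfl, hj⟩)
    rw [Set.mem_singleton_iff.1 hy'] at hyw
    exact ⟨w, hw, hyw⟩
  have hyZ : y ∈ Z := by
    obtain ⟨x, -, hx⟩ := hacc 1 one_pos
    exact hx.source_mem
  obtain ⟨w₀, hw₀, hyw₀⟩ := step Set.univ ρ y hρ le_rfl (Set.subset_univ _) (JoinedIn.refl hyZ)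
    (by simpa using hacc)
  rw [Set.inter_univ] at hyw₀
  have hpos : ∀ n : ℕ, 0 < ρ / 2 ^ n := fun n => by positivity
  have step' : ∀ (n : ℕ) (z : ℂ), JoinedIn Z y z ∧ Accesses Z p (ρ / 2 ^ n) z →
      ∃ w, (JoinedIn Z y w ∧ Accesses Z p (ρ / 2 ^ (n + 1)) w) ∧
        JoinedIn (Z ∩ Metric.ball p (ρ / 2 ^ n)) z w := by
    rintro n z ⟨hyz, hz⟩
    have hle : ρ / 2 ^ (n + 1) ≤ ρ / 2 ^ n := by
      rw [pow_succ]
      exact div_le_div_of_nonneg_left hρ.le (by positivity) (by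
        have : (0 : ℝ) < 2 ^ n := by positivity
        linarith)
    obtain ⟨w, hw, hzw⟩ := step (Metric.ball p (ρ / 2 ^ n)) (ρ / 2 ^ (n + 1)) z (hpos _)
      (div_le_self hρ.le (one_le_pow₀ (by norm_num))) (Metric.ball_subset_ball hle) hyz hz
    exact ⟨w, ⟨hyz.trans (hzw.mono Set.inter_subset_left), hw⟩, hzw⟩
  choose! next hnext hjoin using step'
  set w : ℕ → ℂ := fun n => Nat.rec w₀ (fun n z => next n z) n with hw
  have hwP : ∀ n, JoinedIn Z y (w n) ∧ Accesses Z p (ρ / 2 ^ n) (w n) := by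
    intro n
    induction n with
    | zero => exact ⟨hyw₀, by simp only [pow_zero, div_one]; exact hw₀⟩
    | succ n ih => exact hnext n _ ih
  exact hyw₀.trans (joinedIn_of_seq (w := w) hp fun n => hjoin n _ (hwP n))

/-- A regular level set is locally path connected. -/
theorem locallyJoined_of_fderiv_ne_zero {ψ : ℂ → ℝ} (hψ : ContDiff ℝ 1 ψ) {z : ℂ} (hz : ψ z = 0)
    (hd : fderiv ℝ ψ z ≠ 0) : LocallyJoined {k | ψ k = 0} z := by
  have hs : HasStrictFDerivAt ψ (fderiv ℝ ψ z) z := hψ.contDiffAt.hasStrictFDerivAt (by simp)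
  have hr : (fderiv ℝ ψ z).range = ⊤ := by
    refine LinearMap.range_eq_top.2 (LinearMap.surjective ?_)
    intro h
    exact hd (ContinuousLinearMap.coe_injective h)
  set φ := hs.implicitToOpenPartialHomeomorph ψ _ hr with hφ
  have hzs : z ∈ φ.source := hs.mem_implicitToOpenPartialHomeomorph_source hr
  have hφz : φ z = (ψ z, 0) := hs.implicitToOpenPartialHomeomorph_self hr
  have hfst : ∀ k, (φ k).1 = ψ k := hs.implicitToOpenPartialHomeomorph_fst hr
  intro ε hε
  have hnt : φ.target ∩ φ.symm ⁻¹' Metric.ball z ε ∈ 𝓝 (φ z) := by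
    refine Filter.inter_mem (φ.open_target.mem_nhds (φ.map_source hzs)) ?_
    have hc := φ.continuousAt_symm (φ.map_source hzs)
    refine hc ?_
    rw [φ.left_inv hzs]
    exact Metric.ball_mem_nhds z hε
  obtain ⟨r, hr0, hball⟩ := Metric.mem_nhds_iff.1 hnt
  have hns : φ.source ∩ φ ⁻¹' Metric.ball (φ z) r ∈ 𝓝 z :=
    Filter.inter_mem (φ.open_source.mem_nhds hzs)
      ((φ.continuousAt hzs) (Metric.ball_mem_nhds _ hr0))
  obtain ⟨η, hη, hsub⟩ := Metric.mem_nhds_iff.1 hns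
  refine ⟨η, hη, fun y hy hyz => ?_⟩
  obtain ⟨hys, hyb⟩ := hsub hyz
  have hy0 : ψ y = 0 := hy
  -- In the chart of the implicit function theorem the first coordinate is `ψ`, so the segment
  -- between two points of the level set stays in it.
  have hseg : ∀ t ∈ Set.Icc (0 : ℝ) 1, φ z + t • (φ y - φ z) ∈ Metric.ball (φ z) r := by
    intro t ht
    have hyb' : dist (φ y) (φ z) < r := hyb
    rw [dist_eq_norm] at hyb'
    rw [Metric.mem_ball, dist_eq_norm, add_sub_cancel_left, norm_smul, Real.norm_eq_abs,
      abs_of_nonneg ht.1]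
    exact (mul_le_of_le_one_left (norm_nonneg _) ht.2).trans_lt hyb'
  refine JoinedIn.ofLine (f := fun t => φ.symm (φ z + t • (φ y - φ z))) ?_ ?_ ?_ ?_
  · refine φ.continuousOn_symm.comp (by fun_prop) fun t ht => (hball (hseg t ht)).1
  · simp [φ.left_inv hzs]
  · simp [φ.left_inv hys]
  · rintro _ ⟨t, ht, rfl⟩
    obtain ⟨h1, h2⟩ := hball (hseg t ht)
    refine ⟨?_, h2⟩
    change ψ _ = 0
    rw [← hfst, φ.right_inv h1]
    simp [hfst, hz, hy0]

end

/-! ### Joining Γ_M to the region `|d| ≥ |f|` -/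

noncomputable section

set_option linter.unusedSectionVars false

/-- Two elements of a coset differ by a lattice vector, so at most one has norm below half the
minimal distance. If there is such an element and it is not zero, its norm is the bound. -/
theorem exists_pos_forall_le_norm_add {b : ℂ} (hb : b ≠ 0) (c : ℂ) :
    ∃ ρ > 0, ∀ G ∈ recipLattice b, c + G ≠ 0 → ρ ≤ ‖c + G‖ := by
  obtain ⟨r, hr, hdisc⟩ := exists_pos_forall_norm_lt_eq_zero hb
  by_cases h : ∃ G₀ ∈ recipLattice b, c + G₀ ≠ 0 ∧ ‖c + G₀‖ < r / 2
  · obtain ⟨G₀, hG₀, hne, hlt⟩ := h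
    refine ⟨‖c + G₀‖, norm_pos_iff.2 hne, fun G hG _ => ?_⟩
    by_contra! hcon
    have h1 : ‖G - G₀‖ < r := by
      rw [show G - G₀ = (c + G) - (c + G₀) by ring]
      exact (norm_sub_le _ _).trans_lt (by linarith)
    have h2 := sub_eq_zero.1 (hdisc _ (sub_mem hG hG₀) h1)
    rw [h2] at hcon
    exact lt_irrefl _ hcon
  · push Not at h
    exact ⟨r / 2, half_pos hr, fun G hG hne => h G hG hne⟩

theorem exists_pos_forall_le_dist {b : ℂ} (hb : b ≠ 0) (p p' : ℂ) :
    ∃ ρ > 0, ∀ z z' : ℂ, (z - p ∈ recipLattice b ∨ z - p' ∈ recipLattice b) →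
      (z' - p ∈ recipLattice b ∨ z' - p' ∈ recipLattice b) → z ≠ z' → ρ ≤ dist z z' := by
  obtain ⟨ρ₀, h₀, H₀⟩ := exists_pos_forall_le_norm_add hb 0
  obtain ⟨ρ₁, h₁, H₁⟩ := exists_pos_forall_le_norm_add hb (p - p')
  obtain ⟨ρ₂, h₂, H₂⟩ := exists_pos_forall_le_norm_add hb (p' - p)
  refine ⟨min ρ₀ (min ρ₁ ρ₂), by positivity, fun z z' hz hz' hne => ?_⟩
  have hne' := sub_ne_zero.2 hne
  rw [dist_eq_norm]
  rcases hz with hz | hz <;> rcases hz' with hz' | hz'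
  · have e : z - z' = 0 + ((z - p) - (z' - p)) := by ring
    have := H₀ _ (sub_mem hz hz') (by rwa [← e])
    rw [← e] at this
    exact (min_le_left _ _).trans this
  · have e : z - z' = (p - p') + ((z - p) - (z' - p')) := by ring
    have := H₁ _ (sub_mem hz hz') (by rwa [← e])
    rw [← e] at this
    exact (min_le_right _ _).trans ((min_le_left _ _).trans this)
  · have e : z - z' = (p' - p) + ((z - p') - (z' - p)) := by ring
    have := H₂ _ (sub_mem hz hz') (by rwa [← e])
    rw [← e] at this
    exact (min_le_right _ _).trans ((min_le_right _ _).trans this)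
  · have e : z - z' = 0 + ((z - p') - (z' - p')) := by ring
    have := H₀ _ (sub_mem hz hz') (by rwa [← e])
    rw [← e] at this
    exact (min_le_left _ _).trans this

theorem infDist_add_of_invariant {Λ : AddSubgroup ℂ} {S : Set ℂ}
    (hS : ∀ G ∈ Λ, ∀ k ∈ S, k + G ∈ S) {G : ℂ} (hG : G ∈ Λ) (k : ℂ) :
    Metric.infDist (k + G) S = Metric.infDist k S := by
  have himg : (fun z => z + G) '' S = S := by
    ext z
    constructor
    · rintro ⟨y, hy, rfl⟩; exact hS G hG y hy
    · intro hz
      exact ⟨z + -G, hS _ (neg_mem hG) z hz, by ring⟩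
  have := Metric.infDist_image (isometry_add_right G) (x := k) (t := S)
  rwa [himg] at this

/-- An invariant continuous function that separates two disjoint invariant closed sets. -/
theorem exists_invariant_separation {Λ : AddSubgroup ℂ} {S T : Set ℂ} (hS : IsClosed S)
    (hT : IsClosed T) (hne : S.Nonempty) (hST : Disjoint S T)
    (hSΛ : ∀ G ∈ Λ, ∀ k ∈ S, k + G ∈ S) (hTΛ : ∀ G ∈ Λ, ∀ k ∈ T, k + G ∈ T) :
    ∃ s : ℂ → ℝ, Continuous s ∧ (∀ G ∈ Λ, ∀ k, s (k + G) = s k) ∧ (∀ k ∈ S, s k = 1) ∧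
      ∀ k ∈ T, ∀ᶠ k' in 𝓝 k, s k' = 0 := by
  rcases T.eq_empty_or_nonempty with rfl | hT'
  · exact ⟨fun _ => 1, continuous_const, by simp, by simp, by simp⟩
  set u : ℂ → ℝ := fun k => Metric.infDist k S
  set v : ℂ → ℝ := fun k => Metric.infDist k T
  have hu : Continuous u := Metric.continuous_infDist_pt S
  have hv : Continuous v := Metric.continuous_infDist_pt T
  have hu0 : ∀ k, 0 ≤ u k := fun k => Metric.infDist_nonneg
  have hv0 : ∀ k, 0 ≤ v k := fun k => Metric.infDist_nonneg
  have huS : ∀ k, u k = 0 ↔ k ∈ S := fun k => (hS.mem_iff_infDist_zero hne).symm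
  have hvT : ∀ k, v k = 0 ↔ k ∈ T := fun k => (hT.mem_iff_infDist_zero hT').symm
  have hpos : ∀ k, u k + v k ≠ 0 := by
    intro k h
    have h1 : u k = 0 := by linarith [hu0 k, hv0 k]
    have h2 : v k = 0 := by linarith [hu0 k, hv0 k]
    exact Set.disjoint_left.1 hST ((huS k).1 h1) ((hvT k).1 h2)
  refine ⟨fun k => max 0 ((v k - u k) / (u k + v k)),
    continuous_const.max ((hv.sub hu).div (hu.add hv) hpos), fun G hG k => ?_, fun k hk => ?_,
    fun k hk => ?_⟩
  · simp only [u, v, infDist_add_of_invariant hSΛ hG, infDist_add_of_invariant hTΛ hG]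
  · have h1 := (huS k).2 hk
    have h2 := hpos k
    simp only [h1, zero_add, sub_zero] at h2 ⊢
    rw [div_self h2]
    simp
  · have h1 := (hvT k).2 hk
    have h2 : 0 < u k := lt_of_le_of_ne (hu0 k) fun h => hpos k (by rw [h1, ← h, add_zero])
    have h3 : v k < u k := by rw [h1]; exact h2
    filter_upwards [hv.continuousAt.eventually_lt hu.continuousAt h3] with k' hk'
    refine max_eq_left (div_nonpos_of_nonpos_of_nonneg (by linarith) ?_)
    linarith [hu0 k', hv0 k']

/-- The zero of `d` at the origin is joined, in the set where `f conj d` is imaginary, to a point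
where `|d| ≥ |f|`. -/
theorem exists_joinedIn_norm_le {b : ℂ} (hb : b ≠ 0) {d f : ℂ → ℂ} (hd : Continuous d)
    (hf : Continuous f)
    (hper : ∀ G ∈ recipLattice b, ∀ k, ∃ c : ℂ, ‖c‖ = 1 ∧ d (k + G) = c * d k ∧
      f (k + G) = c * f k)
    (hz : HasTwoZeros b d) (hd0 : d 0 = 0) (hf0 : f 0 ≠ 0)
    (hreg : ∀ k, (f k * conj (d k)).re = 0 → ‖d k‖ ≤ ‖f k‖ → d k ≠ 0 →
      LocallyJoined {k | (f k * conj (d k)).re = 0} k) :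
    ∃ e, ‖f e‖ ≤ ‖d e‖ ∧ JoinedIn {k | (f k * conj (d k)).re = 0} 0 e := by
  by_contra! hcon
  set Z : Set ℂ := {k | (f k * conj (d k)).re = 0} with hZdef
  set Λ := recipLattice b
  obtain ⟨p₁, p₂, hp⟩ := hz.exists_representatives
  obtain ⟨ρ₀, hρ₀, hsep⟩ := exists_pos_forall_le_dist hb p₁ p₂
  have hsep' : ∀ z z', d z = 0 → d z' = 0 → dist z z' < ρ₀ → z = z' := fun z z' h h' hlt => by
    by_contra hne
    exact absurd (hsep z z' ((hp z).1 h) ((hp z').1 h') hne) (not_le.2 hlt)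
  have hZc : IsClosed Z := by
    have hc : Continuous fun k => (f k * conj (d k)).re :=
      Complex.continuous_re.comp (hf.mul (Complex.continuous_conj.comp hd))
    exact isClosed_eq hc continuous_const
  have hdZ : ∀ k, d k = 0 → k ∈ Z := fun k hk => by simp [hZdef, hk]
  have hdG : ∀ G ∈ Λ, ∀ k, ‖d (k + G)‖ = ‖d k‖ := fun G hG k => by
    obtain ⟨c, hc, h1, -⟩ := hper G hG k
    rw [h1, norm_mul, hc, one_mul]
  have hfG : ∀ G ∈ Λ, ∀ k, ‖f (k + G)‖ = ‖f k‖ := fun G hG k => by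
    obtain ⟨c, hc, -, h1⟩ := hper G hG k
    rw [h1, norm_mul, hc, one_mul]
  have hd0G : ∀ G ∈ Λ, ∀ k, d k = 0 → d (k + G) = 0 := fun G hG k hk => by
    rw [← norm_eq_zero, hdG G hG, hk, norm_zero]
  have hZG : ∀ G ∈ Λ, ∀ k ∈ Z, k + G ∈ Z := fun G hG k hk => by
    obtain ⟨c, hc, h1, h2⟩ := hper G hG k
    have hcc : c * conj c = 1 := by
      rw [Complex.mul_conj, Complex.normSq_eq_norm_sq, hc]; simp
    have : f (k + G) * conj (d (k + G)) = f k * conj (d k) := by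
      rw [h1, h2, map_mul]
      linear_combination f k * conj (d k) * hcc
    change (f (k + G) * conj (d (k + G))).re = 0
    rw [this]; exact hk
  have hJG : ∀ G ∈ Λ, ∀ {y z}, JoinedIn Z y z → JoinedIn Z (y + G) (z + G) :=
    fun G hG _ _ h => h.add_right (hZG G hG)
  -- the points joined to the lattice
  set R : Set ℂ := {e | ∃ G ∈ Λ, JoinedIn Z G e} with hR
  have hRJ : ∀ {y z}, y ∈ R → JoinedIn Z y z → z ∈ R := fun ⟨G, hG, h⟩ h' => ⟨G, hG, h.trans h'⟩
  have hRG : ∀ G ∈ Λ, ∀ k ∈ R, k + G ∈ R := fun G hG k ⟨G', hG', h⟩ =>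
    ⟨G' + G, add_mem hG' hG, hJG G hG h⟩
  have hRW : ∀ e ∈ R, ‖d e‖ < ‖f e‖ := by
    rintro e ⟨G, hG, h⟩
    have h1 := hJG (-G) (neg_mem hG) h
    rw [add_neg_cancel] at h1
    by_contra! hle
    refine hcon (e + -G) ?_ h1
    rw [hdG _ (neg_mem hG), hfG _ (neg_mem hG)]
    exact hle
  have h0R : (0 : ℂ) ∈ R := ⟨0, zero_mem _, JoinedIn.refl (hdZ 0 hd0)⟩
  -- a neighbourhood of a zero of `d` that is joined to the lattice
  have hA : ∀ p ∈ R, d p = 0 → ∃ r > 0, ∀ x, dist x p < r → ∀ e, JoinedIn Z e x →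
      ‖d e‖ < ‖f e‖ ∧ (d e = 0 → e ∈ R) := by
    intro p hpR hpd
    have hopen : {k | ‖d k‖ < ‖f k‖} ∈ 𝓝 p :=
      (isOpen_lt hd.norm hf.norm).mem_nhds (hRW p hpR)
    obtain ⟨τ', hτ', hball⟩ := Metric.mem_nhds_iff.1 hopen
    set τ := min τ' ρ₀
    have hτ : 0 < τ := lt_min hτ' hρ₀
    have hW : ∀ z, dist z p < τ → ‖d z‖ < ‖f z‖ := fun z hz =>
      hball (hz.trans_le (min_le_left _ _))
    have hne : ∀ z, dist z p < τ → d z = 0 → z = p := fun z hz h =>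
      hsep' z p h hpd (hz.trans_le (min_le_right _ _))
    have hgood : ∀ z ∈ Z, z ≠ p → dist z p < τ → LocallyJoined Z z := fun z hzZ hzp hz =>
      hreg z hzZ (hW z hz).le fun h => hzp (hne z hz h)
    -- Otherwise bad points are joined to points arbitrarily close to `p`. Their paths accumulate at
    -- a point `w` of a small circle with access to `p`, hence joined to `p`; then some bad point
    -- lies in `R` after all, where nothing is bad.
    by_contra! hbad
    obtain ⟨w, hwσ, hacc, e, he, hew⟩ := exists_crossing_limit (Z := Z) (p := p)
      (half_pos hτ) (half_lt_self hτ) (O := Set.univ)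
      (Y := {e | ¬(‖d e‖ < ‖f e‖ ∧ (d e = 0 → e ∈ R))}) (Set.subset_univ _)
      (fun w hw hwσ => hgood w
        (closure_minimal (by rintro v ⟨y, -, hv⟩; exact hv.target_mem.1) hZc hw)
        (dist_pos.1 (by rw [hwσ]; exact half_pos hτ)) (by rw [hwσ]; exact half_lt_self hτ))
      (fun e he => by
        by_contra! hlt
        have hlt' := hlt.trans (half_lt_self hτ)
        exact he ⟨hW e hlt', fun h => by rw [hne e hlt' h]; exact hpR⟩)
      (fun ε hε => by
        obtain ⟨x, hx, e, hex, he⟩ := hbad ε hε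
        refine ⟨x, hx, e, fun h => ?_, by rwa [Set.inter_univ]⟩
        obtain ⟨h1, h2⟩ := he h.1
        exact h2 (h.2 h1))
    rw [Set.inter_univ] at hew
    have hwp : JoinedIn Z w p := joinedIn_of_accesses (hdZ p hpd) hτ
      (fun v hv hvp hvτ => hgood v (closure_minimal (fun q hq => hq.target_mem) hZc hv) hvp hvτ)
      (fun ε hε => by
        obtain ⟨x, hx, h⟩ := hacc ε hε
        exact ⟨x, hx, h.mono Set.inter_subset_left⟩)
    have heR : e ∈ R := hRJ hpR (hew.trans hwp).symm
    exact he ⟨hRW e heR, fun _ => heR⟩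
  -- uniformity
  have hAu : ∃ r > 0, r ≤ ρ₀ / 2 ∧ ∀ p ∈ R, d p = 0 → ∀ x, dist x p < r → ∀ e, JoinedIn Z e x →
      ‖d e‖ < ‖f e‖ ∧ (d e = 0 → e ∈ R) := by
    have hrep : ∀ q, ∃ r > 0, q ∈ R → d q = 0 → ∀ x, dist x q < r → ∀ e, JoinedIn Z e x →
        ‖d e‖ < ‖f e‖ ∧ (d e = 0 → e ∈ R) := by
      intro q
      by_cases h : q ∈ R ∧ d q = 0
      · obtain ⟨r, hr, H⟩ := hA q h.1 h.2
        exact ⟨r, hr, fun _ _ => H⟩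
      · exact ⟨1, one_pos, fun h1 h2 => absurd ⟨h1, h2⟩ h⟩
    obtain ⟨r₁, hr₁, H₁⟩ := hrep p₁
    obtain ⟨r₂, hr₂, H₂⟩ := hrep p₂
    refine ⟨min (ρ₀ / 2) (min r₁ r₂), by positivity, min_le_left _ _,
      fun p hpR hpd x hx e hex => ?_⟩
    have hshift : ∀ q, p - q ∈ Λ → q ∈ R ∧ d q = 0 := fun q hq => by
      have h1 := hRG _ (neg_mem hq) p hpR
      have h2 := hd0G _ (neg_mem hq) p hpd
      rw [show p + -(p - q) = q by ring] at h1 h2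
      exact ⟨h1, h2⟩
    have main : ∀ q r, p - q ∈ Λ → dist x p < r → (q ∈ R → d q = 0 → ∀ x, dist x q < r →
        ∀ e, JoinedIn Z e x → ‖d e‖ < ‖f e‖ ∧ (d e = 0 → e ∈ R)) →
        ‖d e‖ < ‖f e‖ ∧ (d e = 0 → e ∈ R) := by
      intro q r hq hxr H
      have hq' := neg_mem hq
      obtain ⟨h1, h2⟩ := H (hshift q hq).1 (hshift q hq).2 (x + -(p - q)) (by
        rw [dist_eq_norm] at hxr ⊢
        rwa [show x + -(p - q) - q = x - p by ring]) (e + -(p - q)) (hJG _ hq' hex)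
      rw [hdG _ hq', hfG _ hq'] at h1
      refine ⟨h1, fun he => ?_⟩
      have h3 := hRG _ hq _ (h2 (hd0G _ hq' e he))
      rwa [neg_add_cancel_right] at h3
    rcases (hp p).1 hpd with h | h
    · exact main p₁ r₁ h (hx.trans_le ((min_le_right _ _).trans (min_le_left _ _))) H₁
    · exact main p₂ r₂ h (hx.trans_le ((min_le_right _ _).trans (min_le_right _ _))) H₂
  obtain ⟨r, hr, hrρ, hAr⟩ := hAu
  -- the enlarged set of points
  set Q : Set ℂ := {e | ∃ p ∈ R, d p = 0 ∧ ∃ x, dist x p < r ∧ JoinedIn Z e x} with hQ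
  have hQW : ∀ e ∈ Q, ‖d e‖ < ‖f e‖ ∧ (d e = 0 → e ∈ R) := by
    rintro e ⟨p, hpR, hpd, x, hx, h⟩
    exact hAr p hpR hpd x hx e h
  have hQJ : ∀ {y z}, z ∈ Q → JoinedIn Z y z → y ∈ Q := fun ⟨p, hpR, hpd, x, hx, h⟩ h' =>
    ⟨p, hpR, hpd, x, hx, h'.trans h⟩
  have hQZ : Q ⊆ Z := fun e ⟨_, _, _, _, _, h⟩ => h.source_mem
  have hQ0 : ∀ e ∈ R, d e = 0 → e ∈ Q := fun e he hde =>
    ⟨e, he, hde, e, by simpa using hr, JoinedIn.refl (hdZ e hde)⟩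
  have hQG : ∀ G ∈ Λ, ∀ k ∈ Q, k + G ∈ Q := fun G hG k ⟨p, hpR, hpd, x, hx, h⟩ =>
    ⟨p + G, hRG G hG p hpR, hd0G G hG p hpd, x + G, by rwa [dist_add_right], hJG G hG h⟩
  have hclQ : ∀ z ∈ closure Q, z ∈ Z ∧ ‖d z‖ ≤ ‖f z‖ := fun z hz =>
    ⟨closure_minimal hQZ hZc hz, closure_minimal (fun q hq => (hQW q hq).1.le)
      (isClosed_le hd.norm hf.norm) hz⟩
  have hQc : IsClosed Q := by
    refine isClosed_of_closure_subset fun z hz => ?_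
    obtain ⟨hzZ, hzle⟩ := hclQ z hz
    by_cases hzd : d z = 0
    swap
    · obtain ⟨η, hη, hj⟩ := hreg z hzZ hzle hzd 1 one_pos
      obtain ⟨y, hyQ, hy⟩ := Metric.mem_closure_iff.1 hz η hη
      rw [dist_comm] at hy
      exact hQJ hyQ ((hj y (hQZ hyQ) hy).mono Set.inter_subset_left)
    by_cases hzR : z ∈ R
    · exact hQ0 z hzR hzd
    -- A zero `z` of `d` outside `R` is at distance at least `ρ₀` from the zeros defining `Q`. Since
    -- `r ≤ ρ₀/2`, points of `Q` near `z` are joined to points at distance at least `ρ₀/2` from `z`;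
    -- the crossing paths accumulate and join `z` to `Q`, so `z` lies in `R` by the choice of `r`.
    exfalso
    have hρ4 : 0 < ρ₀ / 4 := by positivity
    have hgood : ∀ v ∈ closure Q, v ≠ z → dist v z < ρ₀ / 2 → LocallyJoined Z v := by
      intro v hv hvz hvρ
      obtain ⟨h1, h2⟩ := hclQ v hv
      exact hreg v h1 h2 fun h => hvz (hsep' v z h hzd (by linarith))
    obtain ⟨w, hwσ, hacc, x, hxY, hxw⟩ := exists_crossing_limit (Z := Z) (p := z) hρ4
      (by linarith : ρ₀ / 4 < ρ₀ / 2) (O := Set.univ)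
      (Y := {x | x ∈ Q ∧ ρ₀ / 2 ≤ dist x z}) (Set.subset_univ _)
      (fun w hw hwσ => hgood w (closure_mono (by
          rintro v ⟨y, hy, hv⟩
          rw [Set.inter_univ] at hv
          exact hQJ hy.1 hv.symm) hw)
        (dist_pos.1 (by rw [hwσ]; exact hρ4)) (by rw [hwσ]; linarith))
      (fun y hy => by linarith [hy.2])
      (fun ε hε => by
        obtain ⟨y, hyQ, hy⟩ := Metric.mem_closure_iff.1 hz ε hε
        rw [dist_comm] at hy
        obtain ⟨p, hpR, hpd, x, hx, hyx⟩ := hyQ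
        have hpz : ρ₀ ≤ dist p z := by
          by_contra! hlt
          rw [hsep' p z hpd hzd hlt] at hpR
          exact hzR hpR
        refine ⟨y, hy, x, ⟨⟨p, hpR, hpd, x, hx, JoinedIn.refl hyx.target_mem⟩, ?_⟩, ?_⟩
        · have := dist_triangle_left p z x
          linarith
        · rw [Set.inter_univ]; exact hyx.symm)
    rw [Set.inter_univ] at hxw
    have hwQ : w ∈ Q := hQJ hxY.1 hxw.symm
    have hwz : JoinedIn Z w z := joinedIn_of_accesses hzZ (half_pos hρ₀)
      (fun v hv hvz hvρ => hgood v (closure_mono (fun q hq => hQJ hwQ hq.symm) hv) hvz hvρ)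
      (fun ε hε => by
        obtain ⟨x, hx, h⟩ := hacc ε hε
        exact ⟨x, hx, h.mono Set.inter_subset_left⟩)
    exact hzR ((hQW z (hQJ hwQ hwz.symm)).2 hzd)
  have hQc' : IsClosed (Z \ Q) := by
    refine isClosed_of_closure_subset fun z hz => ?_
    have hzZ : z ∈ Z := closure_minimal Set.sdiff_subset hZc hz
    refine ⟨hzZ, fun hzQ => ?_⟩
    obtain ⟨h1, h2⟩ := hQW z hzQ
    by_cases hzd : d z = 0
    · obtain ⟨y, hy, hyr⟩ := Metric.mem_closure_iff.1 hz r hr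
      rw [dist_comm] at hyr
      exact hy.2 ⟨z, h2 hzd, hzd, y, hyr, JoinedIn.refl hy.1⟩
    · obtain ⟨η, hη, hj⟩ := hreg z hzZ h1.le hzd 1 one_pos
      obtain ⟨y, hy, hyη⟩ := Metric.mem_closure_iff.1 hz η hη
      rw [dist_comm] at hyη
      exact hy.2 (hQJ hzQ ((hj y hy.1 hyη).mono Set.inter_subset_left).symm)
  have h0Q : (0 : ℂ) ∈ Q := hQ0 0 h0R hd0
  obtain ⟨s, hs, hsG, hs1, hs0⟩ := exists_invariant_separation (Λ := Λ) hQc hQc' ⟨0, h0Q⟩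
    Set.disjoint_sdiff_right hQG (fun G hG k hk => ⟨hZG G hG k hk.1, fun h => hk.2 (by
      have := hQG _ (neg_mem hG) _ h
      rwa [add_neg_cancel_right] at this)⟩)
  -- A zero of `d + i s f` lies in `Z`. It is not in `Q`, where `s = 1` would give `|d| = |f|`, so
  -- it lies where `s` vanishes locally and the section equals `d`. At the origin the value is `i f
  -- 0 ≠ 0`.
  refine false_of_removed_zero hb (q := fun k => d k + Complex.I * s k * f k) hd
    (by fun_prop) (fun G hG k => ?_) hz hd0 ?_ (fun k hk => ?_)
  · obtain ⟨c, hc, h1, h2⟩ := hper G hG k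
    refine ⟨c, hc, h1, ?_⟩
    rw [h1, h2, hsG G hG]; ring
  · simp only [hd0, hs1 0 h0Q]
    simpa using hf0
  · have hdk : d k = -(Complex.I * s k * f k) := by linear_combination hk
    have hkZ : k ∈ Z := by
      change (f k * conj (d k)).re = 0
      rw [hdk]; simp; ring
    have hkQ : k ∉ Q := by
      intro hkQ
      have h1 := (hQW k hkQ).1
      rw [hdk, hs1 k hkQ] at h1
      simp at h1
    filter_upwards [hs0 k ⟨hkZ, hkQ⟩] with k' hk'
    rw [hk']; simp

section

variable {Hp Hm : Type*} [NormedAddCommGroup Hp] [InnerProductSpace ℂ Hp] [CompleteSpace Hp]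
  [NormedAddCommGroup Hm] [InnerProductSpace ℂ Hm] [CompleteSpace Hm] {B : MoireBands Hp}
  {C2 : Hp ≃ₗᵢ[ℂ] Hm} {g : ChernGauge B}

/-- If `f` vanishes at Γ_M, the constant path will do. Otherwise the path in `Re (f conj d) = 0`
starts with `|d| < |f|` and is stopped at the first time with `|d| = |f|`: up to then it stays in
`Σ`, and its end is a zero of `d + i f` or of `d - i f`. -/
theorem Admissible.hasNodalPath {x : MeanField Hp Hm} (hx : Admissible C2 g x)
    (hreg : PathRegular C2 g x) : HasNodalPath C2 g x := by
  have hd := (contDiff_dFun (C2 := C2) (g := g) hx.pairing.smooth).continuous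
  have hf := (contDiff_fFun (g := g) hx.band.smooth).continuous
  have hd0 : dFun C2 g x.Ppar 0 = 0 := hx.nematic.dFun_zero
  by_cases hf0 : fFun g x.Ph 0 = 0
  · refine ⟨fun _ => 0, continuousOn_const, rfl, fun t _ => ?_, Or.inl (by rw [hd0, hf0]; simp)⟩
    rw [mem_SigmaSet, hd0, hf0]
    simp
  have hψ : ContDiff ℝ 1 (reProd C2 g x) :=
    (contDiff_reProd hx.band.smooth hx.pairing.smooth).of_le (by exact_mod_cast le_top)
  obtain ⟨e, he, hj⟩ := exists_joinedIn_norm_le B.b_ne hd hf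
    (section_cocycle hx.band hx.pairing) hx.zeros hd0 hf0
    (fun k h0 hle hdk => locallyJoined_of_fderiv_ne_zero hψ h0 (hreg k h0 hle hdk))
  obtain ⟨γ, hγ, hγ0, hγ1, hγZ⟩ := hj.exists_path
  have hc : Continuous fun t => ‖fFun g x.Ph (γ t)‖ - ‖dFun C2 g x.Ppar (γ t)‖ :=
    (hf.comp hγ).norm.sub (hd.comp hγ).norm
  set φ : ℝ → ℝ := fun t => ‖fFun g x.Ph (γ t)‖ - ‖dFun C2 g x.Ppar (γ t)‖ with hφ
  -- the first time at which the two amplitudes agree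
  have hT : IsCompact ({t | φ t ≤ 0} ∩ Set.Icc (0 : ℝ) 1) :=
    isCompact_Icc.inter_left (isClosed_le hc continuous_const)
  obtain ⟨t₀, ⟨ht₀, h01⟩, hmin⟩ := hT.exists_isLeast ⟨1, by
    change φ 1 ≤ 0
    simp only [hφ]
    rw [hγ1 1 le_rfl]; linarith, by simp⟩
  have hφ0 : 0 < φ 0 := by
    simp only [hφ]
    rw [hγ0 0 le_rfl, hd0, norm_zero, sub_zero]
    exact norm_pos_iff.2 hf0
  have hφt : φ t₀ = 0 := by
    refine le_antisymm ht₀ ?_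
    by_contra! hlt
    obtain ⟨s, hs, hs0⟩ := intermediate_value_Icc' h01.1 hc.continuousOn ⟨hlt.le, hφ0.le⟩
    have := hmin ⟨hs0.le, hs.1, hs.2.trans h01.2⟩
    have hst : s = t₀ := le_antisymm hs.2 this
    rw [hst] at hs0
    exact hlt.ne hs0
  have hle : ∀ t ∈ Set.Icc 0 t₀, 0 ≤ φ t := by
    intro t ht
    by_contra! hlt
    have := hmin ⟨hlt.le, ht.1, ht.2.trans h01.2⟩
    rw [le_antisymm ht.2 this, hφt] at hlt
    exact lt_irrefl _ hlt
  refine ⟨fun t => γ (t * t₀), (by fun_prop : Continuous fun t => γ (t * t₀)).continuousOn,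
    by simpa using hγ0 0 le_rfl, fun t ht => ?_, ?_⟩
  · rw [mem_SigmaSet]
    refine ⟨hγZ _, ?_⟩
    have := hle (t * t₀) ⟨mul_nonneg ht.1 h01.1, mul_le_of_le_one_left h01.1 ht.2⟩
    simp only [hφ] at this
    linarith
  · simp only [one_mul]
    refine add_or_sub_eq_zero (hγZ _) ?_
    simp only [hφ] at hφt
    linarith

end

end

/-! ### The three statements together -/

theorem mainTheorem4 {Hp Hm : Type*}
    [NormedAddCommGroup Hp] [InnerProductSpace ℂ Hp] [CompleteSpace Hp]
    [NormedAddCommGroup Hm] [InnerProductSpace ℂ Hm] [CompleteSpace Hm]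
    (B : MoireBands Hp) (C2 : Hp ≃ₗᵢ[ℂ] Hm) (g : ChernGauge B) :
    -- for all admissible data: a zero of `Δ_∥` at `Γ_M`, and the energy window lies in `E(Σ)`
    (∀ x : MeanField Hp Hm, Admissible C2 g x →
      dFun C2 g x.Ppar 0 = 0 ∧
      Set.Icc (epsFun g x.Ph 0 - ‖fFun g x.Ph 0‖) (epsFun g x.Ph 0 + ‖fFun g x.Ph 0‖) ⊆
        ESigma C2 g x) ∧
    -- for generic admissible data (a dense countable intersection of open sets): the path in `Σ`
    (∃ U : ℕ → Set (MeanField Hp Hm),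
      (∀ n, RelOpen {x | Admissible C2 g x} (U n)) ∧
      RelDense {x | Admissible C2 g x} (⋂ n, U n) ∧
      ∀ x, Admissible C2 g x → x ∈ ⋂ n, U n → HasNodalPath C2 g x) ∧
    -- for an open dense set of admissible data: nodal superconductivity is enforced
    (∃ V : Set (MeanField Hp Hm),
      RelOpen {x | Admissible C2 g x} V ∧
      RelDense {x | Admissible C2 g x} V ∧
      ∀ x, Admissible C2 g x → x ∈ V → NodalEnforced C2 g x) := by
  refine ⟨fun x hx => ⟨hx.nematic.dFun_zero, hx.Icc_subset_ESigma⟩,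
    ⟨fun n => {x | ∀ k, 0 < pathFun C2 g (1 / (n + 1)) x k}, fun n => relOpen_pathFun_pos _,
      fun x hx r δ hδ => ?_, fun x hx hU => hx.hasNodalPath (pathRegular_iff.2 ?_)⟩,
    ⟨{x | NodeRegular C2 g x}, relOpen_nodeRegular, relDense_nodeRegular,
      fun x hx hV => hV.nodalEnforced hx⟩⟩
  · obtain ⟨y, ⟨hy, hreg⟩, hclose⟩ := relDense_pathRegular (C2 := C2) (g := g) x hx r δ hδ
    exact ⟨y, ⟨hy, Set.mem_iInter.2 fun n => pathRegular_iff.1 hreg n⟩, hclose⟩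
  · exact fun n => Set.mem_iInter.1 hU n
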